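/- Let $M$ be an oriented smooth $4$-manifold (Hausdorff, $\sigma$-compact, without boundary). Let $\Theta^{\alpha\beta}$ be a finite antisymmetric real constant matrix and $X_\alpha$ mutually commuting smooth real vector fields on $M$. The Abelian twist $\mathcal F=e^{-\frac{i\lambda}{2}\Theta^{\alpha\beta}X_\alpha\otimes X_\beta}$ defines, on formal power series in $\lambda$ of complex differential forms, the product $$\omega\wedge_\star\tau=\wedge\big(\mathcal F^{-1}(\omega\otimes\tau)\big)=\sum_{r\ge 0}\frac{1}{r!}\Big(\frac{i\lambda}{2}\Big)^r\Theta^{\alpha_1\beta_1}\cdots\Theta^{\alpha_r\beta_r}\,\mathcal L_{X_{\alpha_1}}\cdots\mathcal L_{X_{\alpha_r}}\omega\wedge\mathcal L_{X_{\beta_1}}\cdots\mathcal L_{X_{\beta_r}}\tau ,$$ written $\star$ if one factor is a function and combined with the matrix product for matrix-valued forms. The parameter $\lambda$ is formal and real: $\lambda^*=\lambda$. Let $\gamma_0,\dots,\gamma_3$ be complex $4\times4$ matrices with $\{\gamma_a,\gamma_b\}=2\eta_{ab}$, $\eta=\mathrm{diag}(1,-1,-1,-1)$, and $\gamma_a^\dagger=\gamma_0\gamma_a\gamma_0$.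 Put $\gamma_5=i\gamma_0\gamma_1\gamma_2\gamma_3$, $\gamma_{ab}=\frac12[\gamma_a,\gamma_b]$, and let $\epsilon_{abcd}$ be totally antisymmetric with $\epsilon_{0123}=1$. Let $(V,\Omega)$ be a noncommutative Cartan geometry, i.e. $$V=V^a\gamma_a+\tilde V^a\gamma_a\gamma_5,\qquad \Omega=\tfrac14\omega^{ab}\gamma_{ab}+i\omega 1+\tilde\omega\gamma_5,$$ where $V^a,\tilde V^a,\omega^{ab},\omega,\tilde\omega$ are formal power series in $\lambda$ of smooth one-forms, $V^\dagger=\gamma_0V\gamma_0$, $\Omega^\dagger=-\gamma_0\Omega\gamma_0$, and $\tilde V^a=\omega=\tilde\omega=0$ at order $\lambda^0$. Let $V^a_{(0)}$ be the $\lambda^0$-coefficient of $V^a$ and $\mathrm{vol}_{(0)}=V^a_{(0)}\wedge V^b_{(0)}\wedge V^c_{(0)}\wedge V^d_{(0)}\,\epsilon_{abcd}$. Dirac fields are $\psi\in C^\infty(M,\mathbb C^4)[[\lambda]]$, with $\overline\psi=\psi^\dagger\gamma_0$. Say that $\psi_1,\psi_2$ have compact overlapping support if the support of each $\lambda$-coefficient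 of $\psi_1$ meets that of each $\lambda$-coefficient of $\psi_2$ in a compact set; for such fields set $$\langle\psi_1,\psi_2\rangle=i\int_M\mathrm{Tr}\big(\psi_2\star\overline{\psi_1}\star V\wedge_\star V\wedge_\star V\wedge_\star V\,\gamma_5\big)\in\mathbb C[[\lambda]].$$ Then: (a) $\langle\psi_1,\psi_2\rangle^*=\langle\psi_2,\psi_1\rangle$ for all $\psi_1,\psi_2$ with compact overlapping support. (b) $\langle\psi_1,\psi_2\rangle=\int_M\overline{\psi_1}\,\psi_2\,\mathrm{vol}_{(0)}+\mathcal O(\lambda)$ for all $\psi_1,\psi_2$ with compact overlapping support, i.e. the $\lambda^0$-coefficient of $\langle\psi_1,\psi_2\rangle$ is $\int_M\overline{\psi_1}\psi_2\,\mathrm{vol}_{(0)}$ evaluated on the $\lambda^0$-coefficients of $\psi_1,\psi_2$. (c) Suppose that the classical vierbein is nondegenerate, i.e. $V^0_{(0)},\dots,V^3_{(0)}$ are linearly independent at every point of $M$. If $\psi_1$ is a Dirac field such that $\langle\psi_1,\psi_2\rangle=0$ for every Dirac field $\psi_2$ all of whose $\lambda$-coefficients have compact support, then $\psi_1=0$.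 -/

import Mathlib

open scoped Manifold ContDiff Nat

noncomputable section

namespace NCDirac

/-! ### Complex-valued exterior forms on a real topological vector space -/

section Algebra

variable {E : Type*} [AddCommGroup E] [Module ℝ E] [TopologicalSpace E]

/-- The product `(v₁, …, v_{p+q}) ↦ a (v₁, …, v_p) * b (v_{p+1}, …, v_{p+q})`. -/
def tensorProd {p q : ℕ} (a : E [⋀^Fin p]→L[ℝ] ℂ) (b : E [⋀^Fin q]→L[ℝ] ℂ) :
    ContinuousMultilinearMap ℝ (fun _ : Fin (p + q) => E) ℂ where
  toMultilinearMap :=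
    ((LinearMap.mul' ℝ ℂ).compMultilinearMap
      (MultilinearMap.domCoprod (a.toAlternatingMap : MultilinearMap ℝ (fun _ : Fin p => E) ℂ)
        (b.toAlternatingMap : MultilinearMap ℝ (fun _ : Fin q => E) ℂ))).domDomCongr
      finSumFinEquiv
  cont := by
    change Continuous fun v : Fin (p + q) → E =>
      a (fun i => v (Fin.castAdd q i)) * b (fun j => v (Fin.natAdd p j))
    exact (a.cont.comp (by fun_prop)).mul (b.cont.comp (by fun_prop))

theorem tensorProd_apply {p q : ℕ} (a : E [⋀^Fin p]→L[ℝ] ℂ) (b : E [⋀^Fin q]→L[ℝ] ℂ)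
    (v : Fin (p + q) → E) :
    tensorProd a b v = a (fun i => v (Fin.castAdd q i)) * b (fun j => v (Fin.natAdd p j)) :=
  rfl

/-- The exterior product, `(a ∧ b)(v) = 1/(p! q!) ∑_σ sgn(σ) a(v_{σ 1}, …, v_{σ p})
b(v_{σ (p+1)}, …, v_{σ (p+q)})`; so `(a₁ ∧ ⋯ ∧ a_n)(v) = det (a_i (v_j))` for covectors. -/
def wedgeAlt {p q : ℕ} (a : E [⋀^Fin p]→L[ℝ] ℂ) (b : E [⋀^Fin q]→L[ℝ] ℂ) :
    E [⋀^Fin (p + q)]→L[ℝ] ℂ :=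
  ((p ! * q ! : ℝ)⁻¹) • ContinuousMultilinearMap.alternatization (tensorProd a b)

end Algebra

/-! ### Oriented 4-manifolds, differential forms, Lie derivatives and integration -/

/-- The model space of 4-manifolds. -/
abbrev E4 : Type := EuclideanSpace ℝ (Fin 4)

section Manifold

variable (M : Type*) [TopologicalSpace M] [ChartedSpace E4 M]

/-- The atlas of `M` is oriented: all changes of charts have positive Jacobian determinant. -/
def OrientedAtlas : Prop :=
  ∀ e ∈ atlas E4 M, ∀ e' ∈ atlas E4 M, ∀ y ∈ (e.symm.trans e').source,
    0 < (fderiv ℝ (fun z => e' (e.symm z)) y).det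

/-- Complex-valued differential `k`-forms on `M` (not necessarily smooth). -/
abbrev DForm (k : ℕ) : Type _ := ∀ x : M, TangentSpace (𝓡 4) x [⋀^Fin k]→L[ℝ] ℂ

/-- Vector fields on `M` (not necessarily smooth). -/
abbrev VField : Type _ := ∀ x : M, TangentSpace (𝓡 4) x

variable {M}

namespace DForm

/-- The coordinate expression of a form in the preferred chart at `x₀`: its pullback along the
inverse of that chart. -/
def inChart {k : ℕ} (η : DForm M k) (x₀ : M) (y : E4) : E4 [⋀^Fin k]→L[ℝ] ℂ :=
  (η ((extChartAt (𝓡 4) x₀).symm y)).compContinuousLinearMap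
    (mfderiv 𝓘(ℝ, E4) (𝓡 4) (extChartAt (𝓡 4) x₀).symm y)

/-- Smoothness of a form: its coordinate expressions are smooth. -/
def IsSmooth {k : ℕ} (η : DForm M k) : Prop :=
  ∀ x₀ : M, ContDiffOn ℝ ∞ (DForm.inChart η x₀) (extChartAt (𝓡 4) x₀).target

/-- The exterior product of differential forms. -/
def wedge {p q : ℕ} (η : DForm M p) (τ : DForm M q) : DForm M (p + q) :=
  fun x => wedgeAlt (η x) (τ x)

/-- Pointwise complex conjugation of a form. -/
def conj {k : ℕ} (η : DForm M k) : DForm M k :=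
  fun x => (Complex.conjCLE : ℂ →L[ℝ] ℂ).compContinuousAlternatingMap (η x)

/-- A complex-valued function as a 0-form. -/
def ofFun (f : M → ℂ) : DForm M 0 :=
  fun x => ContinuousAlternatingMap.constOfIsEmpty ℝ (TangentSpace (𝓡 4) x) (Fin 0) (f x)

end DForm

/-- The Lie derivative on an open subset of `E4`:
`(L_X η)(v₁, …, v_k) = (D_X η)(v₁, …, v_k) + ∑ i, η(v₁, …, DX v_i, …, v_k)`. -/
def lieDerivCoord {k : ℕ} (X : E4 → E4) (η : E4 → E4 [⋀^Fin k]→L[ℝ] ℂ) (y : E4) :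
    E4 [⋀^Fin k]→L[ℝ] ℂ :=
  fderiv ℝ η y (X y) +
    (η y).fderivCompContinuousLinearMap (ContinuousLinearMap.id ℝ E4) (fderiv ℝ X y)

/-- The coordinate expression of a vector field in the preferred chart at `x₀`. -/
def VField.inChart (X : VField M) (x₀ : M) (y : E4) : E4 :=
  VectorField.mpullback 𝓘(ℝ, E4) (𝓡 4) (extChartAt (𝓡 4) x₀).symm X y

/-- The Lie derivative of a differential form along a vector field; its value at `x` is computed
in the preferred chart at `x`. -/
def lieDeriv {k : ℕ} (X : VField M) (η : DForm M k) : DForm M k :=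
  fun x => (lieDerivCoord (VField.inChart X x) (DForm.inChart η x)
    (extChartAt (𝓡 4) x x)).compContinuousLinearMap
      (mfderiv (𝓡 4) 𝓘(ℝ, E4) (extChartAt (𝓡 4) x) x)

/-- Smooth vector fields. -/
def VField.IsSmooth [IsManifold (𝓡 4) ∞ M] (X : VField M) : Prop :=
  ContMDiff (𝓡 4) (𝓡 4).tangent ∞ (fun x => (⟨x, X x⟩ : TangentBundle (𝓡 4) M))

section Integral

variable [IsManifold (𝓡 4) ∞ M] [T2Space M] [SigmaCompactSpace M]

/-- A smooth partition of unity subordinate to the preferred charts. -/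
def chartPartition (M : Type*) [TopologicalSpace M] [ChartedSpace E4 M]
    [IsManifold (𝓡 4) ∞ M] [T2Space M] [SigmaCompactSpace M] :
    SmoothPartitionOfUnity M (𝓡 4) M Set.univ :=
  (SmoothPartitionOfUnity.exists_isSubordinate_chartAt_source (𝓡 4) M).choose

/-- The integral over `M` (with an oriented atlas) of a compactly supported 4-form, by means of a
partition of unity. -/
def DForm.integral (η : DForm M 4) : ℂ :=
  ∑ᶠ i : M, ∫ y in (extChartAt (𝓡 4) i).target,
    ((chartPartition M i ((extChartAt (𝓡 4) i).symm y) : ℝ) : ℂ) *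
      DForm.inChart η i y (fun a => EuclideanSpace.single a (1 : ℝ))

end Integral

/-! ### The twist and the star product -/

/-- The data of an Abelian Drinfeld twist `exp(-(iλ/2) Θ^{αβ} X_α ⊗ X_β)` on `M`. -/
structure Twist (M : Type*) [TopologicalSpace M] [ChartedSpace E4 M] [IsManifold (𝓡 4) ∞ M]
    (ι : Type*) where
  Θ : ι → ι → ℝ
  antisymm : ∀ α β, Θ α β = -Θ β α
  X : ι → VField M
  smooth : ∀ α, VField.IsSmooth (X α)
  commute : ∀ α β, VectorField.mlieBracket (𝓡 4) (X α) (X β) = 0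

/-- Formal power series in `λ` whose coefficients are `k`-forms. -/
abbrev FormSeries (M : Type*) [TopologicalSpace M] [ChartedSpace E4 M] (k : ℕ) : Type _ :=
  ℕ → DForm M k

section Star

variable [IsManifold (𝓡 4) ∞ M] {ι : Type*} [Fintype ι]

/-- `∧ ((Θ^{αβ} X_α ⊗ X_β)^r (η ⊗ τ))`, the vector fields acting by Lie derivatives. -/
def bidiff (T : Twist M ι) {p q : ℕ} : ℕ → DForm M p → DForm M q → DForm M (p + q)
  | 0, η, τ => DForm.wedge η τ
  | r + 1, η, τ => ∑ α, ∑ β, ((T.Θ α β : ℝ) : ℂ) •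
      bidiff T r (lieDeriv (T.X α) η) (lieDeriv (T.X β) τ)

/-- The product `η ∧⋆ τ = ∧ (exp((iλ/2) Θ^{αβ} X_α ⊗ X_β) (η ⊗ τ))`, extended to formal power
series in `λ`; for functions (0-forms) it is the star product. -/
def starProd (T : Twist M ι) {p q : ℕ} (η : FormSeries M p) (τ : FormSeries M q) :
    FormSeries M (p + q) :=
  fun n => ∑ a ∈ Finset.HasAntidiagonal.antidiagonal n,
    ∑ b ∈ Finset.HasAntidiagonal.antidiagonal a.2,
    ((Complex.I / 2) ^ a.1 / (a.1 ! : ℂ)) • bidiff T a.1 (η b.1) (τ b.2)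

/-- Matrix product with respect to `∧⋆`. -/
def matStar (T : Twist M ι) {l m n : Type*} [Fintype m] {p q : ℕ}
    (A : Matrix l m (FormSeries M p)) (B : Matrix m n (FormSeries M q)) :
    Matrix l n (FormSeries M (p + q)) :=
  Matrix.of fun i j => ∑ k, starProd T (A i k) (B k j)

end Star

/-- Left multiplication of a matrix of forms by a constant matrix. -/
def constMul {l m n : Type*} [Fintype m] {p : ℕ} (g : Matrix l m ℂ)
    (A : Matrix m n (FormSeries M p)) : Matrix l n (FormSeries M p) :=
  Matrix.of fun i j => ∑ k, g i k • A k j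

/-- Right multiplication of a matrix of forms by a constant matrix. -/
def mulConst {l m n : Type*} [Fintype m] {p : ℕ}
    (A : Matrix l m (FormSeries M p)) (g : Matrix m n ℂ) : Matrix l n (FormSeries M p) :=
  Matrix.of fun i j => ∑ k, g k j • A i k

/-- Hermitian conjugate of a matrix of forms (`λ` is real). -/
def dagger {l m : Type*} {p : ℕ} (A : Matrix l m (FormSeries M p)) :
    Matrix m l (FormSeries M p) :=
  Matrix.of fun i j n => DForm.conj (A j i n)

end Manifold

/-! ### Gamma matrices -/

/-- Gamma matrices for the signature `(+,-,-,-)`. -/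
structure GammaMatrices where
  γ : Fin 4 → Matrix (Fin 4) (Fin 4) ℂ
  clifford : ∀ a b, γ a * γ b + γ b * γ a =
    (if a = b then (if a = 0 then 2 else -2) else 0 : ℂ) • (1 : Matrix (Fin 4) (Fin 4) ℂ)
  hermitian : ∀ a, (γ a).conjTranspose = γ 0 * γ a * γ 0

namespace GammaMatrices

/-- `γ₅ = i γ₀ γ₁ γ₂ γ₃`. -/
def γ₅ (G : GammaMatrices) : Matrix (Fin 4) (Fin 4) ℂ :=
  Complex.I • (G.γ 0 * G.γ 1 * G.γ 2 * G.γ 3)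

/-- `γ_{ab} = (1/2) [γ_a, γ_b]`. -/
def γ₂ (G : GammaMatrices) (a b : Fin 4) : Matrix (Fin 4) (Fin 4) ℂ :=
  (1 / 2 : ℂ) • (G.γ a * G.γ b - G.γ b * G.γ a)

end GammaMatrices

/-- The totally antisymmetric symbol with `ε 0 1 2 3 = 1`. -/
def levi (a b c d : Fin 4) : ℂ :=
  Matrix.det (Matrix.of fun i j : Fin 4 => if ![a, b, c, d] i = j then (1 : ℂ) else 0)

/-! ### Noncommutative Cartan geometries and Dirac fields -/

section Cartan

/-- A noncommutative Cartan geometry `(V, Ω)`, given by its components: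
`V = V^a γ_a + Ṽ^a γ_a γ₅` and `Ω = (1/4) ω^{ab} γ_{ab} + i ω 1 + ω̃ γ₅`, where `Va`, `Vt`, `wab`, `w`, `wt` are `V^a`, `Ṽ^a`,
`ω^{ab}`, `ω`, `ω̃`, formal power series in `λ` of one-forms. -/
structure CartanComponents (M : Type*) [TopologicalSpace M] [ChartedSpace E4 M] where
  Va : Fin 4 → FormSeries M 1
  Vt : Fin 4 → FormSeries M 1
  wab : Fin 4 → Fin 4 → FormSeries M 1
  w : FormSeries M 1
  wt : FormSeries M 1

variable {M : Type*} [TopologicalSpace M] [ChartedSpace E4 M]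

namespace CartanComponents

/-- The Clifford algebra valued one-form `V = V^a γ_a + Ṽ^a γ_a γ₅`. -/
def V (C : CartanComponents M) (G : GammaMatrices) : Matrix (Fin 4) (Fin 4) (FormSeries M 1) :=
  Matrix.of fun i j => ∑ a, (G.γ a i j • C.Va a + (G.γ a * G.γ₅) i j • C.Vt a)

/-- The Clifford algebra valued one-form `Ω = (1/4) ω^{ab} γ_{ab} + i ω 1 + ω̃ γ₅`. -/
def Ω (C : CartanComponents M) (G : GammaMatrices) : Matrix (Fin 4) (Fin 4) (FormSeries M 1) :=
  Matrix.of fun i j => (∑ a, ∑ b, ((1 / 4 : ℂ) * G.γ₂ a b i j) • C.wab a b) +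
    (Complex.I * (1 : Matrix (Fin 4) (Fin 4) ℂ) i j) • C.w + G.γ₅ i j • C.wt

/-- The classical volume form `V₀^a ∧ V₀^b ∧ V₀^c ∧ V₀^d ε_{abcd}`, where `V₀^a` is the
coefficient of `λ⁰` in `V^a`. -/
def vol₀ (C : CartanComponents M) : DForm M 4 :=
  ∑ a, ∑ b, ∑ c, ∑ d, levi a b c d •
    DForm.wedge (DForm.wedge (DForm.wedge (C.Va a 0) (C.Va b 0)) (C.Va c 0)) (C.Va d 0)

/-- The classical limit of `V` is a nondegenerate vierbein: its components form a coframe. -/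
def Nondegenerate (C : CartanComponents M) : Prop :=
  ∀ x : M, LinearIndependent ℝ (fun a => C.Va a 0 x)

end CartanComponents

/-- The defining conditions of a noncommutative Cartan geometry: smoothness, the reality conditions
`V† = γ₀ V γ₀`, `Ω† = -γ₀ Ω γ₀`, and `Ṽ^a = ω = ω̃ = 0` at order `λ⁰`. -/
structure IsCartanGeometry (G : GammaMatrices) (C : CartanComponents M) : Prop where
  smooth_Va : ∀ a n, DForm.IsSmooth (C.Va a n)
  smooth_Vt : ∀ a n, DForm.IsSmooth (C.Vt a n)
  smooth_wab : ∀ a b n, DForm.IsSmooth (C.wab a b n)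
  smooth_w : ∀ n, DForm.IsSmooth (C.w n)
  smooth_wt : ∀ n, DForm.IsSmooth (C.wt n)
  real_V : dagger (C.V G) = mulConst (constMul (G.γ 0) (C.V G)) (G.γ 0)
  real_Ω : dagger (C.Ω G) = -mulConst (constMul (G.γ 0) (C.Ω G)) (G.γ 0)
  limit_Vt : ∀ a, C.Vt a 0 = 0
  limit_w : C.w 0 = 0
  limit_wt : C.wt 0 = 0

/-- Dirac fields: formal power series in `λ` of smooth functions `M → ℂ⁴`. -/
abbrev DiracField (M : Type*) [TopologicalSpace M] [ChartedSpace E4 M] : Type _ :=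
  ℕ → C^∞⟮𝓡 4, M; 𝓘(ℝ, Fin 4 → ℂ), Fin 4 → ℂ⟯

/-- A Dirac field as a column of 0-forms. -/
def column (ψ : DiracField M) : Matrix (Fin 4) (Fin 1) (FormSeries M 0) :=
  Matrix.of fun i _ n => DForm.ofFun fun x => ψ n x i

/-- The Dirac adjoint `ψ̄ = ψ† γ₀`, as a row of 0-forms. -/
def diracAdjoint (G : GammaMatrices) (ψ : DiracField M) : Matrix (Fin 1) (Fin 4) (FormSeries M 0) :=
  mulConst (dagger (column ψ)) (G.γ 0)

/-- Compact overlapping support: at all orders in `λ` the supports have compact intersection. -/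
def CompactOverlap (ψ₁ ψ₂ : DiracField M) : Prop :=
  ∀ m n, IsCompact (tsupport (ψ₁ m) ∩ tsupport (ψ₂ n))

variable [IsManifold (𝓡 4) ∞ M] [T2Space M] [SigmaCompactSpace M]

/-- The four-form `Tr(ψ₂ ⋆ ψ̄₁ ⋆ V ∧⋆ V ∧⋆ V ∧⋆ V γ₅)`, a formal power series in `λ`. -/
def innerForm {ι : Type*} [Fintype ι] (G : GammaMatrices) (T : Twist M ι)
    (C : CartanComponents M) (ψ₁ ψ₂ : DiracField M) : FormSeries M 4 :=
  ∑ i, mulConst (matStar T (matStar T (matStar T (matStar T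
    (matStar T (column ψ₂) (diracAdjoint G ψ₁)) (C.V G)) (C.V G)) (C.V G)) (C.V G)) G.γ₅ i i

/-- The inner product `⟨ψ₁, ψ₂⟩ = i ∫ Tr(ψ₂ ⋆ ψ̄₁ ⋆ V ∧⋆ V ∧⋆ V ∧⋆ V γ₅)` with values in formal
power series in `λ`. -/
def diracInner {ι : Type*} [Fintype ι] (G : GammaMatrices) (T : Twist M ι)
    (C : CartanComponents M) (ψ₁ ψ₂ : DiracField M) : PowerSeries ℂ :=
  PowerSeries.mk fun n => Complex.I * DForm.integral (innerForm G T C ψ₁ ψ₂ n)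

/-- The classical inner product `∫ φ̄₁ φ₂ vol₀` of two spinor fields. -/
def classicalInner (G : GammaMatrices) (C : CartanComponents M) (φ₁ φ₂ : M → Fin 4 → ℂ) : ℂ :=
  DForm.integral fun x =>
    (Matrix.vecMul (fun i => (starRingEnd ℂ) (φ₁ x i)) (G.γ 0) ⬝ᵥ φ₂ x) • C.vol₀ x

end Cartan

end NCDirac

end

/-! Write `c = i/2`. On constant (λ-independent) factors a left-nested star product is `exp(λ c P)`
followed by the wedge product, where `P` is the sum over pairs of factors `s < t` of `Θ^{αβ} L_α ⊗
L_β` acting in the slots `s` and `t`; the Lie derivatives commute, so these operators commute. The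
notion `IsTwistFlow` records exactly this: equivariance under the total Lie derivative and the
recursion `(r+1) F_{r+1} = c F_r P`.

Hermiticity (a). Conjugation replaces `c` by `-c`. For two functions the antisymmetry of `Θ` turns
this into exchange of the factors, so `(ψ₂ ⋆ ψ₁†)† = ψ₁ ⋆ ψ₂†`. For `∫ h ⋆ v₁ ∧⋆ v₂ ∧⋆ v₃ ∧⋆ v₄` it
turns into reversal of the four one-forms with `h` kept in front (`flow_reverse`,
`fourStar_reverse`). Couplings among the `v`'s change sign under reversal. Couplings of `h` with the
`v`'s add up, by Stokes' theorem `∫ L_X = 0`, to `-Θ^{αβ} L_α L_β h = 0`. At order zero the reversal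
of four covectors is an even permutation. It remains to do matrix algebra
(`sum_matPairing_sandwich`): with `V† = γ₀ V γ₀` the inner factors `γ₀` cancel, and moving `γ₅` past
one `γ₀` and four `V`'s costs five signs. The resulting `-1` cancels against the conjugate of the
prefactor `i`.

Stokes' theorem (`integral_lieDeriv_eq_zero`) rests on three facts: the coordinate formula for
`lieDeriv` holds in every preferred chart, the Lie derivative of a top-degree form is a divergence,
and a partition of unity localises the integral. Orientation enters through the positive Jacobians
in the independence of the chart.

Leading order (b), (c). If `ψ₁` vanishes below order `n`, every contraction with `Θ` costs a power
of `λ`, so the coefficient of `λ^n` contains only the `n`-th coefficient of `ψ₁`, the zeroth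
coefficients of `ψ₂` and `V`, and undeformed products. Since `V` is `V^a γ_a` at order zero,
antisymmetry yields `24 γ₀γ₁γ₂γ₃` times the frame determinant; now `γ₀γ₁γ₂γ₃ = -iγ₅`, `γ₅² = 1` and
`vol₀` is `24` times the same determinant. Hence the coefficient is the classical inner product
(`coeff_diracInner`). The case `n = 0` is (b). For (c), strong induction on `n` with `λ`-independent
test fields reduces the claim to the classical pairing, which is nondegenerate because the real
classical vierbein has nowhere vanishing volume form. -/

noncomputable section

namespace NCDirac

/-! ### Exterior algebra at a point -/

section PointwiseAlgebra

variable {E F : Type*} [AddCommGroup E] [Module ℝ E] [TopologicalSpace E]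
  [AddCommGroup F] [Module ℝ F] [TopologicalSpace F] {p q : ℕ}

theorem wedgeAlt_apply (a : E [⋀^Fin p]→L[ℝ] ℂ) (b : E [⋀^Fin q]→L[ℝ] ℂ)
    (v : Fin (p + q) → E) :
    wedgeAlt a b v = ((p ! * q ! : ℝ) : ℂ)⁻¹ * ∑ σ : Equiv.Perm (Fin (p + q)),
      ((Equiv.Perm.sign σ : ℤ) : ℂ) *
        (a (fun i => v (σ (Fin.castAdd q i))) * b (fun j => v (σ (Fin.natAdd p j)))) := by
  simp only [wedgeAlt, ContinuousAlternatingMap.smul_apply,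
    ContinuousMultilinearMap.alternatization_apply_apply, tensorProd_apply, Complex.real_smul,
    Complex.ofReal_inv, Units.smul_def, zsmul_eq_mul, Function.comp_apply]

theorem wedgeAlt_add_left (a a' : E [⋀^Fin p]→L[ℝ] ℂ) (b : E [⋀^Fin q]→L[ℝ] ℂ) :
    wedgeAlt (a + a') b = wedgeAlt a b + wedgeAlt a' b := by
  ext v
  simp only [wedgeAlt_apply, ContinuousAlternatingMap.add_apply, add_mul, mul_add,
    Finset.sum_add_distrib]

theorem wedgeAlt_add_right (a : E [⋀^Fin p]→L[ℝ] ℂ) (b b' : E [⋀^Fin q]→L[ℝ] ℂ) :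
    wedgeAlt a (b + b') = wedgeAlt a b + wedgeAlt a b' := by
  ext v
  simp only [wedgeAlt_apply, ContinuousAlternatingMap.add_apply, mul_add,
    Finset.sum_add_distrib]

theorem wedgeAlt_smul_left (c : ℂ) (a : E [⋀^Fin p]→L[ℝ] ℂ) (b : E [⋀^Fin q]→L[ℝ] ℂ) :
    wedgeAlt (c • a) b = c • wedgeAlt a b := by
  ext v
  simp only [wedgeAlt_apply, ContinuousAlternatingMap.smul_apply, smul_eq_mul, Finset.mul_sum]
  exact Finset.sum_congr rfl fun σ _ => by ring

theorem wedgeAlt_smul_right (c : ℂ) (a : E [⋀^Fin p]→L[ℝ] ℂ) (b : E [⋀^Fin q]→L[ℝ] ℂ) :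
    wedgeAlt a (c • b) = c • wedgeAlt a b := by
  ext v
  simp only [wedgeAlt_apply, ContinuousAlternatingMap.smul_apply, smul_eq_mul, Finset.mul_sum]
  exact Finset.sum_congr rfl fun σ _ => by ring

/-- The exterior product as a bilinear map. -/
def wedgeAltₗ (E : Type*) [AddCommGroup E] [Module ℝ E] [TopologicalSpace E] (p q : ℕ) :
    (E [⋀^Fin p]→L[ℝ] ℂ) →ₗ[ℂ] (E [⋀^Fin q]→L[ℝ] ℂ) →ₗ[ℂ] (E [⋀^Fin (p + q)]→L[ℝ] ℂ) :=
  LinearMap.mk₂ ℂ wedgeAlt wedgeAlt_add_left wedgeAlt_smul_left wedgeAlt_add_right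
    fun c a b => wedgeAlt_smul_right c a b

theorem wedgeAlt_zero_left (b : E [⋀^Fin q]→L[ℝ] ℂ) :
    wedgeAlt (0 : E [⋀^Fin p]→L[ℝ] ℂ) b = 0 := (wedgeAltₗ E p q).map_zero₂ b

theorem wedgeAlt_zero_right (a : E [⋀^Fin p]→L[ℝ] ℂ) :
    wedgeAlt a (0 : E [⋀^Fin q]→L[ℝ] ℂ) = 0 := (wedgeAltₗ E p q a).map_zero

theorem wedgeAlt_compContinuousLinearMap (a : F [⋀^Fin p]→L[ℝ] ℂ) (b : F [⋀^Fin q]→L[ℝ] ℂ)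
    (f : E →L[ℝ] F) :
    (wedgeAlt a b).compContinuousLinearMap f =
      wedgeAlt (a.compContinuousLinearMap f) (b.compContinuousLinearMap f) := by
  ext v
  simp only [wedgeAlt_apply, ContinuousAlternatingMap.compContinuousLinearMap_apply]
  rfl

theorem conj_wedgeAlt (a : E [⋀^Fin p]→L[ℝ] ℂ) (b : E [⋀^Fin q]→L[ℝ] ℂ) :
    (Complex.conjCLE : ℂ →L[ℝ] ℂ).compContinuousAlternatingMap (wedgeAlt a b) =
      wedgeAlt ((Complex.conjCLE : ℂ →L[ℝ] ℂ).compContinuousAlternatingMap a)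
        ((Complex.conjCLE : ℂ →L[ℝ] ℂ).compContinuousAlternatingMap b) := by
  ext v
  simp [wedgeAlt_apply]

/-- The exterior product with a covector on the right, for a form given as an alternating sum. -/
theorem wedgeAlt_covector_apply {a : E [⋀^Fin p]→L[ℝ] ℂ} {m : (Fin p → E) → ℂ}
    (h : ∀ v, a v = ∑ σ : Equiv.Perm (Fin p), ((Equiv.Perm.sign σ : ℤ) : ℂ) * m (fun i => v (σ i)))
    (b : E [⋀^Fin 1]→L[ℝ] ℂ) (v : Fin (p + 1) → E) :
    wedgeAlt a b v = ∑ σ : Equiv.Perm (Fin (p + 1)), ((Equiv.Perm.sign σ : ℤ) : ℂ) *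
      (m (fun i => v (σ (Fin.castAdd 1 i))) * b (fun j => v (σ (Fin.natAdd p j)))) := by
  rw [wedgeAlt_apply]
  simp only [h, Finset.sum_mul, Finset.mul_sum]
  rw [Finset.sum_comm]
  -- A permutation `τ` of the first `p` slots extends to `τ'` fixing the last one and is absorbed by
  -- `σ ↦ σ τ'`. All `p!` values of `τ` therefore contribute equally and cancel the normalisation.
  have key : ∀ τ : Equiv.Perm (Fin p), ∑ σ : Equiv.Perm (Fin (p + 1)),
      ((p ! * 1 ! : ℝ) : ℂ)⁻¹ * (((Equiv.Perm.sign σ : ℤ) : ℂ) *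
        (((Equiv.Perm.sign τ : ℤ) : ℂ) * m (fun i => v (σ (Fin.castAdd 1 (τ i)))) *
          b (fun j => v (σ (Fin.natAdd p j))))) =
      ∑ σ : Equiv.Perm (Fin (p + 1)), (p ! : ℂ)⁻¹ * (((Equiv.Perm.sign σ : ℤ) : ℂ) *
        (m (fun i => v (σ (Fin.castAdd 1 i))) * b (fun j => v (σ (Fin.natAdd p j))))) := by
    intro τ
    let τ' : Equiv.Perm (Fin (p + 1)) :=
      finSumFinEquiv.permCongr (Equiv.Perm.sumCongr τ (1 : Equiv.Perm (Fin 1)))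
    have hl : ∀ i, τ' (Fin.castAdd 1 i) = Fin.castAdd 1 (τ i) := fun i => by
      simp [τ', Equiv.permCongr_apply]
    have hr : ∀ j, τ' (Fin.natAdd p j) = Fin.natAdd p j := fun j => by
      simp [τ', Equiv.permCongr_apply]
    have hs : Equiv.Perm.sign τ' = Equiv.Perm.sign τ := by
      simp [τ', Equiv.Perm.sign_permCongr, Equiv.Perm.sign_sumCongr]
    rw [← Equiv.sum_comp (Equiv.mulRight τ') (fun σ : Equiv.Perm (Fin (p + 1)) =>
      (p ! : ℂ)⁻¹ * (((Equiv.Perm.sign σ : ℤ) : ℂ) *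
        (m (fun i => v (σ (Fin.castAdd 1 i))) * b (fun j => v (σ (Fin.natAdd p j))))))]
    refine Finset.sum_congr rfl fun σ _ => ?_
    simp only [Equiv.coe_mulRight, Equiv.Perm.coe_mul, Function.comp_apply, hl, hr, hs,
      Equiv.Perm.sign_mul, Units.val_mul, Int.cast_mul, Nat.factorial_one, Nat.cast_one, mul_one,
      Complex.ofReal_natCast]
    ring
  rw [Finset.sum_congr rfl fun τ _ => key τ, Finset.sum_const, Finset.card_univ,
    Fintype.card_perm, Fintype.card_fin, nsmul_eq_mul, ← Finset.mul_sum, ← mul_assoc,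
    mul_inv_cancel₀ (by exact_mod_cast Nat.factorial_ne_zero p), one_mul]

/-- A 0-form is multiplication by its value. -/
theorem wedgeAlt_four_apply (h : E [⋀^Fin 0]→L[ℝ] ℂ) (b : Fin 4 → E [⋀^Fin 1]→L[ℝ] ℂ)
    (v : Fin 4 → E) :
    wedgeAlt (wedgeAlt (wedgeAlt (wedgeAlt h (b 0)) (b 1)) (b 2)) (b 3) v =
      h ![] * (Matrix.of fun i j : Fin 4 => b i (fun _ => v j)).det := by
  have h0 : ∀ w : Fin 0 → E, h w = ∑ σ : Equiv.Perm (Fin 0), ((Equiv.Perm.sign σ : ℤ) : ℂ) *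
      (fun _ => h ![]) (fun i => w (σ i)) := fun w => by
    simp [Subsingleton.elim w ![]]
  -- The functions `m` collect the product before antisymmetrisation. Each further covector thus
  -- yields a single signed sum again, and the last one is the Leibniz expansion of the determinant.
  have h1 := wedgeAlt_covector_apply (m := fun _ => h ![]) h0 (b 0)
  have h2 := wedgeAlt_covector_apply (m := fun w => h ![] * b 0 (fun j => w (Fin.natAdd 0 j)))
    h1 (b 1)
  have h3 := wedgeAlt_covector_apply (m := fun w => h ![] * b 0 (fun j => w (Fin.castAdd 1
    (Fin.natAdd 0 j))) * b 1 (fun j => w (Fin.natAdd 1 j))) h2 (b 2)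
  have h4 := wedgeAlt_covector_apply (m := fun w => h ![] * b 0 (fun j => w (Fin.castAdd 1
    (Fin.castAdd 1 (Fin.natAdd 0 j)))) * b 1 (fun j => w (Fin.castAdd 1 (Fin.natAdd 1 j))) *
    b 2 (fun j => w (Fin.natAdd 2 j))) h3 (b 3) v
  refine h4.trans ?_
  rw [← Matrix.det_transpose, Matrix.det_apply', Finset.mul_sum]
  refine Finset.sum_congr rfl fun (σ : Equiv.Perm (Fin 4)) _ => ?_
  simp only [Fin.prod_univ_four, Matrix.transpose_apply, Matrix.of_apply]
  have e : ∀ (c : E [⋀^Fin 1]→L[ℝ] ℂ) (w : Fin 1 → E), c w = c (fun _ => w 0) := fun c w => by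
    congr 1; ext i; rw [Subsingleton.elim i 0]
  rw [e (b 0), e (b 1), e (b 2), e (b 3)]
  change _ * (h ![] * b 0 (fun _ => v (σ 0)) * b 1 (fun _ => v (σ 1)) * b 2 (fun _ => v (σ 2)) *
    b 3 (fun _ => v (σ 3))) = _
  ring

theorem wedgeAlt_zero_form_apply (a b : E [⋀^Fin 0]→L[ℝ] ℂ) (v : Fin (0 + 0) → E) :
    wedgeAlt a b v = a ![] * b ![] := by
  have : Subsingleton (Fin (0 + 0)) := inferInstanceAs (Subsingleton (Fin 0))
  rw [wedgeAlt_apply, Fintype.sum_subsingleton _ (1 : Equiv.Perm (Fin (0 + 0)))]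
  simp only [Equiv.Perm.sign_one]
  rw [Subsingleton.elim (fun i => v ((1 : Equiv.Perm (Fin (0 + 0))) (Fin.castAdd 0 i))) ![],
    Subsingleton.elim (fun i => v ((1 : Equiv.Perm (Fin (0 + 0))) (Fin.natAdd 0 i))) ![]]
  simp

theorem wedgeAlt_zero_form_left (a : E [⋀^Fin 0]→L[ℝ] ℂ) (b : E [⋀^Fin 1]→L[ℝ] ℂ)
    (v : Fin (0 + 1) → E) : wedgeAlt a b v = a ![] * b v := by
  have : Subsingleton (Fin (0 + 1)) := inferInstanceAs (Subsingleton (Fin 1))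
  rw [wedgeAlt_apply, Fintype.sum_subsingleton _ (1 : Equiv.Perm (Fin (0 + 1)))]
  simp only [Equiv.Perm.sign_one]
  rw [Subsingleton.elim (fun i => v ((1 : Equiv.Perm (Fin (0 + 1))) (Fin.castAdd 1 i))) ![]]
  have : (fun j => v ((1 : Equiv.Perm (Fin (0 + 1))) (Fin.natAdd 0 j))) = v := by
    ext j; simp
  simp

end PointwiseAlgebra

/-! ### Lie derivatives of forms in coordinates on ℝ⁴ -/

section CoordinateCalculus

open Filter Topology ContinuousAlternatingMap

/-- Finite dimensionality makes linear and bilinear maps on forms continuous, hence smooth. This is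
how `wedgeAltL` and `volCoeff` arise. -/
instance finiteDimensional_continuousAlternatingMap (k : ℕ) :
    FiniteDimensional ℝ (E4 [⋀^Fin k]→L[ℝ] ℂ) :=
  let f : (E4 [⋀^Fin k]→L[ℝ] ℂ) →ₗ[ℝ] MultilinearMap ℝ (fun _ : Fin k => E4) ℂ :=
    { toFun := fun a => a.toContinuousMultilinearMap.toMultilinearMap
      map_add' := fun _ _ => rfl
      map_smul' := fun _ _ => rfl }
  FiniteDimensional.of_injective f fun a b h => by
    ext v; exact congrArg (fun m : MultilinearMap ℝ (fun _ : Fin k => E4) ℂ => m v) h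

theorem ofReal_smul_form {E : Type*} [AddCommGroup E] [Module ℝ E] [TopologicalSpace E] {k : ℕ}
    (c : ℝ) (a : E [⋀^Fin k]→L[ℝ] ℂ) : (c : ℂ) • a = c • a := by
  ext v
  simp only [ContinuousAlternatingMap.smul_apply, smul_eq_mul, Complex.real_smul]

/-- The exterior product on `E4` as a continuous bilinear map. -/
def wedgeAltL (p q : ℕ) : (E4 [⋀^Fin p]→L[ℝ] ℂ) →L[ℝ] (E4 [⋀^Fin q]→L[ℝ] ℂ) →L[ℝ]
    (E4 [⋀^Fin (p + q)]→L[ℝ] ℂ) :=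
  LinearMap.toContinuousBilinearMap
    (LinearMap.mk₂ ℝ wedgeAlt wedgeAlt_add_left
      (fun c a b => by
        rw [← ofReal_smul_form, wedgeAlt_smul_left, ofReal_smul_form]) wedgeAlt_add_right
      (fun c a b => by
        rw [← ofReal_smul_form, wedgeAlt_smul_right, ofReal_smul_form]))

theorem wedgeAltL_apply {p q : ℕ} (a : E4 [⋀^Fin p]→L[ℝ] ℂ) (b : E4 [⋀^Fin q]→L[ℝ] ℂ) :
    wedgeAltL p q a b = wedgeAlt a b := rfl

variable {k : ℕ}

/-- The derivation action of an endomorphism on alternating forms, as a continuous bilinear map. -/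
def derivAction (k : ℕ) : (E4 [⋀^Fin k]→L[ℝ] ℂ) →L[ℝ] (E4 →L[ℝ] E4) →L[ℝ]
    (E4 [⋀^Fin k]→L[ℝ] ℂ) :=
  fderivCompContinuousLinearMapCLM ℂ (ContinuousLinearMap.id ℝ E4)

theorem derivAction_apply (a : E4 [⋀^Fin k]→L[ℝ] ℂ) (A : E4 →L[ℝ] E4) (v : Fin k → E4) :
    derivAction k a A v = ∑ i, a (Function.update v i (A (v i))) := by
  simp only [derivAction, fderivCompContinuousLinearMapCLM_apply,
    fderivCompContinuousLinearMap_apply]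
  refine Finset.sum_congr rfl fun i _ => congrArg a (funext fun j => ?_)
  rcases eq_or_ne j i with rfl | h
  · simp
  · simp [h]

theorem lieDerivCoord_eq (X : E4 → E4) (η : E4 → E4 [⋀^Fin k]→L[ℝ] ℂ) (y : E4) :
    lieDerivCoord X η y = fderiv ℝ η y (X y) + derivAction k (η y) (fderiv ℝ X y) := rfl

/-- Together with `derivAction_comp_right` this expresses both composites through the derivative of
`g ↦ g^* a` at `g`, the common form in which the two sides of `lieDerivCoord_pullback` are compared.
-/
theorem derivAction_comp_left (a : E4 [⋀^Fin k]→L[ℝ] ℂ) (g A : E4 →L[ℝ] E4) :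
    derivAction k (a.compContinuousLinearMap g) A =
      a.fderivCompContinuousLinearMap g (g.comp A) := by
  ext v
  simp only [derivAction_apply, fderivCompContinuousLinearMap_apply,
    compContinuousLinearMap_apply]
  refine Finset.sum_congr rfl fun i _ => congrArg a (funext fun j => ?_)
  rcases eq_or_ne j i with rfl | h
  · simp
  · simp [h]

theorem derivAction_comp_right (a : E4 [⋀^Fin k]→L[ℝ] ℂ) (g A : E4 →L[ℝ] E4) :
    (derivAction k a A).compContinuousLinearMap g =
      a.fderivCompContinuousLinearMap g (A.comp g) := by
  ext v
  simp only [derivAction_apply, fderivCompContinuousLinearMap_apply,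
    compContinuousLinearMap_apply]
  refine Finset.sum_congr rfl fun i _ => congrArg a (funext fun j => ?_)
  rcases eq_or_ne j i with rfl | h
  · simp
  · simp [h]

/-- Expand into a sum over pairs of slots. Terms with distinct slots are symmetric in `A` and `B`
and cancel; the terms with both endomorphisms in one slot leave the commutator. Its sign is that of
a right action. -/
theorem derivAction_commutator (a : E4 [⋀^Fin k]→L[ℝ] ℂ) (A B : E4 →L[ℝ] E4) :
    derivAction k (derivAction k a B) A - derivAction k (derivAction k a A) B =
      derivAction k a (B.comp A - A.comp B) := by
  ext v
  have key : ∀ A B : E4 →L[ℝ] E4, derivAction k (derivAction k a B) A v =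
      ∑ i, ∑ j, if j = i then a (Function.update v i (B (A (v i)))) else
        a (Function.update (Function.update v i (A (v i))) j (B (v j))) := by
    intro A B
    simp only [derivAction_apply]
    refine Finset.sum_congr rfl fun i _ => Finset.sum_congr rfl fun j _ => ?_
    split_ifs with h
    · subst h; simp
    · simp [h]
  have diag : ∀ A B : E4 →L[ℝ] E4, derivAction k (derivAction k a B) A v =
      (∑ i, a (Function.update v i (B (A (v i))))) + ∑ i, ∑ j, if j = i then 0 else
        a (Function.update (Function.update v i (A (v i))) j (B (v j))) := by
    intro A B
    rw [key, ← Finset.sum_add_distrib]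
    refine Finset.sum_congr rfl fun i _ => ?_
    rw [← Finset.sum_erase_add _ _ (Finset.mem_univ i),
      ← Finset.sum_erase_add (s := Finset.univ) (a := i) (f := fun j => if j = i then (0 : ℂ) else
        a (Function.update (Function.update v i (A (v i))) j (B (v j)))) (Finset.mem_univ i)]
    simp only [if_true, add_zero]
    rw [add_comm]
    congr 1
    refine Finset.sum_congr rfl fun j hj => ?_
    simp [Finset.ne_of_mem_erase hj]
  rw [ContinuousAlternatingMap.sub_apply, diag A B, diag B A, derivAction_apply]
  have swap : (∑ i, ∑ j, if j = i then 0 else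
      a (Function.update (Function.update v i (A (v i))) j (B (v j)))) =
      ∑ i, ∑ j, if j = i then 0 else
        a (Function.update (Function.update v i (B (v i))) j (A (v j))) := by
    rw [Finset.sum_comm]
    refine Finset.sum_congr rfl fun i _ => Finset.sum_congr rfl fun j _ => ?_
    rcases eq_or_ne j i with rfl | h
    · simp
    · rw [if_neg h, if_neg h.symm, Function.update_comm h]
  rw [swap, add_sub_add_right_eq_sub, ← Finset.sum_sub_distrib]
  refine Finset.sum_congr rfl fun i _ => ?_
  rw [← a.map_update_sub]
  rfl

/-- The pullback of a form-valued function along a map with derivative `D`. -/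
theorem lieDerivCoord_pullback {X X' : E4 → E4} {η η' : E4 → E4 [⋀^Fin k]→L[ℝ] ℂ} {ψ : E4 → E4}
    {y : E4} (hψ : ContDiffAt ℝ ∞ ψ y) (hη : DifferentiableAt ℝ η (ψ y))
    (hX : DifferentiableAt ℝ X (ψ y)) (hX' : DifferentiableAt ℝ X' y)
    (hXX' : ∀ᶠ z in 𝓝 y, fderiv ℝ ψ z (X' z) = X (ψ z))
    (hηη' : ∀ᶠ z in 𝓝 y, η' z = (η (ψ z)).compContinuousLinearMap (fderiv ℝ ψ z)) :
    lieDerivCoord X' η' y = (lieDerivCoord X η (ψ y)).compContinuousLinearMap (fderiv ℝ ψ y) := by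
  have hψ1 : DifferentiableAt ℝ ψ y := hψ.differentiableAt (by simp)
  have hψ2 : DifferentiableAt ℝ (fderiv ℝ ψ) y :=
    (hψ.fderiv_right (m := 1) (by norm_cast)).differentiableAt (by simp)
  have hsymm : IsSymmSndFDerivAt ℝ ψ y := hψ.isSymmSndFDerivAt (by simp; norm_cast)
  -- This is the derivative of the relation `Dψ · X' = X ∘ ψ`, with the symmetry of the second
  -- derivative used to put `X' y` in the first slot. It absorbs the second derivative of `ψ` that
  -- appears when the pulled-back form is differentiated.
  have hD : (fderiv ℝ (fderiv ℝ ψ) y (X' y)) + (fderiv ℝ ψ y).comp (fderiv ℝ X' y) =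
      (fderiv ℝ X (ψ y)).comp (fderiv ℝ ψ y) := by
    have h1 := (hψ2.hasFDerivAt.clm_apply hX'.hasFDerivAt).fderiv
    have h2 := (hX.hasFDerivAt.comp y hψ1.hasFDerivAt).fderiv
    have h3 : (fun z => fderiv ℝ ψ z (X' z)) =ᶠ[𝓝 y] X ∘ ψ := hXX'
    rw [h3.fderiv_eq, h2] at h1
    rw [h1]
    ext w : 1
    simp [hsymm.eq w (X' y), add_comm]
  have hη1 := ((hη.hasFDerivAt.comp y hψ1.hasFDerivAt).continuousAlternatingMapCompContinuousLinearMap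
    hψ2.hasFDerivAt).fderiv
  have hη2 : η' =ᶠ[𝓝 y] fun z => ((η ∘ ψ) z).compContinuousLinearMap (fderiv ℝ ψ z) := hηη'
  have hXy : fderiv ℝ ψ y (X' y) = X (ψ y) := hXX'.self_of_nhds
  rw [lieDerivCoord_eq, lieDerivCoord_eq, hη2.fderiv_eq, hη1, hη2.self_of_nhds,
    derivAction_comp_left]
  have hadd : ∀ a b : E4 [⋀^Fin k]→L[ℝ] ℂ, (a + b).compContinuousLinearMap (fderiv ℝ ψ y) =
      a.compContinuousLinearMap (fderiv ℝ ψ y) + b.compContinuousLinearMap (fderiv ℝ ψ y) :=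
    fun a b => rfl
  rw [hadd, derivAction_comp_right, ← hD, map_add]
  simp [hXy, add_assoc]

theorem lieDerivCoord_congr {X X' : E4 → E4} {η η' : E4 → E4 [⋀^Fin k]→L[ℝ] ℂ} {y : E4}
    (hX : X =ᶠ[𝓝 y] X') (hη : η =ᶠ[𝓝 y] η') : lieDerivCoord X η y = lieDerivCoord X' η' y := by
  rw [lieDerivCoord_eq, lieDerivCoord_eq, hX.fderiv_eq, hη.fderiv_eq, hX.self_of_nhds,
    hη.self_of_nhds]

theorem lieDerivCoord_add (X : E4 → E4) {η τ : E4 → E4 [⋀^Fin k]→L[ℝ] ℂ} {y : E4}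
    (hη : DifferentiableAt ℝ η y) (hτ : DifferentiableAt ℝ τ y) :
    lieDerivCoord X (fun z => η z + τ z) y = lieDerivCoord X η y + lieDerivCoord X τ y := by
  simp only [lieDerivCoord_eq]
  rw [fderiv_fun_add hη hτ, map_add]
  simp only [_root_.add_apply]
  abel

/-- Stated for real-linear `f` so as to cover both multiplication by complex scalars and complex
conjugation. -/
theorem lieDerivCoord_clm (X : E4 → E4) {η : E4 → E4 [⋀^Fin k]→L[ℝ] ℂ} {y : E4}
    (hη : DifferentiableAt ℝ η y) (f : ℂ →L[ℝ] ℂ) :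
    lieDerivCoord X (fun z => f.compContinuousAlternatingMap (η z)) y =
      f.compContinuousAlternatingMap (lieDerivCoord X η y) := by
  have h1 : HasFDerivAt (fun z => f.compContinuousAlternatingMap (η z))
      ((ContinuousLinearMap.compContinuousAlternatingMapCLM (ι := Fin k) (𝕜 := ℝ) E4 ℂ ℂ f).comp (fderiv ℝ η y)) y :=
    (ContinuousLinearMap.compContinuousAlternatingMapCLM (ι := Fin k) (𝕜 := ℝ) E4 ℂ ℂ f).hasFDerivAt.comp y hη.hasFDerivAt
  simp only [lieDerivCoord_eq]
  rw [h1.fderiv]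
  ext v
  simp [derivAction_apply]

theorem lieDerivCoord_smul (X : E4 → E4) {η : E4 → E4 [⋀^Fin k]→L[ℝ] ℂ} {y : E4}
    (hη : DifferentiableAt ℝ η y) (c : ℂ) :
    lieDerivCoord X (fun z => c • η z) y = c • lieDerivCoord X η y :=
  lieDerivCoord_clm X hη (ContinuousLinearMap.mul ℝ ℂ c)

/-- The derivation action of `A` is the derivative at `t = 0` of pullback along `1 + tA`. Pullback
is multiplicative for the wedge product, so the Leibniz rule follows from uniqueness of derivatives.
-/
theorem derivAction_wedge {p q : ℕ} (a : E4 [⋀^Fin p]→L[ℝ] ℂ) (b : E4 [⋀^Fin q]→L[ℝ] ℂ)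
    (A : E4 →L[ℝ] E4) :
    derivAction (p + q) (wedgeAlt a b) A =
      wedgeAlt (derivAction p a A) b + wedgeAlt a (derivAction q b A) := by
  have hB : HasDerivAt (fun t : ℝ => ContinuousLinearMap.id ℝ E4 + t • A) A 0 := by
    simpa using ((hasDerivAt_id (0 : ℝ)).smul_const A).const_add (ContinuousLinearMap.id ℝ E4)
  have key : ∀ {n : ℕ} (c : E4 [⋀^Fin n]→L[ℝ] ℂ), HasDerivAt
      (fun t : ℝ => c.compContinuousLinearMap (ContinuousLinearMap.id ℝ E4 + t • A))
      (derivAction n c A) 0 := by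
    intro n c
    have h := ((hasFDerivAt_const c (0 : ℝ)).continuousAlternatingMapCompContinuousLinearMap
      hB.hasFDerivAt).hasDerivAt
    have e0 : ContinuousLinearMap.id ℝ E4 + (0 : ℝ) • A = ContinuousLinearMap.id ℝ E4 := by
      ext w; simp
    rw [e0] at h
    simpa [derivAction] using h
  have h1 := key (wedgeAlt a b)
  simp only [wedgeAlt_compContinuousLinearMap] at h1
  have h2 := ((wedgeAltL p q).hasFDerivAt_of_bilinear (key a).hasFDerivAt
    (key b).hasFDerivAt).hasDerivAt
  simp only [wedgeAltL_apply] at h2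
  have e0 : ContinuousLinearMap.id ℝ E4 + (0 : ℝ) • A = ContinuousLinearMap.id ℝ E4 := by
    ext w; simp
  have e1 : ∀ {n : ℕ} (c : E4 [⋀^Fin n]→L[ℝ] ℂ),
      c.compContinuousLinearMap (ContinuousLinearMap.id ℝ E4) = c := fun c => rfl
  rw [h1.unique h2, e0, e1, e1]
  simp only [_root_.add_apply, ContinuousLinearMap.precompR_apply,
    ContinuousLinearMap.precompL_apply, ContinuousLinearMap.compL_apply,
    ContinuousLinearMap.comp_apply, ContinuousLinearMap.toSpanSingleton_apply, one_smul,
    wedgeAltL_apply]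
  exact add_comm _ _

theorem lieDerivCoord_wedge {p q : ℕ} (X : E4 → E4) {η : E4 → E4 [⋀^Fin p]→L[ℝ] ℂ}
    {τ : E4 → E4 [⋀^Fin q]→L[ℝ] ℂ} {y : E4}
    (hη : DifferentiableAt ℝ η y) (hτ : DifferentiableAt ℝ τ y) :
    lieDerivCoord X (fun z => wedgeAlt (η z) (τ z)) y =
      wedgeAlt (lieDerivCoord X η y) (τ y) + wedgeAlt (η y) (lieDerivCoord X τ y) := by
  have h := ((wedgeAltL p q).hasFDerivAt_of_bilinear hη.hasFDerivAt hτ.hasFDerivAt).fderiv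
  simp only [wedgeAltL_apply] at h
  simp only [lieDerivCoord_eq]
  rw [h, derivAction_wedge, wedgeAlt_add_left, wedgeAlt_add_right]
  simp only [_root_.add_apply, ContinuousLinearMap.precompR_apply,
    ContinuousLinearMap.precompL_apply, ContinuousLinearMap.compL_apply,
    ContinuousLinearMap.comp_apply, wedgeAltL_apply]
  abel

/-- In the difference of the two sides the second derivatives of `η` cancel by symmetry. What
remains is the derivative of `η` along `[X, Y]` and, by `derivAction_commutator`, the action of
`D[X, Y]` on `η`. The bracket vanishes near `y`, hence so does its derivative there. -/
theorem lieDerivCoord_comm {X Y : E4 → E4} {η : E4 → E4 [⋀^Fin k]→L[ℝ] ℂ} {y : E4}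
    (hX : ContDiffAt ℝ ∞ X y) (hY : ContDiffAt ℝ ∞ Y y) (hη : ContDiffAt ℝ ∞ η y)
    (hXY : VectorField.lieBracket ℝ X Y =ᶠ[𝓝 y] 0) :
    lieDerivCoord X (lieDerivCoord Y η) y = lieDerivCoord Y (lieDerivCoord X η) y := by
  have d1 : ∀ {F : Type} [NormedAddCommGroup F] [NormedSpace ℝ F] {f : E4 → F},
      ContDiffAt ℝ ∞ f y → DifferentiableAt ℝ f y := fun h => h.differentiableAt (by simp)
  have d2 : ∀ {F : Type} [NormedAddCommGroup F] [NormedSpace ℝ F] {f : E4 → F},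
      ContDiffAt ℝ ∞ f y → DifferentiableAt ℝ (fderiv ℝ f) y :=
    fun h => (h.fderiv_right (m := 1) (by norm_cast)).differentiableAt (by simp)
  have ds : ∀ {F : Type} [NormedAddCommGroup F] [NormedSpace ℝ F] {f : E4 → F},
      ContDiffAt ℝ ∞ f y → IsSymmSndFDerivAt ℝ f y :=
    fun h => h.isSymmSndFDerivAt (by simp; norm_cast)
  have expand : ∀ {Y : E4 → E4}, ContDiffAt ℝ ∞ Y y → ∀ w, fderiv ℝ (lieDerivCoord Y η) y w =
      fderiv ℝ (fderiv ℝ η) y w (Y y) + fderiv ℝ η y (fderiv ℝ Y y w) +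
      derivAction k (fderiv ℝ η y w) (fderiv ℝ Y y) +
      derivAction k (η y) (fderiv ℝ (fderiv ℝ Y) y w) := by
    intro Y hY w
    have h1 := (d2 hη).hasFDerivAt.clm_apply (d1 hY).hasFDerivAt
    have h2 := (derivAction k).hasFDerivAt_of_bilinear (d1 hη).hasFDerivAt (d2 hY).hasFDerivAt
    have h3 : lieDerivCoord Y η = fun z => fderiv ℝ η z (Y z) +
      derivAction k (η z) (fderiv ℝ Y z) := rfl
    have h4 : fderiv ℝ (fun z => fderiv ℝ η z (Y z) + derivAction k (η z) (fderiv ℝ Y z)) y = _ :=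
      (h1.add h2).fderiv
    rw [h3, h4]
    simp only [_root_.add_apply, ContinuousLinearMap.precompR_apply,
      ContinuousLinearMap.precompL_apply, ContinuousLinearMap.compL_apply, ContinuousLinearMap.comp_apply,
      ContinuousLinearMap.flip_apply]
    abel
  have hbr : fderiv ℝ Y y (X y) - fderiv ℝ X y (Y y) = 0 := hXY.self_of_nhds
  have hD : fderiv ℝ (fderiv ℝ Y) y (X y) - fderiv ℝ (fderiv ℝ X) y (Y y) +
      ((fderiv ℝ Y y).comp (fderiv ℝ X y) - (fderiv ℝ X y).comp (fderiv ℝ Y y)) = 0 := by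
    have h1 := ((d2 hY).hasFDerivAt.clm_apply (d1 hX).hasFDerivAt).sub
      ((d2 hX).hasFDerivAt.clm_apply (d1 hY).hasFDerivAt)
    have h2 := h1.fderiv
    have h3 : (fun z => fderiv ℝ Y z (X z) - fderiv ℝ X z (Y z)) =ᶠ[𝓝 y] fun _ => (0 : E4) := hXY
    have h4 : fderiv ℝ (fun z => fderiv ℝ Y z (X z) - fderiv ℝ X z (Y z)) y = 0 := by
      rw [h3.fderiv_eq]; simp
    have h5 := h2.symm.trans h4
    rw [← h5]
    ext w : 1
    simp only [_root_.add_apply, _root_.sub_apply,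
      ContinuousLinearMap.comp_apply, ContinuousLinearMap.flip_apply, (ds hY).eq w (X y),
      (ds hX).eq w (Y y)]
    abel
  have hcomm := derivAction_commutator (η y) (fderiv ℝ X y) (fderiv ℝ Y y)
  have hR := congrArg (derivAction k (η y)) hD
  rw [map_add, ← hcomm, map_sub, _root_.map_zero] at hR
  have hη3 := congrArg (fderiv ℝ η y) hbr
  rw [map_sub, _root_.map_zero] at hη3
  rw [← sub_eq_zero, lieDerivCoord_eq X (lieDerivCoord Y η), lieDerivCoord_eq Y (lieDerivCoord X η),
    expand hY, expand hX, lieDerivCoord_eq, lieDerivCoord_eq, (ds hη).eq (X y) (Y y), map_add, map_add]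
  simp only [_root_.add_apply]
  have e := congrArg₂ (· + ·) hR hη3
  simp only [add_zero] at e
  rw [← e]
  abel

end CoordinateCalculus

/-! ### Top-degree forms and the divergence theorem on ℝ⁴ -/

section CoordinateCalculus

open Filter Topology ContinuousAlternatingMap

variable {k : ℕ}

theorem contDiff_derivAction : ContDiff ℝ ∞ (fun p : (E4 [⋀^Fin k]→L[ℝ] ℂ) × (E4 →L[ℝ] E4) =>
    derivAction k p.1 p.2) := (derivAction k).isBoundedBilinearMap.contDiff

theorem contDiffOn_lieDerivCoord {X : E4 → E4} {η : E4 → E4 [⋀^Fin k]→L[ℝ] ℂ} {U : Set E4}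
    (hU : IsOpen U) (hX : ContDiffOn ℝ ∞ X U) (hη : ContDiffOn ℝ ∞ η U) :
    ContDiffOn ℝ ∞ (lieDerivCoord X η) U := by
  have h1 : ContDiffOn ℝ ∞ (fun y => fderiv ℝ X y) U := hX.fderiv_of_isOpen hU (by simp)
  have h2 : ContDiffOn ℝ ∞ (fun y => fderiv ℝ η y) U := hη.fderiv_of_isOpen hU (by simp)
  have h4 : ContDiffOn ℝ ∞ (fun y => derivAction k (η y) (fderiv ℝ X y)) U :=
    ContDiff.comp_contDiffOn (f := fun y => (η y, fderiv ℝ X y))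
      (g := fun p : (E4 [⋀^Fin k]→L[ℝ] ℂ) × (E4 →L[ℝ] E4) => derivAction k p.1 p.2)
      contDiff_derivAction (hη.prodMk h1)
  have h5 : ContDiffOn ℝ ∞ (fun y => fderiv ℝ η y (X y)) U := h2.clm_apply hX
  exact h5.add h4

/-- The coordinate volume `η ↦ η (e₀, …, e₃)` of a 4-form. -/
def volCoeff : (E4 [⋀^Fin 4]→L[ℝ] ℂ) →L[ℝ] ℂ :=
  LinearMap.toContinuousLinearMap
    { toFun := fun a => a (fun i => EuclideanSpace.single i (1 : ℝ))
      map_add' := fun _ _ => rfl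
      map_smul' := fun _ _ => rfl }

theorem volCoeff_apply (a : E4 [⋀^Fin 4]→L[ℝ] ℂ) :
    volCoeff a = a (fun i => EuclideanSpace.single i (1 : ℝ)) := rfl

theorem euclidean_eq_sum (w : E4) :
    w = ∑ j, w j • (EuclideanSpace.single j (1 : ℝ) : E4) := by
  ext i
  simp [Finset.sum_apply, Pi.single_apply]

/-- A real top-degree form is a multiple of the determinant in the standard basis; real and
imaginary parts are treated separately. -/
theorem volCoeff_compContinuousLinearMap (a : E4 [⋀^Fin 4]→L[ℝ] ℂ) (A : E4 →L[ℝ] E4) :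
    volCoeff (a.compContinuousLinearMap A) = (A.det : ℂ) * volCoeff a := by
  have key : ∀ f : E4 [⋀^Fin 4]→ₗ[ℝ] ℝ, f (fun i => A (EuclideanSpace.single i (1 : ℝ))) =
      A.det * f (fun i => EuclideanSpace.single i (1 : ℝ)) := by
    intro f
    let e := (EuclideanSpace.basisFun (Fin 4) ℝ).toBasis
    have he : ∀ i, e i = EuclideanSpace.single i (1 : ℝ) := fun i => by simp [e]
    have h1 := congrArg (fun m : E4 [⋀^Fin 4]→ₗ[ℝ] ℝ => m ((A : E4 →ₗ[ℝ] E4) ∘ e))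
      (f.eq_smul_basis_det e)
    simp only [AlternatingMap.smul_apply, Module.Basis.det_comp, Module.Basis.det_self, mul_one,
      smul_eq_mul] at h1
    have h2 : ((A : E4 →ₗ[ℝ] E4) ∘ e) = fun i => A (EuclideanSpace.single i (1 : ℝ)) :=
      funext fun i => congrArg A (he i)
    rw [h2, funext he] at h1
    rw [h1, mul_comm]
  refine Complex.ext ?_ ?_
  · rw [Complex.re_ofReal_mul]
    exact key (Complex.reLm.compAlternatingMap a.toAlternatingMap)
  · rw [Complex.im_ofReal_mul]
    exact key (Complex.imLm.compAlternatingMap a.toAlternatingMap)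

/-- In slot `i` only the component of `A eᵢ` along `eᵢ` survives, since any other repeats a basis
vector already present. The factor is the trace of `A`. -/
theorem volCoeff_derivAction (a : E4 [⋀^Fin 4]→L[ℝ] ℂ) (A : E4 →L[ℝ] E4) :
    volCoeff (derivAction 4 a A) =
      ∑ i, ((A (EuclideanSpace.single i (1 : ℝ)) i : ℝ) : ℂ) * volCoeff a := by
  rw [volCoeff_apply, derivAction_apply]
  refine Finset.sum_congr rfl fun i _ => ?_
  have h1 := a.toAlternatingMap.map_update_sum Finset.univ i
    (fun j => A (EuclideanSpace.single i (1 : ℝ)) j • (EuclideanSpace.single j (1 : ℝ) : E4))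
    (fun i => EuclideanSpace.single i (1 : ℝ))
  rw [← euclidean_eq_sum] at h1
  refine h1.trans ?_
  simp only [ContinuousAlternatingMap.coe_toAlternatingMap]
  rw [Finset.sum_eq_single i]
  · rw [a.map_update_smul, Complex.real_smul]
    simp [volCoeff_apply]
  · intro j _ hj
    rw [a.map_update_smul, a.map_eq_zero_of_eq _ (i := i) (j := j) (by simp [hj]) hj.symm,
      smul_zero]
  · simp

/-- The Lie derivative of a top-degree form is a divergence. -/
theorem volCoeff_lieDerivCoord {X : E4 → E4} {η : E4 → E4 [⋀^Fin 4]→L[ℝ] ℂ} {y : E4}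
    (hX : DifferentiableAt ℝ X y) (hη : DifferentiableAt ℝ η y) :
    volCoeff (lieDerivCoord X η y) = ∑ i, fderiv ℝ (fun z => ((X z i : ℝ) : ℂ) * volCoeff (η z)) y
      (EuclideanSpace.single i (1 : ℝ)) := by
  have hu : HasFDerivAt (fun z => volCoeff (η z)) (volCoeff.comp (fderiv ℝ η y)) y :=
    volCoeff.hasFDerivAt.comp y hη.hasFDerivAt
  have hXi : ∀ i, HasFDerivAt (fun z => ((X z i : ℝ) : ℂ))
      ((Complex.ofRealCLM.comp (EuclideanSpace.proj i)).comp (fderiv ℝ X y)) y := fun i =>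
    (Complex.ofRealCLM.comp (EuclideanSpace.proj i : E4 →L[ℝ] ℝ)).hasFDerivAt.comp
      y hX.hasFDerivAt
  have hXu : ∀ i, fderiv ℝ (fun z => ((X z i : ℝ) : ℂ) * volCoeff (η z)) y
      (EuclideanSpace.single i (1 : ℝ)) =
      X y i * volCoeff (fderiv ℝ η y (EuclideanSpace.single i (1 : ℝ))) +
      ((fderiv ℝ X y (EuclideanSpace.single i (1 : ℝ)) i : ℝ) : ℂ) * volCoeff (η y) := by
    intro i
    have h : fderiv ℝ (fun z => ((X z i : ℝ) : ℂ) * volCoeff (η z)) y = _ :=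
      ((hXi i).mul hu).fderiv
    rw [h]
    simp [mul_comm]
  rw [Finset.sum_congr rfl fun i _ => hXu i, Finset.sum_add_distrib, lieDerivCoord_eq, map_add,
    volCoeff_derivAction]
  congr 1
  conv_lhs => rw [euclidean_eq_sum (X y), _root_.map_sum, _root_.map_sum]
  refine Finset.sum_congr rfl fun i _ => ?_
  rw [map_smul, map_smul, Complex.real_smul]

/-- **Divergence theorem** for compactly supported forms. -/
theorem integral_volCoeff_lieDerivCoord {X : E4 → E4} {η : E4 → E4 [⋀^Fin 4]→L[ℝ] ℂ}
    {U K : Set E4} (hU : IsOpen U) (hK : IsCompact K) (hKU : K ⊆ U)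
    (hX : ContDiffOn ℝ ∞ X U) (hη : ContDiffOn ℝ ∞ η U) (h0 : ∀ y ∈ U, y ∉ K → η y = 0) :
    ∫ y in U, volCoeff (lieDerivCoord X η y) = 0 := by
  classical
  -- The components of the vector field whose divergence is integrated, extended by zero outside
  -- `U`. They are smooth on all of `E4` because `η` vanishes on `U` outside the compact set `K ⊆
  -- U`.
  let g : Fin 4 → E4 → ℂ := fun i => U.indicator fun z => ((X z i : ℝ) : ℂ) * volCoeff (η z)
  have hgU : ∀ i, Set.EqOn (g i) (fun z => ((X z i : ℝ) : ℂ) * volCoeff (η z)) U :=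
    fun i z hz => Set.indicator_of_mem hz _
  have hgK : ∀ i, ∀ z ∉ K, g i z = 0 := by
    intro i z hz
    by_cases hzU : z ∈ U
    · simp [hgU i hzU, h0 z hzU hz]
    · exact Set.indicator_of_notMem hzU _
  have hsm : ∀ i, ContDiff ℝ ∞ (g i) := by
    intro i
    rw [contDiff_iff_contDiffAt]
    intro z
    by_cases hz : z ∈ K
    · have hzU := hU.mem_nhds (hKU hz)
      have h1 : ContDiffOn ℝ ∞ (fun z => ((X z i : ℝ) : ℂ) * volCoeff (η z)) U := by
        refine ContDiffOn.mul ?_ (volCoeff.contDiff.comp_contDiffOn hη)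
        exact (Complex.ofRealCLM.comp
          (EuclideanSpace.proj i : E4 →L[ℝ] ℝ)).contDiff.comp_contDiffOn hX
      exact ((h1.contDiffAt hzU).congr_of_eventuallyEq
        (Filter.eventually_of_mem hzU fun w hw => hgU i hw))
    · refine contDiffAt_const (c := (0 : ℂ)) |>.congr_of_eventuallyEq ?_
      exact Filter.eventually_of_mem (hK.isClosed.isOpen_compl.mem_nhds hz) fun w hw => hgK i w hw
  have hcs : ∀ i, HasCompactSupport (g i) := fun i => HasCompactSupport.intro hK (hgK i)
  have hint : ∀ i, ∫ z, fderiv ℝ (g i) z (EuclideanSpace.single i (1 : ℝ)) = 0 := by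
    intro i
    have hd : Continuous fun z => fderiv ℝ (g i) z (EuclideanSpace.single i (1 : ℝ)) :=
      ((hsm i).continuous_fderiv (by simp)).clm_apply continuous_const
    -- Integration by parts against the constant function `1`.
    have := integral_mul_fderiv_eq_neg_fderiv_mul_of_integrable (f := fun _ : E4 => (1 : ℂ))
      (g := g i) (v := EuclideanSpace.single i (1 : ℝ)) (μ := MeasureTheory.volume) (by simp)
      (by simpa using hd.integrable_of_hasCompactSupport ((hcs i).fderiv_apply ℝ _))
      (by simpa using (hsm i).continuous.integrable_of_hasCompactSupport (hcs i))
      (fun x _ => differentiableAt_const _) (fun x _ => (hsm i).differentiable (by simp) x)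
    simpa using this
  have hpt : ∀ z, U.indicator (fun y => volCoeff (lieDerivCoord X η y)) z =
      ∑ i, fderiv ℝ (g i) z (EuclideanSpace.single i (1 : ℝ)) := by
    intro z
    by_cases hz : z ∈ U
    · have hzU := hU.mem_nhds hz
      rw [Set.indicator_of_mem hz, volCoeff_lieDerivCoord
        ((hX.contDiffAt hzU).differentiableAt (by simp))
        ((hη.contDiffAt hzU).differentiableAt (by simp))]
      refine Finset.sum_congr rfl fun i _ => ?_
      have h : g i =ᶠ[𝓝 z] fun z => ((X z i : ℝ) : ℂ) * volCoeff (η z) :=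
        Filter.eventually_of_mem hzU fun w hw => hgU i hw
      rw [h.fderiv_eq]
    · rw [Set.indicator_of_notMem hz]
      refine (Finset.sum_eq_zero fun i _ => ?_).symm
      have : g i =ᶠ[𝓝 z] fun _ => (0 : ℂ) := Filter.eventually_of_mem
        (hK.isClosed.isOpen_compl.mem_nhds fun h => hz (hKU h)) fun w hw => hgK i w hw
      rw [this.fderiv_eq]
      simp
  rw [← MeasureTheory.integral_indicator hU.measurableSet]
  simp only [hpt]
  rw [MeasureTheory.integral_finsetSum]
  · exact Finset.sum_eq_zero fun i _ => hint i
  · intro i _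
    have hd : Continuous fun z => fderiv ℝ (g i) z (EuclideanSpace.single i (1 : ℝ)) :=
      ((hsm i).continuous_fderiv (by simp)).clm_apply continuous_const
    exact hd.integrable_of_hasCompactSupport ((hcs i).fderiv_apply ℝ _)

end CoordinateCalculus

/-! ### Coordinate changes and the Lie derivative in an arbitrary preferred chart -/

section Charts

open Filter Topology Set

variable {M : Type*} [TopologicalSpace M] [ChartedSpace E4 M] {k : ℕ}

/-- The coordinate change from the preferred chart at `x₁` to the one at `x₀`. -/
def transition (x₁ x₀ : M) (y : E4) : E4 :=
  extChartAt (𝓡 4) x₀ ((extChartAt (𝓡 4) x₁).symm y)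

/-- The domain of a coordinate change. -/
def overlap (x₁ x₀ : M) : Set E4 :=
  (extChartAt (𝓡 4) x₁).target ∩ (extChartAt (𝓡 4) x₁).symm ⁻¹' (extChartAt (𝓡 4) x₀).source

theorem isOpen_overlap (x₁ x₀ : M) : IsOpen (overlap x₁ x₀) :=
  (continuousOn_extChartAt_symm x₁).isOpen_inter_preimage (isOpen_extChartAt_target x₁)
    (isOpen_extChartAt_source x₀)

theorem transition_mem_overlap {x₁ x₀ : M} {y : E4} (hy : y ∈ overlap x₁ x₀) :
    transition x₁ x₀ y ∈ overlap x₀ x₁ := by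
  refine ⟨(extChartAt (𝓡 4) x₀).map_source hy.2, ?_⟩
  simp only [mem_preimage, transition, (extChartAt (𝓡 4) x₀).left_inv hy.2]
  exact (extChartAt (𝓡 4) x₁).map_target hy.1

theorem symm_transition {x₁ x₀ : M} {y : E4} (hy : y ∈ overlap x₁ x₀) :
    (extChartAt (𝓡 4) x₀).symm (transition x₁ x₀ y) = (extChartAt (𝓡 4) x₁).symm y :=
  (extChartAt (𝓡 4) x₀).left_inv hy.2

theorem transition_transition {x₁ x₀ : M} {y : E4} (hy : y ∈ overlap x₁ x₀) :
    transition x₀ x₁ (transition x₁ x₀ y) = y := by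
  rw [transition, symm_transition hy, (extChartAt (𝓡 4) x₁).right_inv hy.1]

theorem det_fderiv_transition_pos (hM : OrientedAtlas M) {x₁ x₀ : M} {y : E4}
    (hy : y ∈ overlap x₁ x₀) : 0 < (fderiv ℝ (transition x₁ x₀) y).det := by
  have h := hM (chartAt E4 x₁) (chart_mem_atlas E4 x₁) (chartAt E4 x₀) (chart_mem_atlas E4 x₀) y
    (by simpa [overlap] using hy)
  have e : transition x₁ x₀ = fun z => chartAt E4 x₀ ((chartAt E4 x₁).symm z) := by
    ext z; simp [transition]
  rw [e]
  exact h

variable [IsManifold (𝓡 4) ∞ M]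

theorem isManifold_one : IsManifold (𝓡 4) 1 M := IsManifold.of_le (n := ∞) (by norm_cast)

theorem contDiffOn_transition (x₁ x₀ : M) : ContDiffOn ℝ ∞ (transition x₁ x₀) (overlap x₁ x₀) := by
  rw [← contMDiffOn_iff_contDiffOn]
  exact (contMDiffOn_extChartAt (I := 𝓡 4) (n := ∞) (x := x₀)).comp
    ((contMDiffOn_extChartAt_symm (I := 𝓡 4) (n := ∞) x₁).mono inter_subset_left)
    (fun y hy => by simpa using hy.2)

/-- The derivative of the inverse of the preferred chart at `x₀`. -/
def symmDeriv (x₀ : M) (y : E4) : E4 →L[ℝ] E4 :=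
  mfderiv 𝓘(ℝ, E4) (𝓡 4) (extChartAt (𝓡 4) x₀).symm y

theorem mdifferentiableAt_symm {x₀ : M} {y : E4} (hy : y ∈ (extChartAt (𝓡 4) x₀).target) :
    MDifferentiableAt 𝓘(ℝ, E4) (𝓡 4) (extChartAt (𝓡 4) x₀).symm y :=
  ((contMDiffOn_extChartAt_symm (I := 𝓡 4) (n := ∞) x₀).contMDiffAt
    ((isOpen_extChartAt_target x₀).mem_nhds hy)).mdifferentiableAt (by simp)

theorem isInvertible_symmDeriv {x₀ : M} {y : E4} (hy : y ∈ (extChartAt (𝓡 4) x₀).target) :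
    (symmDeriv x₀ y).IsInvertible := by
  have := isManifold_one (M := M)
  have h := isInvertible_mfderivWithin_extChartAt_symm (I := 𝓡 4) hy
  rw [modelWithCornersSelf_coe, range_id, mfderivWithin_univ] at h
  exact h

theorem symmDeriv_eq_comp {x₁ x₀ : M} {y : E4} (hy : y ∈ overlap x₁ x₀) :
    symmDeriv x₁ y =
      (symmDeriv x₀ (transition x₁ x₀ y)).comp (fderiv ℝ (transition x₁ x₀) y) := by
  have hψ : MDifferentiableAt 𝓘(ℝ, E4) 𝓘(ℝ, E4) (transition x₁ x₀) y :=
    (((contDiffOn_transition x₁ x₀).contDiffAt ((isOpen_overlap x₁ x₀).mem_nhds hy)).differentiableAt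
      (by simp)).mdifferentiableAt
  have h1 := mfderiv_comp y
    (mdifferentiableAt_symm (x₀ := x₀) (transition_mem_overlap hy).1) hψ
  have h2 : (extChartAt (𝓡 4) x₁).symm =ᶠ[𝓝 y] (extChartAt (𝓡 4) x₀).symm ∘ transition x₁ x₀ :=
    eventually_of_mem ((isOpen_overlap x₁ x₀).mem_nhds hy) fun z hz => (symm_transition hz).symm
  rw [symmDeriv, h2.mfderiv_eq, h1, mfderiv_eq_fderiv]
  rfl

/-- The value of a form at a point, on the model space. -/
def DForm.val (η : DForm M k) (x : M) : E4 [⋀^Fin k]→L[ℝ] ℂ := η x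

omit [IsManifold (𝓡 4) ∞ M] in
theorem DForm.inChart_eq (η : DForm M k) (x₀ : M) (y : E4) :
    DForm.inChart η x₀ y = 
      (DForm.val η ((extChartAt (𝓡 4) x₀).symm y)).compContinuousLinearMap (symmDeriv x₀ y) := rfl

theorem DForm.inChart_transition (η : DForm M k) {x₁ x₀ : M} {y : E4} (hy : y ∈ overlap x₁ x₀) :
    DForm.inChart η x₁ y = (DForm.inChart η x₀ (transition x₁ x₀ y)).compContinuousLinearMap
      (fderiv ℝ (transition x₁ x₀) y) := by
  rw [DForm.inChart_eq, DForm.inChart_eq, symm_transition hy, symmDeriv_eq_comp hy]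
  rfl

theorem DForm.eq_of_inChart_eq {η τ : DForm M k} {x₀ : M} {y : E4}
    (hy : y ∈ (extChartAt (𝓡 4) x₀).target) (h : DForm.inChart η x₀ y = DForm.inChart τ x₀ y) :
    η ((extChartAt (𝓡 4) x₀).symm y) = τ ((extChartAt (𝓡 4) x₀).symm y) := by
  obtain ⟨A, hA⟩ := isInvertible_symmDeriv hy
  rw [DForm.inChart_eq, DForm.inChart_eq, ← hA] at h
  refine ContinuousAlternatingMap.ext fun v => ?_
  have h1 := congrArg (fun a : E4 [⋀^Fin k]→L[ℝ] ℂ => a (fun i => A.symm (v i))) h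
  have h2 : (A : E4 →L[ℝ] E4) ∘ (fun i => A.symm (v i)) = v :=
    funext fun i => A.apply_symm_apply (v i)
  change DForm.val η _ ((A : E4 →L[ℝ] E4) ∘ fun i => A.symm (v i)) =
    DForm.val τ _ ((A : E4 →L[ℝ] E4) ∘ fun i => A.symm (v i)) at h1
  rw [h2] at h1
  exact h1

/-- The differential of a chart is invertible, so identities between forms may be checked in
coordinates. The rules for `lieDeriv` are transferred from `lieDerivCoord` in this way. -/
theorem DForm.ext_inChart {η τ : DForm M k} (h : ∀ x₀, ∀ y ∈ (extChartAt (𝓡 4) x₀).target,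
    DForm.inChart η x₀ y = DForm.inChart τ x₀ y) : η = τ := by
  funext x
  have h1 := DForm.eq_of_inChart_eq (mem_extChartAt_target (I := 𝓡 4) x)
    (h x _ (mem_extChartAt_target x))
  rwa [extChartAt_to_inv] at h1

theorem symmDeriv_inChart (X : VField M) {x₀ : M} {y : E4}
    (hy : y ∈ (extChartAt (𝓡 4) x₀).target) :
    symmDeriv x₀ y (VField.inChart X x₀ y) = X ((extChartAt (𝓡 4) x₀).symm y) := by
  obtain ⟨A, hA⟩ := isInvertible_symmDeriv hy
  have h : VField.inChart X x₀ y =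
      (symmDeriv x₀ y).inverse (X ((extChartAt (𝓡 4) x₀).symm y) : E4) := rfl
  rw [h, ← hA, ContinuousLinearMap.inverse_equiv]
  exact A.apply_symm_apply _

theorem fderiv_transition_inChart (X : VField M) {x₁ x₀ : M} {y : E4} (hy : y ∈ overlap x₁ x₀) :
    fderiv ℝ (transition x₁ x₀) y (VField.inChart X x₁ y) =
      VField.inChart X x₀ (transition x₁ x₀ y) := by
  obtain ⟨A, hA⟩ := isInvertible_symmDeriv (transition_mem_overlap hy).1
  have h1 := symmDeriv_inChart X hy.1
  have h2 := symmDeriv_inChart X (transition_mem_overlap hy).1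
  rw [symmDeriv_eq_comp hy] at h1
  have h3 : (X ((extChartAt (𝓡 4) x₁).symm y) : E4) =
      (X ((extChartAt (𝓡 4) x₀).symm (transition x₁ x₀ y)) : E4) :=
    congrArg (fun x => (X x : E4)) (symm_transition hy).symm
  have h4 := (h1.trans h3).trans h2.symm
  rw [← hA] at h4
  exact A.injective h4

theorem VField.IsSmooth.contDiffOn {X : VField M} (hX : VField.IsSmooth X) (x₀ : M) :
    ContDiffOn ℝ ∞ (VField.inChart X x₀) (extChartAt (𝓡 4) x₀).target := by
  have := isManifold_one (M := M)
  refine (contMDiffOn_vectorSpace_iff_contDiffOn (V := VField.inChart X x₀)).1 fun y hy => ?_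
  refine ContMDiffAt.contMDiffWithinAt ?_
  exact ContMDiffAt.mpullback_vectorField_preimage (n := ∞) (hX _)
    ((contMDiffOn_extChartAt_symm (I := 𝓡 4) (n := ∞) x₀).contMDiffAt
      ((isOpen_extChartAt_target x₀).mem_nhds hy)) (isInvertible_symmDeriv hy) (by simp)

/-- In every preferred chart, the Lie derivative is given by the coordinate formula. -/
theorem inChart_lieDeriv {X : VField M} (hX : VField.IsSmooth X) {η : DForm M k}
    (hη : DForm.IsSmooth η) {x₀ : M} {y : E4} (hy : y ∈ (extChartAt (𝓡 4) x₀).target) :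
    DForm.inChart (lieDeriv X η) x₀ y =
      lieDerivCoord (VField.inChart X x₀) (DForm.inChart η x₀) y := by
  -- By definition the value of the Lie derivative at `x` is computed in the preferred chart at `x`,
  -- not at `x₀`. Naturality under the coordinate change `transition x₀ x` carries the formula over.
  set x := (extChartAt (𝓡 4) x₀).symm y with hx
  have hyo : y ∈ overlap x₀ x := ⟨hy, mem_extChartAt_source x⟩
  have hψy : transition x₀ x y = extChartAt (𝓡 4) x x := rfl
  have hnat := lieDerivCoord_pullback (X := VField.inChart X x) (X' := VField.inChart X x₀)
    (η := DForm.inChart η x) (η' := DForm.inChart η x₀) (ψ := transition x₀ x) (y := y)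
    ((contDiffOn_transition x₀ x).contDiffAt ((isOpen_overlap x₀ x).mem_nhds hyo))
    (((hη x).contDiffAt ((isOpen_extChartAt_target x).mem_nhds
      (transition_mem_overlap hyo).1)).differentiableAt (by simp))
    (((hX.contDiffOn x).contDiffAt ((isOpen_extChartAt_target x).mem_nhds
      (transition_mem_overlap hyo).1)).differentiableAt (by simp))
    (((hX.contDiffOn x₀).contDiffAt ((isOpen_extChartAt_target x₀).mem_nhds
      hy)).differentiableAt (by simp))
    (eventually_of_mem ((isOpen_overlap x₀ x).mem_nhds hyo) fun z hz =>
      fderiv_transition_inChart X hz)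
    (eventually_of_mem ((isOpen_overlap x₀ x).mem_nhds hyo) fun z hz =>
      DForm.inChart_transition η hz)
  have hcomp : (mfderiv (𝓡 4) 𝓘(ℝ, E4) (extChartAt (𝓡 4) x) x : E4 →L[ℝ] E4).comp
      (symmDeriv x₀ y) = fderiv ℝ (transition x₀ x) y := by
    have h1 := mfderiv_comp (I := 𝓘(ℝ, E4)) (I' := 𝓡 4) (I'' := 𝓘(ℝ, E4)) y
      (g := extChartAt (𝓡 4) x) (f := (extChartAt (𝓡 4) x₀).symm)
      ((contMDiffAt_extChartAt' (I := 𝓡 4) (n := ∞) (mem_chart_source _ x)).mdifferentiableAt (by simp))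
      (mdifferentiableAt_symm hy)
    rw [mfderiv_eq_fderiv] at h1
    exact h1.symm
  rw [hnat, ← hcomp, hψy]
  rfl

theorem isSmooth_lieDeriv {X : VField M} (hX : VField.IsSmooth X) {η : DForm M k}
    (hη : DForm.IsSmooth η) : DForm.IsSmooth (lieDeriv X η) := fun x₀ =>
  (contDiffOn_lieDerivCoord (isOpen_extChartAt_target x₀) (hX.contDiffOn x₀) (hη x₀)).congr
    fun _ hy => inChart_lieDeriv hX hη hy

end Charts

/-! ### Rules for the Lie derivative on the manifold -/

section SmoothForms

open Filter Topology Set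

variable {M : Type*} [TopologicalSpace M] [ChartedSpace E4 M] {k p q : ℕ}

namespace DForm

theorem inChart_add (η τ : DForm M k) (x₀ : M) (y : E4) :
    inChart (η + τ) x₀ y = inChart η x₀ y + inChart τ x₀ y := rfl

theorem inChart_smul (c : ℂ) (η : DForm M k) (x₀ : M) (y : E4) :
    inChart (c • η) x₀ y = c • inChart η x₀ y := rfl

theorem inChart_zero (x₀ : M) (y : E4) : inChart (0 : DForm M k) x₀ y = 0 := rfl

theorem inChart_conj (η : DForm M k) (x₀ : M) (y : E4) : inChart (conj η) x₀ y =
    (Complex.conjCLE : ℂ →L[ℝ] ℂ).compContinuousAlternatingMap (inChart η x₀ y) := rfl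

theorem inChart_wedge (η : DForm M p) (τ : DForm M q) (x₀ : M) (y : E4) :
    inChart (wedge η τ) x₀ y = wedgeAlt (inChart η x₀ y) (inChart τ x₀ y) :=
  wedgeAlt_compContinuousLinearMap _ _ _

theorem IsSmooth.add {η τ : DForm M k} (hη : IsSmooth η) (hτ : IsSmooth τ) : IsSmooth (η + τ) :=
  fun x₀ => (hη x₀).add (hτ x₀)

theorem isSmooth_zero : IsSmooth (0 : DForm M k) := fun x₀ =>
  (contDiffOn_const (c := 0)).congr fun y _ => inChart_zero x₀ y

theorem IsSmooth.clm {η τ : DForm M k} (hη : IsSmooth η) (f : ℂ →L[ℝ] ℂ)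
    (h : ∀ x₀ y, inChart τ x₀ y = f.compContinuousAlternatingMap (inChart η x₀ y)) :
    IsSmooth τ := fun x₀ =>
  (((ContinuousLinearMap.compContinuousAlternatingMapCLM (ι := Fin k) (𝕜 := ℝ) E4 ℂ ℂ
    f).contDiff.comp_contDiffOn (hη x₀))).congr fun y _ => h x₀ y

theorem IsSmooth.smul {η : DForm M k} (hη : IsSmooth η) (c : ℂ) : IsSmooth (c • η) :=
  hη.clm (ContinuousLinearMap.mul ℝ ℂ c) fun _ _ => rfl

theorem IsSmooth.conj {η : DForm M k} (hη : IsSmooth η) : IsSmooth (conj η) :=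
  hη.clm (Complex.conjCLE : ℂ →L[ℝ] ℂ) fun _ _ => rfl

theorem IsSmooth.wedge {η : DForm M p} {τ : DForm M q} (hη : IsSmooth η) (hτ : IsSmooth τ) :
    IsSmooth (wedge η τ) := by
  intro x₀
  have h1 : ContDiff ℝ ∞ (fun r : (E4 [⋀^Fin p]→L[ℝ] ℂ) × (E4 [⋀^Fin q]→L[ℝ] ℂ) =>
    wedgeAltL p q r.1 r.2) := (wedgeAltL p q).isBoundedBilinearMap.contDiff
  exact (ContDiff.comp_contDiffOn (f := fun y => (inChart η x₀ y, inChart τ x₀ y))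
    (g := fun r : (E4 [⋀^Fin p]→L[ℝ] ℂ) × (E4 [⋀^Fin q]→L[ℝ] ℂ) => wedgeAltL p q r.1 r.2)
    h1 ((hη x₀).prodMk (hτ x₀))).congr fun y _ => inChart_wedge η τ x₀ y

/-- Constants as alternating maps in no variables, linearly. -/
def constL : ℂ →L[ℝ] (E4 [⋀^Fin 0]→L[ℝ] ℂ) :=
  LinearMap.toContinuousLinearMap
    { toFun := fun c => ContinuousAlternatingMap.constOfIsEmpty ℝ E4 (Fin 0) c
      map_add' := fun _ _ => rfl
      map_smul' := fun _ _ => rfl }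

variable [IsManifold (𝓡 4) ∞ M]

theorem isSmooth_ofFun {f : M → ℂ} (hf : ContMDiff (𝓡 4) 𝓘(ℝ, ℂ) ∞ f) : IsSmooth (ofFun f) := by
  intro x₀
  have h1 : ContDiffOn ℝ ∞ (f ∘ (extChartAt (𝓡 4) x₀).symm) (extChartAt (𝓡 4) x₀).target := by
    rw [← contMDiffOn_iff_contDiffOn]
    exact hf.comp_contMDiffOn (contMDiffOn_extChartAt_symm x₀)
  exact (constL.contDiff.comp_contDiffOn h1).congr fun y _ => rfl

end DForm

variable [IsManifold (𝓡 4) ∞ M]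

omit [IsManifold (𝓡 4) ∞ M] in
theorem DForm.IsSmooth.differentiableAt {η : DForm M k} (hη : DForm.IsSmooth η) {x₀ : M} {y : E4}
    (hy : y ∈ (extChartAt (𝓡 4) x₀).target) : DifferentiableAt ℝ (DForm.inChart η x₀) y :=
  ((hη x₀).contDiffAt ((isOpen_extChartAt_target x₀).mem_nhds hy)).differentiableAt (by simp)

theorem lieDeriv_add {X : VField M} (hX : VField.IsSmooth X) {η τ : DForm M k}
    (hη : DForm.IsSmooth η) (hτ : DForm.IsSmooth τ) :
    lieDeriv X (η + τ) = lieDeriv X η + lieDeriv X τ := by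
  refine DForm.ext_inChart fun x₀ y hy => ?_
  rw [inChart_lieDeriv hX (hη.add hτ) hy, DForm.inChart_add, inChart_lieDeriv hX hη hy,
    inChart_lieDeriv hX hτ hy]
  rw [← lieDerivCoord_add _ (hη.differentiableAt hy) (hτ.differentiableAt hy)]
  exact congrArg (fun f => lieDerivCoord _ f y) (funext fun z => DForm.inChart_add η τ x₀ z)

theorem lieDeriv_smul {X : VField M} (hX : VField.IsSmooth X) {η : DForm M k}
    (hη : DForm.IsSmooth η) (c : ℂ) : lieDeriv X (c • η) = c • lieDeriv X η := by
  refine DForm.ext_inChart fun x₀ y hy => ?_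
  rw [inChart_lieDeriv hX (hη.smul c) hy, DForm.inChart_smul, inChart_lieDeriv hX hη hy]
  rw [← lieDerivCoord_smul _ (hη.differentiableAt hy) c]
  exact congrArg (fun f => lieDerivCoord _ f y) (funext fun z => DForm.inChart_smul c η x₀ z)

theorem lieDeriv_conj {X : VField M} (hX : VField.IsSmooth X) {η : DForm M k}
    (hη : DForm.IsSmooth η) : lieDeriv X (DForm.conj η) = DForm.conj (lieDeriv X η) := by
  refine DForm.ext_inChart fun x₀ y hy => ?_
  rw [inChart_lieDeriv hX hη.conj hy, DForm.inChart_conj, inChart_lieDeriv hX hη hy]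
  rw [← lieDerivCoord_clm _ (hη.differentiableAt hy) _]
  exact congrArg (fun f => lieDerivCoord _ f y) (funext fun z => DForm.inChart_conj η x₀ z)

theorem lieDeriv_wedge {X : VField M} (hX : VField.IsSmooth X) {η : DForm M p} {τ : DForm M q}
    (hη : DForm.IsSmooth η) (hτ : DForm.IsSmooth τ) :
    lieDeriv X (DForm.wedge η τ) =
      DForm.wedge (lieDeriv X η) τ + DForm.wedge η (lieDeriv X τ) := by
  refine DForm.ext_inChart fun x₀ y hy => ?_
  rw [inChart_lieDeriv hX (hη.wedge hτ) hy, DForm.inChart_add, DForm.inChart_wedge,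
    DForm.inChart_wedge, inChart_lieDeriv hX hη hy, inChart_lieDeriv hX hτ hy,
    ← lieDerivCoord_wedge _ (hη.differentiableAt hy) (hτ.differentiableAt hy)]
  exact congrArg (fun f => lieDerivCoord _ f y) (funext fun z => DForm.inChart_wedge η τ x₀ z)

/-- The bracket is natural under pullback along the inverse chart, so commuting fields have
commuting coordinate expressions. -/
theorem lieBracket_inChart {X Y : VField M} (hX : VField.IsSmooth X) (hY : VField.IsSmooth Y)
    (hXY : VectorField.mlieBracket (𝓡 4) X Y = 0) {x₀ : M} {y : E4}
    (hy : y ∈ (extChartAt (𝓡 4) x₀).target) :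
    VectorField.lieBracket ℝ (VField.inChart X x₀) (VField.inChart Y x₀) y = 0 := by
  have : IsManifold (𝓡 4) (minSmoothness ℝ 3) M :=
    IsManifold.of_le (n := ∞) (by simp; norm_cast)
  have h := VectorField.mpullback_mlieBracket (n := ∞) (I := 𝓘(ℝ, E4)) (I' := 𝓡 4)
    (f := (extChartAt (𝓡 4) x₀).symm) (V := X) (W := Y) (x₀ := y)
    ((hX _).mdifferentiableAt (by simp)) ((hY _).mdifferentiableAt (by simp))
    ((contMDiffOn_extChartAt_symm (I := 𝓡 4) (n := ∞) x₀).contMDiffAt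
      ((isOpen_extChartAt_target x₀).mem_nhds hy)) (by simp; norm_cast)
  rw [hXY, VectorField.mpullback_zero, ← VectorField.mlieBracketWithin_univ,
    VectorField.mlieBracketWithin_eq_lieBracketWithin] at h
  have e : VectorField.lieBracketWithin ℝ (VField.inChart X x₀) (VField.inChart Y x₀) univ =
    VectorField.lieBracket ℝ (VField.inChart X x₀) (VField.inChart Y x₀) :=
    VectorField.lieBracketWithin_univ
  exact (congrFun e y).symm.trans h.symm

theorem lieDeriv_comm {X Y : VField M} (hX : VField.IsSmooth X) (hY : VField.IsSmooth Y)
    (hXY : VectorField.mlieBracket (𝓡 4) X Y = 0) {η : DForm M k} (hη : DForm.IsSmooth η) :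
    lieDeriv X (lieDeriv Y η) = lieDeriv Y (lieDeriv X η) := by
  refine DForm.ext_inChart fun x₀ y hy => ?_
  have ho := (isOpen_extChartAt_target (I := 𝓡 4) x₀).mem_nhds hy
  rw [inChart_lieDeriv hX (isSmooth_lieDeriv hY hη) hy,
    inChart_lieDeriv hY (isSmooth_lieDeriv hX hη) hy]
  -- The outer Lie derivative differentiates the inner one, so the coordinate formula for the latter
  -- is needed on a neighbourhood of `y` and not only at `y`.
  have hc : ∀ {Z : VField M}, VField.IsSmooth Z → DForm.inChart (lieDeriv Z η) x₀ =ᶠ[𝓝 y]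
      lieDerivCoord (VField.inChart Z x₀) (DForm.inChart η x₀) := fun hZ =>
    eventually_of_mem ho fun z hz => inChart_lieDeriv hZ hη hz
  rw [lieDerivCoord_congr (EventuallyEq.refl _ _) (hc hY),
    lieDerivCoord_congr (EventuallyEq.refl _ _) (hc hX)]
  exact lieDerivCoord_comm ((hX.contDiffOn x₀).contDiffAt ho) ((hY.contDiffOn x₀).contDiffAt ho)
    ((hη x₀).contDiffAt ho)
    (eventually_of_mem ho fun z hz => lieBracket_inChart hX hY hXY hz)

omit [IsManifold (𝓡 4) ∞ M] in
/-- The Lie derivative is local. -/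
theorem lieDeriv_eq_zero_of_eventually {X : VField M} {η : DForm M k} {x : M}
    (h : ∀ᶠ z in 𝓝 x, η z = 0) : lieDeriv X η x = 0 := by
  have hc : ContinuousAt (extChartAt (𝓡 4) x).symm (extChartAt (𝓡 4) x x) :=
    continuousAt_extChartAt_symm x
  have h1 : DForm.inChart η x =ᶠ[𝓝 (extChartAt (𝓡 4) x x)] fun _ => 0 := by
    have h2 : ∀ᶠ y in 𝓝 (extChartAt (𝓡 4) x x), η ((extChartAt (𝓡 4) x).symm y) = 0 :=
      hc.eventually (by rwa [extChartAt_to_inv])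
    filter_upwards [h2] with y hy
    rw [DForm.inChart_eq, DForm.val, hy]
    rfl
  have h3 : lieDerivCoord (VField.inChart X x) (DForm.inChart η x) (extChartAt (𝓡 4) x x) = 0 := by
    rw [lieDerivCoord_congr (EventuallyEq.refl _ _) h1, lieDerivCoord_eq]
    simp
  rw [lieDeriv, h3]
  rfl

/-- A form with compact support. -/
def DForm.IsCompactlySupported (η : DForm M k) : Prop :=
  ∃ K : Set M, IsCompact K ∧ ∀ x ∉ K, η x = 0

omit [IsManifold (𝓡 4) ∞ M] in
theorem DForm.IsCompactlySupported.lieDeriv [T2Space M] {η : DForm M k}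
    (hη : η.IsCompactlySupported) (X : VField M) : (lieDeriv X η).IsCompactlySupported := by
  obtain ⟨K, hK, h⟩ := hη
  exact ⟨K, hK, fun x hx => lieDeriv_eq_zero_of_eventually
    (eventually_of_mem (hK.isClosed.isOpen_compl.mem_nhds hx) h)⟩

end SmoothForms

/-! ### Integration over the manifold and Stokes' theorem -/

section Integration

open Filter Topology Set MeasureTheory

variable {M : Type*} [TopologicalSpace M] [ChartedSpace E4 M] {k : ℕ}

/-- The product of a real function and a form. -/
def DForm.mulFun (f : M → ℝ) (η : DForm M k) : DForm M k := fun x => ((f x : ℝ) : ℂ) • η x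

theorem mulFun_apply_eq_zero_left {f : M → ℝ} {x : M} (h : f x = 0) (η : DForm M k) :
    DForm.mulFun f η x = 0 := by
  ext v
  change ((f x : ℝ) : ℂ) * η x v = 0
  rw [h, Complex.ofReal_zero, zero_mul]

theorem mulFun_apply_eq_zero_right (f : M → ℝ) {x : M} {η : DForm M k} (h : η x = 0) :
    DForm.mulFun f η x = 0 := by
  ext v
  change ((f x : ℝ) : ℂ) * η x v = 0
  rw [h]
  exact mul_zero _

/-- The integral of a 4-form over the preferred chart at `x₀`. -/
def chartIntegral (x₀ : M) (η : DForm M 4) : ℂ :=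
  ∫ y in (extChartAt (𝓡 4) x₀).target, volCoeff (DForm.inChart η x₀ y)

theorem inChart_mulFun (f : M → ℝ) (η : DForm M k) (x₀ : M) (y : E4) :
    DForm.inChart (DForm.mulFun f η) x₀ y =
      ((f ((extChartAt (𝓡 4) x₀).symm y) : ℝ) : ℂ) • DForm.inChart η x₀ y := rfl

theorem volCoeff_smul (c : ℂ) (a : E4 [⋀^Fin 4]→L[ℝ] ℂ) : volCoeff (c • a) = c * volCoeff a := rfl

theorem inChart_eq_zero {η : DForm M k} {x₀ : M} {y : E4}
    (h : η ((extChartAt (𝓡 4) x₀).symm y) = 0) : DForm.inChart η x₀ y = 0 := by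
  rw [DForm.inChart_eq, DForm.val, h]
  rfl

/-- The image of a compact subset of a chart domain. -/
theorem isCompact_image_extChartAt {x₀ : M} {K : Set M} (hK : IsCompact K)
    (hKs : K ⊆ (extChartAt (𝓡 4) x₀).source) : IsCompact (extChartAt (𝓡 4) x₀ '' K) :=
  hK.image_of_continuousOn ((continuousOn_extChartAt x₀).mono hKs)

theorem inChart_eq_zero_of_notMem_image {η : DForm M k} {x₀ : M} {K : Set M}
    (h0 : ∀ x ∉ K, η x = 0) {y : E4} (hy : y ∈ (extChartAt (𝓡 4) x₀).target)
    (hyK : y ∉ extChartAt (𝓡 4) x₀ '' K) : DForm.inChart η x₀ y = 0 :=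
  inChart_eq_zero (h0 _ fun hx => hyK ⟨_, hx, (extChartAt (𝓡 4) x₀).right_inv hy⟩)

theorem integrableOn_volCoeff {η : DForm M 4} {x₀ : M} {K : Set M} (hK : IsCompact K)
    (hKs : K ⊆ (extChartAt (𝓡 4) x₀).source) (h0 : ∀ x ∉ K, η x = 0)
    (hη : ContinuousOn (fun y => volCoeff (DForm.inChart η x₀ y)) (extChartAt (𝓡 4) x₀).target) :
    IntegrableOn (fun y => volCoeff (DForm.inChart η x₀ y)) (extChartAt (𝓡 4) x₀).target := by
  have hsub : extChartAt (𝓡 4) x₀ '' K ⊆ (extChartAt (𝓡 4) x₀).target := by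
    rintro _ ⟨x, hx, rfl⟩
    exact (extChartAt (𝓡 4) x₀).map_source (hKs hx)
  refine IntegrableOn.of_forall_sdiff_eq_zero
    ((hη.mono hsub).integrableOn_compact (isCompact_image_extChartAt hK hKs))
    (isOpen_extChartAt_target x₀).measurableSet fun y hy => ?_
  rw [inChart_eq_zero_of_notMem_image h0 hy.1 hy.2, map_zero]

section Smooth

variable [IsManifold (𝓡 4) ∞ M]

omit [IsManifold (𝓡 4) ∞ M] in
theorem image_transition_overlap (x₁ x₀ : M) :
    transition x₁ x₀ '' overlap x₁ x₀ = overlap x₀ x₁ := by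
  refine Subset.antisymm ?_ fun y hy => ⟨transition x₀ x₁ y, transition_mem_overlap hy,
    transition_transition hy⟩
  rintro _ ⟨y, hy, rfl⟩
  exact transition_mem_overlap hy

/-- Independence of the chart of the integral of a form supported in two chart domains. -/
theorem chartIntegral_eq (hM : OrientedAtlas M) {η : DForm M 4} {i j : M}
    (hi : ∀ x ∉ (extChartAt (𝓡 4) i).source, η x = 0)
    (hj : ∀ x ∉ (extChartAt (𝓡 4) j).source, η x = 0) :
    chartIntegral i η = chartIntegral j η := by
  -- A form vanishing outside the domain of the chart at `j` contributes to the integral over the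
  -- chart at `i` only on the overlap.
  have restr : ∀ {i j : M}, (∀ x ∉ (extChartAt (𝓡 4) j).source, η x = 0) → chartIntegral i η =
      ∫ y in overlap i j, volCoeff (DForm.inChart η i y) := by
    intro i j hj
    refine setIntegral_eq_of_subset_of_forall_sdiff_eq_zero
      (isOpen_extChartAt_target i).measurableSet inter_subset_left fun y hy => ?_
    rw [inChart_eq_zero (hj _ fun h => hy.2 ⟨hy.1, h⟩), map_zero]
  rw [restr hj, restr hi, ← image_transition_overlap j i,
    integral_image_eq_integral_abs_det_fderiv_smul volume (isOpen_overlap j i).measurableSet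
      (f' := fderiv ℝ (transition j i))]
  · refine setIntegral_congr_fun (isOpen_overlap j i).measurableSet fun y hy => ?_
    -- A top-degree form acquires the Jacobian determinant and the change of variables its absolute
    -- value; these agree because the atlas is oriented.
    rw [DForm.inChart_transition η hy, volCoeff_compContinuousLinearMap,
      abs_of_pos (det_fderiv_transition_pos hM hy), Complex.real_smul]
  · intro y hy
    exact (((contDiffOn_transition j i).contDiffAt ((isOpen_overlap j i).mem_nhds
      hy)).differentiableAt (by simp)).hasFDerivAt.hasFDerivWithinAt
  · exact fun y hy z hz h => by
      rw [← transition_transition hy, h, transition_transition hz]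

variable [T2Space M] [SigmaCompactSpace M]

theorem chartPartition_isSubordinate (M : Type*) [TopologicalSpace M] [ChartedSpace E4 M]
    [IsManifold (𝓡 4) ∞ M] [T2Space M] [SigmaCompactSpace M] (i : M) :
    tsupport (chartPartition M i) ⊆ (extChartAt (𝓡 4) i).source := by
  rw [extChartAt_source]
  exact (SmoothPartitionOfUnity.exists_isSubordinate_chartAt_source (𝓡 4) M).choose_spec i

theorem DForm.integral_eq_finsum (η : DForm M 4) :
    DForm.integral η = ∑ᶠ i : M, chartIntegral i (DForm.mulFun (chartPartition M i) η) := rfl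

theorem mulFun_chartPartition_eq_zero (η : DForm M k) {i x : M}
    (hx : x ∉ (extChartAt (𝓡 4) i).source) : DForm.mulFun (chartPartition M i) η x = 0 := by
  have : chartPartition M i x = 0 := by
    by_contra h
    exact hx (chartPartition_isSubordinate M i (subset_tsupport _ h))
  exact mulFun_apply_eq_zero_left this η

theorem finite_chartPartition_inter {K : Set M} (hK : IsCompact K) :
    {i : M | (Function.support (chartPartition M i) ∩ K).Nonempty}.Finite :=
  (chartPartition M).locallyFinite.finite_nonempty_inter_compact hK

theorem mulFun_chartPartition_eq_zero_of_notMem {η : DForm M k} {K : Set M}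
    (h0 : ∀ x ∉ K, η x = 0) {i : M}
    (hi : i ∉ {i : M | (Function.support (chartPartition M i) ∩ K).Nonempty}) :
    DForm.mulFun (chartPartition M i) η = 0 := by
  funext x
  by_cases hx : x ∈ K
  · have : chartPartition M i x = 0 := by
      by_contra h
      exact hi ⟨x, h, hx⟩
    exact mulFun_apply_eq_zero_left this η
  · exact mulFun_apply_eq_zero_right _ (h0 x hx)

omit [IsManifold (𝓡 4) ∞ M] [T2Space M] [SigmaCompactSpace M] in
theorem chartIntegral_zero (x₀ : M) : chartIntegral x₀ (0 : DForm M 4) = 0 := by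
  simp [chartIntegral, DForm.inChart_zero]

theorem support_chartIntegral_subset {η : DForm M 4} {K : Set M} (h0 : ∀ x ∉ K, η x = 0) :
    Function.support (fun i => chartIntegral i (DForm.mulFun (chartPartition M i) η)) ⊆
      {i : M | (Function.support (chartPartition M i) ∩ K).Nonempty} := by
  intro i hi
  by_contra h
  exact hi (by simp only [mulFun_chartPartition_eq_zero_of_notMem h0 h, chartIntegral_zero])

theorem sum_chartPartition_eq_one {K : Set M} (hK : IsCompact K) {x : M} (hx : x ∈ K) :
    ∑ i ∈ (finite_chartPartition_inter hK).toFinset, chartPartition M i x = 1 := by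
  rw [← (chartPartition M).sum_eq_one (mem_univ x)]
  refine (finsum_eq_sum_of_support_subset _ fun i hi => ?_).symm
  simp only [Finite.coe_toFinset, mem_ofPred_eq]
  exact ⟨x, hi, hx⟩

theorem continuousOn_partition_symm (i x₀ : M) :
    ContinuousOn (fun y => ((chartPartition M i ((extChartAt (𝓡 4) x₀).symm y) : ℝ) : ℂ))
      (extChartAt (𝓡 4) x₀).target :=
  Complex.continuous_ofReal.comp_continuousOn
    ((chartPartition M i).contMDiff.continuous.comp_continuousOn (continuousOn_extChartAt_symm x₀))

/-- The integral of a form supported in a chart domain is computed in that chart. -/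
theorem DForm.integral_eq_chartIntegral (hM : OrientedAtlas M) {η : DForm M 4} {x₀ : M}
    {K : Set M} (hK : IsCompact K) (hKs : K ⊆ (extChartAt (𝓡 4) x₀).source)
    (h0 : ∀ x ∉ K, η x = 0)
    (hη : ContinuousOn (fun y => volCoeff (DForm.inChart η x₀ y)) (extChartAt (𝓡 4) x₀).target) :
    DForm.integral η = chartIntegral x₀ η := by
  -- Each piece is supported both in its own chart and in the chart at `x₀`, so all pieces can be
  -- integrated in the latter. There the partition functions sum to `1` on `K`.
  have h1 : ∀ i, chartIntegral i (DForm.mulFun (chartPartition M i) η) =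
      chartIntegral x₀ (DForm.mulFun (chartPartition M i) η) := fun i =>
    chartIntegral_eq hM (fun x hx => mulFun_chartPartition_eq_zero η hx) fun x hx => by
      exact mulFun_apply_eq_zero_right _ (h0 x fun h => hx (hKs h))
  have hfin := finite_chartPartition_inter (M := M) hK
  rw [DForm.integral_eq_finsum, finsum_eq_sum_of_support_subset (s := hfin.toFinset) _
    (by simpa using support_chartIntegral_subset h0), Finset.sum_congr rfl fun i _ => h1 i]
  simp only [chartIntegral]
  rw [← integral_finsetSum]
  · refine setIntegral_congr_fun (isOpen_extChartAt_target x₀).measurableSet fun y hy => ?_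
    simp only [inChart_mulFun, volCoeff_smul]
    rw [← Finset.sum_mul]
    by_cases hyK : (extChartAt (𝓡 4) x₀).symm y ∈ K
    · rw [← Complex.ofReal_sum, sum_chartPartition_eq_one hK hyK, Complex.ofReal_one, one_mul]
    · rw [inChart_eq_zero (h0 _ hyK), map_zero, mul_zero]
  · intro i _
    refine integrableOn_volCoeff hK hKs (fun x hx => mulFun_apply_eq_zero_right _ (h0 x hx)) ?_
    simp only [inChart_mulFun, volCoeff_smul]
    exact (continuousOn_partition_symm i x₀).mul hη

theorem DForm.integral_smul (c : ℂ) (η : DForm M 4) :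
    DForm.integral (c • η) = c * DForm.integral η := by
  rw [DForm.integral_eq_finsum, DForm.integral_eq_finsum, ← smul_eq_mul, smul_finsum]
  refine finsum_congr fun i => ?_
  simp only [chartIntegral, smul_eq_mul]
  rw [← integral_const_mul]
  refine integral_congr_ae (Eventually.of_forall fun y => ?_)
  simp only [inChart_mulFun, DForm.inChart_smul, volCoeff_smul]
  ring

theorem DForm.integral_conj (η : DForm M 4) :
    DForm.integral (DForm.conj η) = (starRingEnd ℂ) (DForm.integral η) := by
  rw [DForm.integral_eq_finsum, DForm.integral_eq_finsum]
  refine Eq.trans ?_ ((starRingAut (R := ℂ)).toAddEquiv.map_finsum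
    (fun i => chartIntegral i (DForm.mulFun (chartPartition M i) η))).symm
  refine finsum_congr fun i => ?_
  change _ = (starRingEnd ℂ) _
  simp only [chartIntegral]
  rw [← _root_.integral_conj]
  refine integral_congr_ae (Eventually.of_forall fun y => ?_)
  simp only [inChart_mulFun, volCoeff_smul, map_mul, Complex.conj_ofReal]
  rfl

theorem integrableOn_mulFun_chartPartition {η : DForm M 4} (hη : DForm.IsSmooth η)
    {K : Set M} (hK : IsCompact K) (h0 : ∀ x ∉ K, η x = 0) (i : M) :
    IntegrableOn (fun y => volCoeff (DForm.inChart (DForm.mulFun (chartPartition M i) η) i y))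
      (extChartAt (𝓡 4) i).target := by
  refine integrableOn_volCoeff (K := K ∩ tsupport (chartPartition M i))
    (hK.inter_right (isClosed_tsupport _))
    (inter_subset_right.trans (chartPartition_isSubordinate M i)) (fun x hx => ?_) ?_
  · by_cases hxK : x ∈ K
    · have : chartPartition M i x = 0 := by
        by_contra h
        exact hx ⟨hxK, subset_tsupport _ h⟩
      exact mulFun_apply_eq_zero_left this η
    · exact mulFun_apply_eq_zero_right _ (h0 x hxK)
  · simp only [inChart_mulFun, volCoeff_smul]
    exact (continuousOn_partition_symm i i).mul
      (volCoeff.continuous.comp_continuousOn (hη i).continuousOn)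

theorem DForm.integral_add {η τ : DForm M 4} (hη : DForm.IsSmooth η) (hτ : DForm.IsSmooth τ)
    (hηc : η.IsCompactlySupported) (hτc : τ.IsCompactlySupported) :
    DForm.integral (η + τ) = DForm.integral η + DForm.integral τ := by
  obtain ⟨K, hK, h0⟩ := hηc
  obtain ⟨L, hL, h0'⟩ := hτc
  rw [DForm.integral_eq_finsum, DForm.integral_eq_finsum, DForm.integral_eq_finsum,
    ← finsum_add_distrib ((finite_chartPartition_inter hK).subset (support_chartIntegral_subset h0))
      ((finite_chartPartition_inter hL).subset (support_chartIntegral_subset h0'))]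
  refine finsum_congr fun i => ?_
  simp only [chartIntegral]
  rw [← MeasureTheory.integral_add (integrableOn_mulFun_chartPartition hη hK h0 i)
    (integrableOn_mulFun_chartPartition hτ hL h0' i)]
  refine integral_congr_ae (Eventually.of_forall fun y => ?_)
  simp only [inChart_mulFun, volCoeff_smul, DForm.inChart_add, map_add, mul_add]

omit [T2Space M] [SigmaCompactSpace M] in
theorem isSmooth_mulFun {f : M → ℝ} (hf : ContMDiff (𝓡 4) 𝓘(ℝ, ℝ) ∞ f) {η : DForm M k}
    (hη : DForm.IsSmooth η) : DForm.IsSmooth (DForm.mulFun f η) := by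
  intro x₀
  have h1 : ContDiffOn ℝ ∞ (f ∘ (extChartAt (𝓡 4) x₀).symm) (extChartAt (𝓡 4) x₀).target := by
    rw [← contMDiffOn_iff_contDiffOn]
    exact hf.comp_contMDiffOn (contMDiffOn_extChartAt_symm x₀)
  refine (h1.smul (hη x₀)).congr fun y _ => ?_
  rw [inChart_mulFun, ofReal_smul_form]
  rfl

omit [IsManifold (𝓡 4) ∞ M] [T2Space M] [SigmaCompactSpace M] in
theorem lieDeriv_eq_zero_of_notMem {η : DForm M k} {K : Set M} (hK : IsClosed K)
    (h0 : ∀ x ∉ K, η x = 0) (X : VField M) : ∀ x ∉ K, lieDeriv X η x = 0 := fun _ hx =>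
  lieDeriv_eq_zero_of_eventually (eventually_of_mem (hK.isOpen_compl.mem_nhds hx) h0)

theorem integral_lieDeriv_eq_zero_of_subset (hM : OrientedAtlas M) {X : VField M}
    (hX : VField.IsSmooth X) {η : DForm M 4} (hη : DForm.IsSmooth η) {x₀ : M} {K : Set M}
    (hK : IsCompact K) (hKs : K ⊆ (extChartAt (𝓡 4) x₀).source) (h0 : ∀ x ∉ K, η x = 0) :
    DForm.integral (lieDeriv X η) = 0 := by
  rw [DForm.integral_eq_chartIntegral hM hK hKs (lieDeriv_eq_zero_of_notMem hK.isClosed h0 X)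
    (volCoeff.continuous.comp_continuousOn (isSmooth_lieDeriv hX hη x₀).continuousOn)]
  rw [← integral_volCoeff_lieDerivCoord (isOpen_extChartAt_target x₀)
    (isCompact_image_extChartAt hK hKs) (by
      rintro _ ⟨x, hx, rfl⟩
      exact (extChartAt (𝓡 4) x₀).map_source (hKs hx)) (hX.contDiffOn x₀) (hη x₀)
    fun y hy hyK => inChart_eq_zero_of_notMem_image h0 hy hyK]
  exact setIntegral_congr_fun (isOpen_extChartAt_target x₀).measurableSet fun y hy => by
    simp only [inChart_lieDeriv hX hη hy]

/-- **Stokes' theorem** for Lie derivatives of compactly supported top-degree forms. -/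
theorem integral_lieDeriv_eq_zero (hM : OrientedAtlas M) {X : VField M}
    (hX : VField.IsSmooth X) {η : DForm M 4} (hη : DForm.IsSmooth η)
    (hηc : η.IsCompactlySupported) : DForm.integral (lieDeriv X η) = 0 := by
  obtain ⟨K, hK, h0⟩ := hηc
  have hsm : ∀ i, DForm.IsSmooth (DForm.mulFun (chartPartition M i) η) := fun i =>
    isSmooth_mulFun (chartPartition M i).contMDiff hη
  have hsupp : ∀ i, ∀ x ∉ K ∩ tsupport (chartPartition M i),
      DForm.mulFun (chartPartition M i) η x = 0 := by
    intro i x hx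
    by_cases hxK : x ∈ K
    · have : chartPartition M i x = 0 := by
        by_contra h
        exact hx ⟨hxK, subset_tsupport _ h⟩
      exact mulFun_apply_eq_zero_left this η
    · exact mulFun_apply_eq_zero_right _ (h0 x hxK)
  have hKi : ∀ i, IsCompact (K ∩ tsupport (chartPartition M i)) := fun i =>
    hK.inter_right (isClosed_tsupport _)
  -- Only finitely many partition functions meet `K`, so `η` is a finite sum of forms each supported
  -- in one chart domain.
  have hsum : η = ∑ i ∈ (finite_chartPartition_inter hK).toFinset,
      DForm.mulFun (chartPartition M i) η := by
    funext x
    rw [Finset.sum_apply]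
    by_cases hx : x ∈ K
    · simp only [DForm.mulFun]
      rw [← Finset.sum_smul, ← Complex.ofReal_sum, sum_chartPartition_eq_one hK hx,
        Complex.ofReal_one, one_smul]
    · rw [h0 x hx]
      exact (Finset.sum_eq_zero fun i _ => mulFun_apply_eq_zero_right _ (h0 x hx)).symm
  -- Smoothness and compact support of the partial sums are carried through the induction because
  -- additivity of the integral needs both.
  have hind : ∀ s : Finset M,
      DForm.IsSmooth (∑ i ∈ s, DForm.mulFun (chartPartition M i) η) ∧
      (∑ i ∈ s, DForm.mulFun (chartPartition M i) η).IsCompactlySupported ∧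
      DForm.integral (lieDeriv X (∑ i ∈ s, DForm.mulFun (chartPartition M i) η)) = 0 := by
    classical
    intro s
    induction s using Finset.induction_on with
    | empty =>
      refine ⟨DForm.isSmooth_zero, ⟨∅, isCompact_empty, fun x _ => rfl⟩, ?_⟩
      have hc : ∀ η : DForm M 4, (0 : ℂ) • η = 0 := fun η => by
        funext x
        ext v
        exact zero_mul _
      have hz : lieDeriv X (0 : DForm M 4) = 0 := by
        have h := lieDeriv_smul hX (DForm.isSmooth_zero (M := M) (k := 4)) 0
        rwa [hc, hc] at h
      rw [Finset.sum_empty, hz]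
      have h := DForm.integral_smul 0 (0 : DForm M 4)
      rwa [hc, zero_mul] at h
    | insert i s hi ih =>
      obtain ⟨h1, h2, h3⟩ := ih
      rw [Finset.sum_insert hi]
      have h2' := h2
      obtain ⟨L, hL, hL0⟩ := h2'
      refine ⟨(hsm i).add h1, ⟨K ∩ tsupport (chartPartition M i) ∪ L, (hKi i).union hL,
        fun x hx => ?_⟩, ?_⟩
      · rw [Pi.add_apply, hsupp i x fun h => hx (Or.inl h), hL0 x fun h => hx (Or.inr h), add_zero]
      · rw [lieDeriv_add hX (hsm i) h1, DForm.integral_add (isSmooth_lieDeriv hX (hsm i))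
          (isSmooth_lieDeriv hX h1)
          (DForm.IsCompactlySupported.lieDeriv ⟨_, hKi i, hsupp i⟩ X) (h2.lieDeriv X), h3,
          integral_lieDeriv_eq_zero_of_subset hM hX (hsm i) (hKi i)
            (inter_subset_right.trans (chartPartition_isSubordinate M i)) (hsupp i), add_zero]
  rw [hsum]
  exact (hind _).2.2

end Smooth

end Integration

/-! ### Abelian twists as exponentials acting on tensor products -/

section TwistedProducts

open Finset TensorProduct

variable {ι : Type*} [Fintype ι] {A B C X : Type*} [AddCommMonoid A] [Module ℂ A]
  [AddCommMonoid B] [Module ℂ B] [AddCommMonoid C] [Module ℂ C] [AddCommMonoid X] [Module ℂ X]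

/-- The composition of a pairing `w` with `(Θ^{αβ} l_α ⊗ l_β)^r`. -/
def pairingDeriv (Θ : ι → ι → ℝ) (lA : ι → A →ₗ[ℂ] A) (lB : ι → B →ₗ[ℂ] B)
    (w : A →ₗ[ℂ] B →ₗ[ℂ] C) : ℕ → A →ₗ[ℂ] B →ₗ[ℂ] C
  | 0 => w
  | r + 1 => ∑ α, ∑ β, ((Θ α β : ℝ) : ℂ) • (pairingDeriv Θ lA lB w r).compl₁₂ (lA α) (lB β)

variable {Θ : ι → ι → ℝ} {lA : ι → A →ₗ[ℂ] A} {lB : ι → B →ₗ[ℂ] B} {lC : ι → C →ₗ[ℂ] C}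
  {w : A →ₗ[ℂ] B →ₗ[ℂ] C}

theorem pairingDeriv_succ_apply (r : ℕ) (a : A) (b : B) :
    pairingDeriv Θ lA lB w (r + 1) a b =
      ∑ α, ∑ β, ((Θ α β : ℝ) : ℂ) • pairingDeriv Θ lA lB w r (lA α a) (lB β b) := by
  simp [pairingDeriv, LinearMap.sum_apply]

/-- The operators `l` commute with one another, so each contraction with `Θ` commutes with the total
action and the Leibniz rule of `w` is inherited. -/
theorem pairingDeriv_equivariant
    (hA : ∀ α β a, lA α (lA β a) = lA β (lA α a)) (hB : ∀ α β b, lB α (lB β b) = lB β (lB α b))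
    (hw : ∀ γ a b, lC γ (w a b) = w (lA γ a) b + w a (lB γ b)) (γ : ι) (r : ℕ) :
    ∀ a b, lC γ (pairingDeriv Θ lA lB w r a b) =
      pairingDeriv Θ lA lB w r (lA γ a) b + pairingDeriv Θ lA lB w r a (lB γ b) := by
  induction r with
  | zero => exact hw γ
  | succ r ih =>
    intro a b
    simp only [pairingDeriv_succ_apply, map_sum, map_smul, ih, ← sum_add_distrib, smul_add]
    simp only [hA _ γ, hB _ γ]

/-- The coefficient of `λ^r` in the product of `a` and `b` twisted by `exp(λ c Θ^{αβ} l_α ⊗ l_β)`. -/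
def starTerm (Θ : ι → ι → ℝ) (c : ℂ) (lA : ι → A →ₗ[ℂ] A) (lB : ι → B →ₗ[ℂ] B)
    (w : A →ₗ[ℂ] B →ₗ[ℂ] C) (r : ℕ) : A →ₗ[ℂ] B →ₗ[ℂ] C :=
  (c ^ r / (r ! : ℂ)) • pairingDeriv Θ lA lB w r

variable {c : ℂ}

theorem starTerm_zero : starTerm Θ c lA lB w 0 = w := by
  simp [starTerm, pairingDeriv]

/-- The coefficientwise form of `d/dλ exp(λcP) = c exp(λcP) P`. In this shape the exponential can be
handled by induction without factorials. -/
theorem starTerm_succ (r : ℕ) (a : A) (b : B) :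
    ((r : ℂ) + 1) • starTerm Θ c lA lB w (r + 1) a b =
      c • ∑ α, ∑ β, ((Θ α β : ℝ) : ℂ) • starTerm Θ c lA lB w r (lA α a) (lB β b) := by
  have h : ((r : ℂ) + 1) ≠ 0 := by exact_mod_cast r.succ_ne_zero
  have hr : (r ! : ℂ) ≠ 0 := by exact_mod_cast r.factorial_ne_zero
  simp only [starTerm, LinearMap.smul_apply, pairingDeriv_succ_apply, smul_sum, smul_smul]
  refine sum_congr rfl fun α _ => sum_congr rfl fun β _ => congrArg (· • _) ?_
  rw [Nat.factorial_succ]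
  push_cast
  field_simp
  ring

theorem starTerm_equivariant
    (hA : ∀ α β a, lA α (lA β a) = lA β (lA α a)) (hB : ∀ α β b, lB α (lB β b) = lB β (lB α b))
    (hw : ∀ γ a b, lC γ (w a b) = w (lA γ a) b + w a (lB γ b)) (γ : ι) (r : ℕ) (a : A) (b : B) :
    lC γ (starTerm Θ c lA lB w r a b) =
      starTerm Θ c lA lB w r (lA γ a) b + starTerm Θ c lA lB w r a (lB γ b) := by
  simp only [starTerm, LinearMap.smul_apply, map_smul, pairingDeriv_equivariant hA hB hw, smul_add]

/-- The twisted product of formal power series. -/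
def seriesStar (Θ : ι → ι → ℝ) (c : ℂ) (lA : ι → A →ₗ[ℂ] A) (lB : ι → B →ₗ[ℂ] B)
    (w : A →ₗ[ℂ] B →ₗ[ℂ] C) (η : ℕ → A) (τ : ℕ → B) (n : ℕ) : C :=
  ∑ a ∈ antidiagonal n, ∑ b ∈ antidiagonal a.2, starTerm Θ c lA lB w a.1 (η b.1) (τ b.2)

/-- Multiplication of a formal power series by `λ`. -/
def seriesShift (η : ℕ → A) : ℕ → A
  | 0 => 0
  | n + 1 => η n

/-- A constant formal power series. -/
def seriesConst (a : A) : ℕ → A := Pi.single 0 a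

omit [Module ℂ A] in
theorem series_eq_const_add_shift (η : ℕ → A) :
    η = seriesConst (η 0) + seriesShift fun n => η (n + 1) := by
  funext n
  cases n <;> simp [seriesConst, seriesShift]

omit [Module ℂ A] in
theorem seriesShift_zero (η : ℕ → A) : seriesShift η 0 = 0 := rfl

omit [Module ℂ A] in
theorem seriesShift_succ (η : ℕ → A) (n : ℕ) : seriesShift η (n + 1) = η n := rfl

theorem seriesStar_add_left (η η' : ℕ → A) (τ : ℕ → B) :
    seriesStar Θ c lA lB w (η + η') τ =
      seriesStar Θ c lA lB w η τ + seriesStar Θ c lA lB w η' τ := by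
  funext n
  simp [seriesStar, sum_add_distrib]

theorem seriesStar_add_right (η : ℕ → A) (τ τ' : ℕ → B) :
    seriesStar Θ c lA lB w η (τ + τ') =
      seriesStar Θ c lA lB w η τ + seriesStar Θ c lA lB w η τ' := by
  funext n
  simp [seriesStar, sum_add_distrib]

/-- With `seriesStar_shift_right`, this is the `λ`-bilinearity that reduces identities between
series to constant series through `series_functional_eq_zero`. -/
theorem seriesStar_shift_left (η : ℕ → A) (τ : ℕ → B) :
    seriesStar Θ c lA lB w (seriesShift η) τ = seriesShift (seriesStar Θ c lA lB w η τ) := by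
  funext n
  cases n with
  | zero => simp [seriesStar, seriesShift_zero]
  | succ n =>
    simp only [seriesStar, seriesShift_succ, Nat.antidiagonal_succ' (n := n), sum_cons, sum_map]
    simp [seriesShift_zero, seriesShift_succ, Nat.antidiagonal_succ]

theorem seriesStar_shift_right (η : ℕ → A) (τ : ℕ → B) :
    seriesStar Θ c lA lB w η (seriesShift τ) = seriesShift (seriesStar Θ c lA lB w η τ) := by
  funext n
  cases n with
  | zero => simp [seriesStar, seriesShift_zero]
  | succ n =>
    simp only [seriesStar, seriesShift_succ, Nat.antidiagonal_succ' (n := n), sum_cons, sum_map]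
    simp [seriesShift_zero, seriesShift_succ, Nat.antidiagonal_succ']

/-- A sequence of linear maps `F r` equivariant under `l`, with `F = exp(λ c P)` applied to
`F 0`. -/
structure IsTwistFlow (c : ℂ) (l : ι → X →ₗ[ℂ] X) (P : X →ₗ[ℂ] X) (lA : ι → A →ₗ[ℂ] A)
    (F : ℕ → X →ₗ[ℂ] A) : Prop where
  equivariant : ∀ γ r x, lA γ (F r x) = F r (l γ x)
  succ : ∀ (r : ℕ) x, ((r : ℂ) + 1) • F (r + 1) x = c • F r (P x)

/-- The action of `l` and `lB` on the tensor product. -/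
def tensorAction (l : ι → X →ₗ[ℂ] X) (lB : ι → B →ₗ[ℂ] B) (γ : ι) : X ⊗[ℂ] B →ₗ[ℂ] X ⊗[ℂ] B :=
  map (l γ) LinearMap.id + map LinearMap.id (lB γ)

/-- The operator `P ⊗ 1 + Θ^{αβ} l_α ⊗ l_β`. -/
def tensorTwist (Θ : ι → ι → ℝ) (l : ι → X →ₗ[ℂ] X) (P : X →ₗ[ℂ] X) (lB : ι → B →ₗ[ℂ] B) :
    X ⊗[ℂ] B →ₗ[ℂ] X ⊗[ℂ] B :=
  map P LinearMap.id + ∑ α, ∑ β, ((Θ α β : ℝ) : ℂ) • map (l α) (lB β)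

/-- The twisted product of `F` with a further factor. -/
def tensorFlow (Θ : ι → ι → ℝ) (c : ℂ) (lA : ι → A →ₗ[ℂ] A) (lB : ι → B →ₗ[ℂ] B)
    (w : A →ₗ[ℂ] B →ₗ[ℂ] C) (F : ℕ → X →ₗ[ℂ] A) (r : ℕ) : X ⊗[ℂ] B →ₗ[ℂ] C :=
  ∑ a ∈ antidiagonal r, lift ((starTerm Θ c lA lB w a.1).comp (F a.2))

omit [Fintype ι] in
theorem tensorAction_tmul (l : ι → X →ₗ[ℂ] X) (γ : ι) (x : X) (b : B) :
    tensorAction l lB γ (x ⊗ₜ b) = l γ x ⊗ₜ b + x ⊗ₜ lB γ b := by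
  simp [tensorAction]

theorem tensorTwist_tmul (l : ι → X →ₗ[ℂ] X) (P : X →ₗ[ℂ] X) (x : X) (b : B) :
    tensorTwist Θ l P lB (x ⊗ₜ b) =
      P x ⊗ₜ b + ∑ α, ∑ β, ((Θ α β : ℝ) : ℂ) • (l α x ⊗ₜ[ℂ] lB β b) := by
  simp [tensorTwist, LinearMap.sum_apply]

theorem tensorFlow_tmul (F : ℕ → X →ₗ[ℂ] A) (r : ℕ) (x : X) (b : B) :
    tensorFlow Θ c lA lB w F r (x ⊗ₜ b) =
      ∑ a ∈ antidiagonal r, starTerm Θ c lA lB w a.1 (F a.2 x) b := by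
  simp [tensorFlow, LinearMap.sum_apply]

/-- Multiplying by one more constant factor means passing to one more tensor factor. An iterated
star product of constants thus becomes a single sequence of linear maps on a tensor product. -/
theorem seriesStar_const (F : ℕ → X →ₗ[ℂ] A) (x : X) (b : B) :
    seriesStar Θ c lA lB w (fun r => F r x) (seriesConst b) =
      fun r => tensorFlow Θ c lA lB w F r (x ⊗ₜ b) := by
  funext r
  rw [tensorFlow_tmul]
  refine sum_congr rfl fun a _ => ?_
  rw [sum_eq_single (a.2, 0)]
  · simp [seriesConst]
  · rintro ⟨i, j⟩ hij hne
    have : j ≠ 0 := by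
      rintro rfl
      simp at hij
      simp [hij] at hne
    simp [seriesConst, this]
  · simp

/-- The equivariance of `F` converts the `lA` in `Θ^{αβ} lA_α ⊗ lB_β` into the total action `l` on
the earlier factors. The Cauchy product of the two exponentials is then the exponential of the sum
`tensorTwist`. -/
theorem IsTwistFlow.tensor {l : ι → X →ₗ[ℂ] X} {P : X →ₗ[ℂ] X} {F : ℕ → X →ₗ[ℂ] A}
    (hF : IsTwistFlow c l P lA F)
    (hA : ∀ α β a, lA α (lA β a) = lA β (lA α a)) (hB : ∀ α β b, lB α (lB β b) = lB β (lB α b))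
    (hw : ∀ γ a b, lC γ (w a b) = w (lA γ a) b + w a (lB γ b)) :
    IsTwistFlow c (tensorAction l lB) (tensorTwist Θ l P lB) lC (tensorFlow Θ c lA lB w F) where
  equivariant γ r x := by
    induction x with
    | zero => simp
    | add x y hx hy => simp only [map_add, hx, hy]
    | tmul x b =>
      simp only [tensorAction_tmul, map_add, tensorFlow_tmul, map_sum, ← sum_add_distrib,
        starTerm_equivariant hA hB hw, hF.equivariant]
  succ r x := by
    induction x with
    | zero => simp
    | add x y hx hy => simp only [map_add, smul_add, hx, hy]
    | tmul x b =>
      -- On the antidiagonal of `r + 1` the factor `r + 1` splits as `a.1 + a.2`. The first sum is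
      -- lowered by `starTerm_succ`, the second by `hF.succ`.
      have h1 : ((r : ℂ) + 1) • tensorFlow Θ c lA lB w F (r + 1) (x ⊗ₜ b) =
          ∑ a ∈ antidiagonal (r + 1), (a.1 : ℂ) • starTerm Θ c lA lB w a.1 (F a.2 x) b +
          ∑ a ∈ antidiagonal (r + 1), (a.2 : ℂ) • starTerm Θ c lA lB w a.1 (F a.2 x) b := by
        rw [tensorFlow_tmul, smul_sum, ← sum_add_distrib]
        refine sum_congr rfl fun a ha => ?_
        rw [← add_smul]
        congr 1
        exact_mod_cast (mem_antidiagonal.1 ha).symm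
      rw [h1, Nat.sum_antidiagonal_succ, Nat.sum_antidiagonal_succ', tensorTwist_tmul]
      simp only [Nat.cast_zero, zero_smul, zero_add, map_add, map_sum, map_smul,
        Nat.cast_add, Nat.cast_one, tensorFlow_tmul, smul_add]
      rw [add_comm]
      congr 1
      · rw [smul_sum]
        refine sum_congr rfl fun a _ => ?_
        exact ((LinearMap.map_smul₂ _ _ _ _).symm.trans (congrArg
          (fun z => starTerm Θ c lA lB w a.1 z b) (hF.succ a.2 x))).trans (LinearMap.map_smul₂ _ _ _ _)
      · simp only [starTerm_succ, hF.equivariant, ← smul_sum]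
        congr 1
        simp only [smul_sum]
        rw [sum_comm]
        refine sum_congr rfl fun α _ => ?_
        rw [sum_comm]

end TwistedProducts

/-! ### Reversal of fourfold twisted products under an invariant functional -/

section FourfoldProduct

open Finset TensorProduct

variable {ι : Type*} [Fintype ι] {A₀ A₁ A₂ A₃ A₄ V : Type*}
  [AddCommMonoid A₀] [Module ℂ A₀] [AddCommMonoid A₁] [Module ℂ A₁] [AddCommMonoid A₂] [Module ℂ A₂]
  [AddCommMonoid A₃] [Module ℂ A₃] [AddCommMonoid A₄] [Module ℂ A₄] [AddCommMonoid V] [Module ℂ V]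

omit [Fintype ι] in
/-- The constant family, with `F 0` the identity. -/
theorem isTwistFlow_id (c : ℂ) (l : ι → A₀ →ₗ[ℂ] A₀) :
    IsTwistFlow c l 0 l (Pi.single 0 (LinearMap.id : A₀ →ₗ[ℂ] A₀)) where
  equivariant γ r x := by cases r <;> simp
  succ r x := by simp

theorem sum_antisymm_eq_neg {Θ : ι → ι → ℝ} (hΘ : ∀ α β, Θ α β = -Θ β α) (f : ι → ι → ℂ) :
    ∑ α, ∑ β, ((Θ α β : ℝ) : ℂ) * f α β = -∑ α, ∑ β, ((Θ α β : ℝ) : ℂ) * f β α := by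
  rw [sum_comm, ← sum_neg_distrib]
  refine sum_congr rfl fun α _ => ?_
  rw [← sum_neg_distrib]
  refine sum_congr rfl fun β _ => ?_
  rw [hΘ β α, Complex.ofReal_neg, neg_mul]

theorem sum_antisymm_eq_zero {Θ : ι → ι → ℝ} (hΘ : ∀ α β, Θ α β = -Θ β α) {f : ι → ι → ℂ}
    (hf : ∀ α β, f α β = f β α) : ∑ α, ∑ β, ((Θ α β : ℝ) : ℂ) * f α β = 0 := by
  have h := sum_antisymm_eq_neg hΘ f
  simp only [← hf] at h
  exact self_eq_neg.1 h

variable {Θ : ι → ι → ℝ} {c : ℂ} {l₀ : ι → A₀ →ₗ[ℂ] A₀} {l₁ : ι → A₁ →ₗ[ℂ] A₁}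
  {l₂ : ι → A₂ →ₗ[ℂ] A₂} {l₃ : ι → A₃ →ₗ[ℂ] A₃} {l₄ : ι → A₄ →ₗ[ℂ] A₄} {lV : ι → V →ₗ[ℂ] V}
  {w₁ : A₀ →ₗ[ℂ] V →ₗ[ℂ] A₁} {w₂ : A₁ →ₗ[ℂ] V →ₗ[ℂ] A₂} {w₃ : A₂ →ₗ[ℂ] V →ₗ[ℂ] A₃}
  {w₄ : A₃ →ₗ[ℂ] V →ₗ[ℂ] A₄}

/-- Reversal of the order of the four `V`-factors changes the sign of the twist, up to total
derivatives. -/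
theorem flow_reverse (hΘ : ∀ α β, Θ α β = -Θ β α)
    (h₀ : ∀ α β a, l₀ α (l₀ β a) = l₀ β (l₀ α a))
    {F F' : ℕ → (((A₀ ⊗[ℂ] V) ⊗[ℂ] V) ⊗[ℂ] V) ⊗[ℂ] V →ₗ[ℂ] A₄}
    (hF : IsTwistFlow c
      (tensorAction (tensorAction (tensorAction (tensorAction l₀ lV) lV) lV) lV)
      (tensorTwist Θ (tensorAction (tensorAction (tensorAction l₀ lV) lV) lV)
        (tensorTwist Θ (tensorAction (tensorAction l₀ lV) lV)
          (tensorTwist Θ (tensorAction l₀ lV) (tensorTwist Θ l₀ 0 lV) lV) lV) lV) l₄ F)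
    (hF' : IsTwistFlow (-c)
      (tensorAction (tensorAction (tensorAction (tensorAction l₀ lV) lV) lV) lV)
      (tensorTwist Θ (tensorAction (tensorAction (tensorAction l₀ lV) lV) lV)
        (tensorTwist Θ (tensorAction (tensorAction l₀ lV) lV)
          (tensorTwist Θ (tensorAction l₀ lV) (tensorTwist Θ l₀ 0 lV) lV) lV) lV) l₄ F')
    (I : A₄ →ₗ[ℂ] ℂ) (hI : ∀ γ a, I (l₄ γ a) = 0)
    (hbase : ∀ h v₁ v₂ v₃ v₄, I (F' 0 (h ⊗ₜ v₁ ⊗ₜ v₂ ⊗ₜ v₃ ⊗ₜ v₄)) =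
      I (F 0 (h ⊗ₜ v₄ ⊗ₜ v₃ ⊗ₜ v₂ ⊗ₜ v₁))) (r : ℕ) :
    ∀ h v₁ v₂ v₃ v₄, I (F' r (h ⊗ₜ v₁ ⊗ₜ v₂ ⊗ₜ v₃ ⊗ₜ v₄)) =
      I (F r (h ⊗ₜ v₄ ⊗ₜ v₃ ⊗ₜ v₂ ⊗ₜ v₁)) := by
  induction r with
  | zero => exact hbase
  | succ r ih =>
    intro h v₁ v₂ v₃ v₄
    have hr : ((r : ℂ) + 1) ≠ 0 := by exact_mod_cast r.succ_ne_zero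
    refine mul_left_cancel₀ hr ?_
    -- The recursion peels off one copy of the twist operator on each side. As the constants are `c`
    -- and `-c`, it has to be shown that the two resulting expressions at order `r` are opposite.
    have e := congrArg I (hF.succ r (h ⊗ₜ v₄ ⊗ₜ v₃ ⊗ₜ v₂ ⊗ₜ v₁))
    have e' := congrArg I (hF'.succ r (h ⊗ₜ v₁ ⊗ₜ v₂ ⊗ₜ v₃ ⊗ₜ v₄))
    rw [map_smul, map_smul, smul_eq_mul, smul_eq_mul] at e e'
    rw [e, e', neg_mul, ← mul_neg]
    congr 1
    set g : A₀ → V → V → V → V → ℂ := fun h a b c d => I (F r (h ⊗ₜ d ⊗ₜ c ⊗ₜ b ⊗ₜ a)) with hg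
    -- `I` annihilates total derivatives, here distributed over the five factors by equivariance.
    have stokes : ∀ γ h a b c d, g (l₀ γ h) a b c d + g h (lV γ a) b c d + g h a (lV γ b) c d +
        g h a b (lV γ c) d + g h a b c (lV γ d) = 0 := by
      intro γ h a b c d
      have := hI γ (F r (h ⊗ₜ d ⊗ₜ c ⊗ₜ b ⊗ₜ a))
      rw [hF.equivariant] at this
      simp only [tensorAction_tmul, map_add, add_tmul] at this
      simp only [hg]
      linear_combination this
    have swap : ∀ f : ι → ι → ℂ, ∑ α, ∑ β, ((Θ α β : ℝ) : ℂ) * f α β =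
        -∑ α, ∑ β, ((Θ α β : ℝ) : ℂ) * f β α := sum_antisymm_eq_neg hΘ
    -- The couplings of `h` with the four one-forms. By `stokes` they sum to `-Θ^{αβ} l_α l_β h`,
    -- which vanishes since `Θ` is antisymmetric and the operators commute.
    have zero : ∑ α, ∑ β, ((Θ α β : ℝ) : ℂ) * (g (l₀ α h) (lV β v₁) v₂ v₃ v₄ +
        g (l₀ α h) v₁ (lV β v₂) v₃ v₄ + g (l₀ α h) v₁ v₂ (lV β v₃) v₄ +
        g (l₀ α h) v₁ v₂ v₃ (lV β v₄)) = 0 := by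
      rw [← sum_antisymm_eq_zero hΘ (f := fun α β => -g (l₀ α (l₀ β h)) v₁ v₂ v₃ v₄)
        fun α β => by rw [h₀]]
      refine sum_congr rfl fun α _ => sum_congr rfl fun β _ => congrArg (_ * ·) ?_
      rw [h₀ α β]
      linear_combination stokes β (l₀ α h) v₁ v₂ v₃ v₄
    simp only [tensorTwist_tmul, tensorAction_tmul, map_add, add_tmul, map_sum, map_smul, ih,
      sum_tmul, smul_tmul', LinearMap.zero_apply, zero_tmul, zero_add, smul_eq_mul,
      mul_add, sum_add_distrib]
    simp only [← smul_tmul', map_smul, smul_eq_mul, add_tmul, map_add, mul_add, sum_add_distrib, ih]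
    have hg' : ∀ h a b c d, I (F r (h ⊗ₜ d ⊗ₜ c ⊗ₜ b ⊗ₜ a)) = g h a b c d := fun _ _ _ _ _ => rfl
    simp only [hg']
    simp only [mul_add, sum_add_distrib] at zero
    -- The couplings with `h` occur with equal sign on both sides, hence the factor two. The six
    -- couplings between one-forms have their order exchanged by the reversal and cancel through
    -- `swap`.
    linear_combination (-2) * zero - swap (fun α β => g h (lV α v₁) (lV β v₂) v₃ v₄)
      - swap (fun α β => g h (lV α v₁) v₂ (lV β v₃) v₄)
      - swap (fun α β => g h (lV α v₁) v₂ v₃ (lV β v₄))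
      - swap (fun α β => g h v₁ (lV α v₂) (lV β v₃) v₄)
      - swap (fun α β => g h v₁ (lV α v₂) v₃ (lV β v₄))
      - swap (fun α β => g h v₁ v₂ (lV α v₃) (lV β v₄))

/-- A functional of formal power series, additive and `λ`-linear, vanishes if it vanishes on
constant series. -/
theorem series_functional_eq_zero {A : Type*} [AddCommMonoid A] {D : (ℕ → A) → ℕ → ℂ}
    (hadd : ∀ η η' n, D (η + η') n = D η n + D η' n) (hzero : ∀ η, D (seriesShift η) 0 = 0)
    (hsucc : ∀ η n, D (seriesShift η) (n + 1) = D η n) (hconst : ∀ a n, D (seriesConst a) n = 0)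
    (η : ℕ → A) (n : ℕ) : D η n = 0 := by
  induction n generalizing η with
  | zero => rw [series_eq_const_add_shift η, hadd, hconst, hzero, add_zero]
  | succ n ih => rw [series_eq_const_add_shift η, hadd, hconst, hsucc, ih, add_zero]

/-- The twisted product of a series with four further series. -/
def fourStar (Θ : ι → ι → ℝ) (c : ℂ) (l₀ : ι → A₀ →ₗ[ℂ] A₀) (l₁ : ι → A₁ →ₗ[ℂ] A₁)
    (l₂ : ι → A₂ →ₗ[ℂ] A₂) (l₃ : ι → A₃ →ₗ[ℂ] A₃) (lV : ι → V →ₗ[ℂ] V)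
    (w₁ : A₀ →ₗ[ℂ] V →ₗ[ℂ] A₁) (w₂ : A₁ →ₗ[ℂ] V →ₗ[ℂ] A₂) (w₃ : A₂ →ₗ[ℂ] V →ₗ[ℂ] A₃)
    (w₄ : A₃ →ₗ[ℂ] V →ₗ[ℂ] A₄) (h : ℕ → A₀) (v₁ v₂ v₃ v₄ : ℕ → V) : ℕ → A₄ :=
  seriesStar Θ c l₃ lV w₄ (seriesStar Θ c l₂ lV w₃ (seriesStar Θ c l₁ lV w₂
    (seriesStar Θ c l₀ lV w₁ h v₁) v₂) v₃) v₄

theorem fourStar_const (h : A₀) (v₁ v₂ v₃ v₄ : V) :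
    fourStar Θ c l₀ l₁ l₂ l₃ lV w₁ w₂ w₃ w₄ (seriesConst h) (seriesConst v₁) (seriesConst v₂)
        (seriesConst v₃) (seriesConst v₄) = fun r =>
      tensorFlow Θ c l₃ lV w₄ (tensorFlow Θ c l₂ lV w₃ (tensorFlow Θ c l₁ lV w₂
        (tensorFlow Θ c l₀ lV w₁ (Pi.single 0 (LinearMap.id : A₀ →ₗ[ℂ] A₀))))) r
        (h ⊗ₜ v₁ ⊗ₜ v₂ ⊗ₜ v₃ ⊗ₜ v₄) := by
  have h0 : seriesConst h = fun r => (Pi.single 0 (LinearMap.id : A₀ →ₗ[ℂ] A₀) : ℕ → _) r h := by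
    funext r
    cases r <;> simp [seriesConst]
  rw [fourStar, h0, seriesStar_const, seriesStar_const, seriesStar_const, seriesStar_const]

/-- For constant series both sides are flows built by `IsTwistFlow.tensor`, with parameters `-c` and
`c`, and `flow_reverse` applies. Both sides are additive and `λ`-linear in each argument, so the
constants are replaced by arbitrary series one argument at a time. -/
theorem fourStar_reverse (hΘ : ∀ α β, Θ α β = -Θ β α)
    (h₀ : ∀ α β a, l₀ α (l₀ β a) = l₀ β (l₀ α a)) (h₁ : ∀ α β a, l₁ α (l₁ β a) = l₁ β (l₁ α a))
    (h₂ : ∀ α β a, l₂ α (l₂ β a) = l₂ β (l₂ α a)) (h₃ : ∀ α β a, l₃ α (l₃ β a) = l₃ β (l₃ α a))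
    (hV : ∀ α β a, lV α (lV β a) = lV β (lV α a))
    (hw₁ : ∀ γ a b, l₁ γ (w₁ a b) = w₁ (l₀ γ a) b + w₁ a (lV γ b))
    (hw₂ : ∀ γ a b, l₂ γ (w₂ a b) = w₂ (l₁ γ a) b + w₂ a (lV γ b))
    (hw₃ : ∀ γ a b, l₃ γ (w₃ a b) = w₃ (l₂ γ a) b + w₃ a (lV γ b))
    (hw₄ : ∀ γ a b, l₄ γ (w₄ a b) = w₄ (l₃ γ a) b + w₄ a (lV γ b))
    (I : A₄ →ₗ[ℂ] ℂ) (hI : ∀ γ a, I (l₄ γ a) = 0)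
    (hbase : ∀ h v₁ v₂ v₃ v₄, I (w₄ (w₃ (w₂ (w₁ h v₁) v₂) v₃) v₄) =
      I (w₄ (w₃ (w₂ (w₁ h v₄) v₃) v₂) v₁))
    (h : ℕ → A₀) (v₁ v₂ v₃ v₄ : ℕ → V) (n : ℕ) :
    I (fourStar Θ (-c) l₀ l₁ l₂ l₃ lV w₁ w₂ w₃ w₄ h v₁ v₂ v₃ v₄ n) =
      I (fourStar Θ c l₀ l₁ l₂ l₃ lV w₁ w₂ w₃ w₄ h v₄ v₃ v₂ v₁ n) := by
  rw [← sub_eq_zero]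
  have k₀ : ∀ h v₁ v₂ v₃ v₄ n,
      I (fourStar Θ (-c) l₀ l₁ l₂ l₃ lV w₁ w₂ w₃ w₄ (seriesConst h) (seriesConst v₁)
        (seriesConst v₂) (seriesConst v₃) (seriesConst v₄) n) -
      I (fourStar Θ c l₀ l₁ l₂ l₃ lV w₁ w₂ w₃ w₄ (seriesConst h) (seriesConst v₄)
        (seriesConst v₃) (seriesConst v₂) (seriesConst v₁) n) = 0 := by
    intro h v₁ v₂ v₃ v₄ n
    rw [sub_eq_zero, fourStar_const, fourStar_const]
    have flow : ∀ c, _ := fun c => ((((isTwistFlow_id c l₀).tensor (Θ := Θ) h₀ hV hw₁).tensor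
      (Θ := Θ) h₁ hV hw₂).tensor (Θ := Θ) h₂ hV hw₃).tensor (Θ := Θ) h₃ hV hw₄
    refine flow_reverse hΘ h₀ (flow c) (flow (-c)) I hI ?_ n h v₁ v₂ v₃ v₄
    intro h v₁ v₂ v₃ v₄
    simpa [tensorFlow_tmul, starTerm_zero] using hbase h v₁ v₂ v₃ v₄
  have k₁ := fun h v₁ v₂ v₃ v₄ => series_functional_eq_zero
    (D := fun v n => I (fourStar Θ (-c) l₀ l₁ l₂ l₃ lV w₁ w₂ w₃ w₄ (seriesConst h) v
        (seriesConst v₂) (seriesConst v₃) (seriesConst v₄) n) -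
      I (fourStar Θ c l₀ l₁ l₂ l₃ lV w₁ w₂ w₃ w₄ (seriesConst h) (seriesConst v₄)
        (seriesConst v₃) (seriesConst v₂) v n)) (η := v₁)
    (fun η η' n => by
      simp only [fourStar, seriesStar_add_left, seriesStar_add_right, Pi.add_apply, map_add]; ring)
    (fun η => by
      simp only [fourStar, seriesStar_shift_left, seriesStar_shift_right, seriesShift_zero,
        map_zero, sub_zero])
    (fun η n => by
      simp only [fourStar, seriesStar_shift_left, seriesStar_shift_right, seriesShift_succ])
    fun a n => k₀ h a v₂ v₃ v₄ n
  have k₂ := fun h v₁ v₂ v₃ v₄ => series_functional_eq_zero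
    (D := fun v n => I (fourStar Θ (-c) l₀ l₁ l₂ l₃ lV w₁ w₂ w₃ w₄ (seriesConst h) v₁
        v (seriesConst v₃) (seriesConst v₄) n) -
      I (fourStar Θ c l₀ l₁ l₂ l₃ lV w₁ w₂ w₃ w₄ (seriesConst h) (seriesConst v₄)
        (seriesConst v₃) v v₁ n)) (η := v₂)
    (fun η η' n => by
      simp only [fourStar, seriesStar_add_left, seriesStar_add_right, Pi.add_apply, map_add]; ring)
    (fun η => by
      simp only [fourStar, seriesStar_shift_left, seriesStar_shift_right, seriesShift_zero,
        map_zero, sub_zero])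
    (fun η n => by
      simp only [fourStar, seriesStar_shift_left, seriesStar_shift_right, seriesShift_succ])
    fun a n => k₁ h v₁ a v₃ v₄ n
  have k₃ := fun h v₁ v₂ v₃ v₄ => series_functional_eq_zero
    (D := fun v n => I (fourStar Θ (-c) l₀ l₁ l₂ l₃ lV w₁ w₂ w₃ w₄ (seriesConst h) v₁
        v₂ v (seriesConst v₄) n) -
      I (fourStar Θ c l₀ l₁ l₂ l₃ lV w₁ w₂ w₃ w₄ (seriesConst h) (seriesConst v₄)
        v v₂ v₁ n)) (η := v₃)
    (fun η η' n => by
      simp only [fourStar, seriesStar_add_left, seriesStar_add_right, Pi.add_apply, map_add]; ring)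
    (fun η => by
      simp only [fourStar, seriesStar_shift_left, seriesStar_shift_right, seriesShift_zero,
        map_zero, sub_zero])
    (fun η n => by
      simp only [fourStar, seriesStar_shift_left, seriesStar_shift_right, seriesShift_succ])
    fun a n => k₂ h v₁ v₂ a v₄ n
  have k₄ := fun h v₁ v₂ v₃ v₄ => series_functional_eq_zero
    (D := fun v n => I (fourStar Θ (-c) l₀ l₁ l₂ l₃ lV w₁ w₂ w₃ w₄ (seriesConst h) v₁
        v₂ v₃ v n) -
      I (fourStar Θ c l₀ l₁ l₂ l₃ lV w₁ w₂ w₃ w₄ (seriesConst h) v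
        v₃ v₂ v₁ n)) (η := v₄)
    (fun η η' n => by
      simp only [fourStar, seriesStar_add_left, seriesStar_add_right, Pi.add_apply, map_add]; ring)
    (fun η => by
      simp only [fourStar, seriesStar_shift_left, seriesStar_shift_right, seriesShift_zero,
        map_zero, sub_zero])
    (fun η n => by
      simp only [fourStar, seriesStar_shift_left, seriesStar_shift_right, seriesShift_succ])
    fun a n => k₃ h v₁ v₂ v₃ a n
  exact series_functional_eq_zero
    (D := fun h n => I (fourStar Θ (-c) l₀ l₁ l₂ l₃ lV w₁ w₂ w₃ w₄ h v₁ v₂ v₃ v₄ n) -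
      I (fourStar Θ c l₀ l₁ l₂ l₃ lV w₁ w₂ w₃ w₄ h v₄ v₃ v₂ v₁ n)) (η := h)
    (fun η η' n => by
      simp only [fourStar, seriesStar_add_left, Pi.add_apply, map_add]; ring)
    (fun η => by
      simp only [fourStar, seriesStar_shift_left, seriesShift_zero, map_zero, sub_zero])
    (fun η n => by simp only [fourStar, seriesStar_shift_left, seriesShift_succ])
    (fun a n => k₄ a v₁ v₂ v₃ v₄ n) n

end FourfoldProduct

/-! ### Modules of smooth and of compactly supported forms -/

section SmoothForms

open Finset

variable {M : Type*} [TopologicalSpace M] [ChartedSpace E4 M] {k p q : ℕ}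

namespace DForm

theorem wedge_add_left (η η' : DForm M p) (τ : DForm M q) :
    wedge (η + η') τ = wedge η τ + wedge η' τ := funext fun _ => wedgeAlt_add_left _ _ _

theorem wedge_add_right (η : DForm M p) (τ τ' : DForm M q) :
    wedge η (τ + τ') = wedge η τ + wedge η τ' := funext fun _ => wedgeAlt_add_right _ _ _

theorem wedge_smul_left (c : ℂ) (η : DForm M p) (τ : DForm M q) :
    wedge (c • η) τ = c • wedge η τ := funext fun _ => wedgeAlt_smul_left _ _ _

theorem wedge_smul_right (c : ℂ) (η : DForm M p) (τ : DForm M q) :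
    wedge η (c • τ) = c • wedge η τ := funext fun _ => wedgeAlt_smul_right _ _ _

theorem wedge_zero_left (τ : DForm M q) : wedge (0 : DForm M p) τ = 0 :=
  funext fun _ => wedgeAlt_zero_left _

theorem wedge_zero_right (η : DForm M p) : wedge η (0 : DForm M q) = 0 :=
  funext fun _ => wedgeAlt_zero_right _

theorem IsCompactlySupported.add {η τ : DForm M k} (hη : η.IsCompactlySupported)
    (hτ : τ.IsCompactlySupported) : (η + τ).IsCompactlySupported := by
  obtain ⟨K, hK, h⟩ := hη
  obtain ⟨L, hL, h'⟩ := hτ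
  refine ⟨K ∪ L, hK.union hL, fun x hx => ?_⟩
  rw [Pi.add_apply, h x fun hx' => hx (Or.inl hx'), h' x fun hx' => hx (Or.inr hx'), add_zero]

theorem IsCompactlySupported.smul {η : DForm M k} (hη : η.IsCompactlySupported) (c : ℂ) :
    (c • η).IsCompactlySupported := by
  obtain ⟨K, hK, h⟩ := hη
  refine ⟨K, hK, fun x hx => ContinuousAlternatingMap.ext fun v => ?_⟩
  change c * η x v = 0
  rw [h x hx]
  exact mul_zero _

theorem IsCompactlySupported.wedge {η : DForm M p} (hη : η.IsCompactlySupported)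
    (τ : DForm M q) : (wedge η τ).IsCompactlySupported := by
  obtain ⟨K, hK, h⟩ := hη
  refine ⟨K, hK, fun x hx => ?_⟩
  rw [DForm.wedge, h x hx]
  exact wedgeAlt_zero_left _

theorem IsCompactlySupported.conj {η : DForm M k} (hη : η.IsCompactlySupported) :
    (conj η).IsCompactlySupported := by
  obtain ⟨K, hK, h⟩ := hη
  refine ⟨K, hK, fun x hx => ContinuousAlternatingMap.ext fun v => ?_⟩
  change (starRingEnd ℂ) (η x v) = 0
  rw [h x hx]
  exact map_zero _

theorem isCompactlySupported_zero : (0 : DForm M k).IsCompactlySupported :=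
  ⟨∅, isCompact_empty, fun _ _ => rfl⟩

end DForm

/-- Smooth forms. -/
def SForm (M : Type*) [TopologicalSpace M] [ChartedSpace E4 M] (k : ℕ) :
    Submodule ℂ (DForm M k) where
  carrier := {η | DForm.IsSmooth η}
  add_mem' h h' := h.add h'
  zero_mem' := DForm.isSmooth_zero
  smul_mem' c _ h := h.smul c

/-- Smooth forms of compact support. -/
def CForm (M : Type*) [TopologicalSpace M] [ChartedSpace E4 M] (k : ℕ) :
    Submodule ℂ (DForm M k) where
  carrier := {η | DForm.IsSmooth η ∧ η.IsCompactlySupported}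
  add_mem' h h' := ⟨h.1.add h'.1, h.2.add h'.2⟩
  zero_mem' := ⟨DForm.isSmooth_zero, DForm.isCompactlySupported_zero⟩
  smul_mem' c _ h := ⟨h.1.smul c, h.2.smul c⟩

variable [IsManifold (𝓡 4) ∞ M]

/-- The exterior product of smooth forms. -/
def wedgeS (M : Type*) [TopologicalSpace M] [ChartedSpace E4 M] [IsManifold (𝓡 4) ∞ M]
    (p q : ℕ) : SForm M p →ₗ[ℂ] SForm M q →ₗ[ℂ] SForm M (p + q) :=
  LinearMap.mk₂ ℂ (fun η τ => ⟨DForm.wedge η.1 τ.1, η.2.wedge τ.2⟩)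
    (fun _ _ _ => Subtype.ext (DForm.wedge_add_left _ _ _))
    (fun _ _ _ => Subtype.ext (DForm.wedge_smul_left _ _ _))
    (fun _ _ _ => Subtype.ext (DForm.wedge_add_right _ _ _))
    (fun _ _ _ => Subtype.ext (DForm.wedge_smul_right _ _ _))

/-- The exterior product of a compactly supported form and a smooth form. -/
def wedgeC (M : Type*) [TopologicalSpace M] [ChartedSpace E4 M] [IsManifold (𝓡 4) ∞ M]
    (p q : ℕ) : CForm M p →ₗ[ℂ] SForm M q →ₗ[ℂ] CForm M (p + q) :=
  LinearMap.mk₂ ℂ (fun η τ => ⟨DForm.wedge η.1 τ.1, η.2.1.wedge τ.2, η.2.2.wedge τ.1⟩)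
    (fun _ _ _ => Subtype.ext (DForm.wedge_add_left _ _ _))
    (fun _ _ _ => Subtype.ext (DForm.wedge_smul_left _ _ _))
    (fun _ _ _ => Subtype.ext (DForm.wedge_add_right _ _ _))
    (fun _ _ _ => Subtype.ext (DForm.wedge_smul_right _ _ _))

namespace Twist

variable {ι : Type*} (T : Twist M ι)

/-- The Lie derivatives of smooth forms. -/
def lieS (k : ℕ) (α : ι) : SForm M k →ₗ[ℂ] SForm M k where
  toFun η := ⟨lieDeriv (T.X α) η.1, isSmooth_lieDeriv (T.smooth α) η.2⟩
  map_add' η τ := Subtype.ext (lieDeriv_add (T.smooth α) η.2 τ.2)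
  map_smul' c η := Subtype.ext (lieDeriv_smul (T.smooth α) η.2 c)

/-- The Lie derivatives of smooth compactly supported forms. -/
def lieC [T2Space M] (k : ℕ) (α : ι) : CForm M k →ₗ[ℂ] CForm M k where
  toFun η := ⟨lieDeriv (T.X α) η.1, isSmooth_lieDeriv (T.smooth α) η.2.1, η.2.2.lieDeriv _⟩
  map_add' η τ := Subtype.ext (lieDeriv_add (T.smooth α) η.2.1 τ.2.1)
  map_smul' c η := Subtype.ext (lieDeriv_smul (T.smooth α) η.2.1 c)

theorem lieS_comm (α β : ι) (η : SForm M k) :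
    T.lieS k α (T.lieS k β η) = T.lieS k β (T.lieS k α η) :=
  Subtype.ext (lieDeriv_comm (T.smooth α) (T.smooth β) (T.commute α β) η.2)

theorem lieC_comm [T2Space M] (α β : ι) (η : CForm M k) :
    T.lieC k α (T.lieC k β η) = T.lieC k β (T.lieC k α η) :=
  Subtype.ext (lieDeriv_comm (T.smooth α) (T.smooth β) (T.commute α β) η.2.1)

theorem lieC_wedge [T2Space M] (α : ι) (η : CForm M p) (τ : SForm M q) :
    T.lieC (p + q) α (wedgeC M p q η τ) =
      wedgeC M p q (T.lieC p α η) τ + wedgeC M p q η (T.lieS q α τ) :=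
  Subtype.ext (lieDeriv_wedge (T.smooth α) η.2.1 τ.2)

variable [Fintype ι]

theorem coe_pairingDeriv_S (r : ℕ) (η : SForm M p) (τ : SForm M q) :
    ((pairingDeriv T.Θ (T.lieS p) (T.lieS q) (wedgeS M p q) r η τ : SForm M (p + q)) :
      DForm M (p + q)) =
      bidiff T r (η : DForm M p) (τ : DForm M q) := by
  induction r generalizing η τ with
  | zero => rfl
  | succ r ih =>
    rw [pairingDeriv_succ_apply, Submodule.coe_sum]
    simp only [Submodule.coe_sum, Submodule.coe_smul, ih]
    rfl

theorem coe_pairingDeriv_C [T2Space M] (r : ℕ) (η : CForm M p) (τ : SForm M q) :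
    ((pairingDeriv T.Θ (T.lieC p) (T.lieS q) (wedgeC M p q) r η τ : CForm M (p + q)) :
      DForm M (p + q)) =
      bidiff T r (η : DForm M p) (τ : DForm M q) := by
  induction r generalizing η τ with
  | zero => rfl
  | succ r ih =>
    rw [pairingDeriv_succ_apply, Submodule.coe_sum]
    simp only [Submodule.coe_sum, Submodule.coe_smul, ih]
    rfl

/-- The linearity of `lieDeriv` is established under smoothness, so `starProd` is lifted to the
submodules of smooth forms, where the linear algebra of twists is available. -/
theorem coe_seriesStar_S (η : ℕ → SForm M p) (τ : ℕ → SForm M q) (n : ℕ) :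
    ((seriesStar T.Θ (Complex.I / 2) (T.lieS p) (T.lieS q) (wedgeS M p q) η τ n :
      SForm M (p + q)) : DForm M (p + q)) =
      starProd T (fun i => (η i : DForm M p)) (fun i => (τ i : DForm M q)) n := by
  simp only [seriesStar, starProd, Submodule.coe_sum, starTerm, LinearMap.smul_apply,
    Submodule.coe_smul, coe_pairingDeriv_S]

theorem coe_seriesStar_C [T2Space M] (η : ℕ → CForm M p) (τ : ℕ → SForm M q) (n : ℕ) :
    ((seriesStar T.Θ (Complex.I / 2) (T.lieC p) (T.lieS q) (wedgeC M p q) η τ n :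
      CForm M (p + q)) : DForm M (p + q)) =
      starProd T (fun i => (η i : DForm M p)) (fun i => (τ i : DForm M q)) n := by
  simp only [seriesStar, starProd, Submodule.coe_sum, starTerm, LinearMap.smul_apply,
    Submodule.coe_smul, coe_pairingDeriv_C]

end Twist

/-- Complex conjugation of smooth forms. -/
def conjS (M : Type*) [TopologicalSpace M] [ChartedSpace E4 M] (k : ℕ) :
    SForm M k →ₛₗ[starRingEnd ℂ] SForm M k where
  toFun η := ⟨DForm.conj η.1, η.2.conj⟩
  map_add' _ _ := Subtype.ext (funext fun _ => ContinuousAlternatingMap.ext fun _ =>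
    map_add (starRingEnd ℂ) _ _)
  map_smul' _ _ := Subtype.ext (funext fun _ => ContinuousAlternatingMap.ext fun _ =>
    map_mul (starRingEnd ℂ) _ _)

/-- Complex conjugation of smooth compactly supported forms. -/
def conjC (M : Type*) [TopologicalSpace M] [ChartedSpace E4 M] (k : ℕ) :
    CForm M k →ₛₗ[starRingEnd ℂ] CForm M k where
  toFun η := ⟨DForm.conj η.1, η.2.1.conj, η.2.2.conj⟩
  map_add' _ _ := Subtype.ext (funext fun _ => ContinuousAlternatingMap.ext fun _ =>
    map_add (starRingEnd ℂ) _ _)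
  map_smul' _ _ := Subtype.ext (funext fun _ => ContinuousAlternatingMap.ext fun _ =>
    map_mul (starRingEnd ℂ) _ _)

/-- The integral of smooth compactly supported 4-forms. -/
def integralC (M : Type*) [TopologicalSpace M] [ChartedSpace E4 M] [IsManifold (𝓡 4) ∞ M]
    [T2Space M] [SigmaCompactSpace M] : CForm M 4 →ₗ[ℂ] ℂ where
  toFun η := DForm.integral η.1
  map_add' η τ := DForm.integral_add η.2.1 τ.2.1 η.2.2 τ.2.2
  map_smul' c η := DForm.integral_smul c η.1

end SmoothForms

/-! ### Twisted products under conjugation and exchange of factors -/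

section SeriesConjugation

open Finset

variable {ι : Type*} [Fintype ι] {A B C : Type*} [AddCommMonoid A] [Module ℂ A]
  [AddCommMonoid B] [Module ℂ B] [AddCommMonoid C] [Module ℂ C]
  {Θ : ι → ι → ℝ} {c : ℂ} {lA : ι → A →ₗ[ℂ] A} {lB : ι → B →ₗ[ℂ] B}
  {w : A →ₗ[ℂ] B →ₗ[ℂ] C}

theorem map_pairingDeriv {sA : A → A} {sB : B → B} {sC : C →ₛₗ[starRingEnd ℂ] C}
    (hA : ∀ α a, sA (lA α a) = lA α (sA a)) (hB : ∀ α b, sB (lB α b) = lB α (sB b))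
    (hw : ∀ a b, sC (w a b) = w (sA a) (sB b)) (r : ℕ) (a : A) (b : B) :
    sC (pairingDeriv Θ lA lB w r a b) = pairingDeriv Θ lA lB w r (sA a) (sB b) := by
  induction r generalizing a b with
  | zero => exact hw a b
  | succ r ih =>
    simp only [pairingDeriv_succ_apply, map_sum, LinearMap.map_smulₛₗ, Complex.conj_ofReal, ih, hA,
      hB]

/-- The matrix `Θ` is real, so an antilinear map compatible with the Lie derivatives and with the
pairing affects only the parameter `c`. -/
theorem map_seriesStar {sA : A → A} {sB : B → B} {sC : C →ₛₗ[starRingEnd ℂ] C}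
    (hA : ∀ α a, sA (lA α a) = lA α (sA a)) (hB : ∀ α b, sB (lB α b) = lB α (sB b))
    (hw : ∀ a b, sC (w a b) = w (sA a) (sB b)) (η : ℕ → A) (τ : ℕ → B) (n : ℕ) :
    sC (seriesStar Θ c lA lB w η τ n) =
      seriesStar Θ (starRingEnd ℂ c) lA lB w (fun i => sA (η i)) (fun i => sB (τ i)) n := by
  simp only [seriesStar, starTerm, LinearMap.smul_apply, map_sum, LinearMap.map_smulₛₗ,
    map_pairingDeriv hA hB hw, map_div₀, map_pow, map_natCast]

/-- Exchanging the factors transposes `Θ` in each of the `r` contractions, at the cost of one sign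
per contraction. -/
theorem pairingDeriv_swap {w : A →ₗ[ℂ] A →ₗ[ℂ] C} (hΘ : ∀ α β, Θ α β = -Θ β α)
    (hw : ∀ a b, w a b = w b a) (r : ℕ) (a b : A) :
    pairingDeriv Θ lA lA w r a b = (-1 : ℂ) ^ r • pairingDeriv Θ lA lA w r b a := by
  induction r generalizing a b with
  | zero => rw [pow_zero, one_smul]; exact hw a b
  | succ r ih =>
    simp only [pairingDeriv_succ_apply]
    rw [sum_comm, smul_sum]
    refine sum_congr rfl fun α _ => ?_
    rw [smul_sum]
    refine sum_congr rfl fun β _ => ?_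
    rw [ih, smul_smul, smul_smul, hΘ β α]
    congr 1
    push_cast
    ring

theorem seriesStar_swap {w : A →ₗ[ℂ] A →ₗ[ℂ] C} (hΘ : ∀ α β, Θ α β = -Θ β α)
    (hw : ∀ a b, w a b = w b a) (η τ : ℕ → A) (n : ℕ) :
    seriesStar Θ (-c) lA lA w η τ n = seriesStar Θ c lA lA w τ η n := by
  refine sum_congr rfl fun a _ => ?_
  rw [← Nat.sum_antidiagonal_swap]
  refine sum_congr rfl fun b _ => ?_
  simp only [starTerm, LinearMap.smul_apply, Prod.fst_swap, Prod.snd_swap]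
  rw [pairingDeriv_swap hΘ hw, smul_smul]
  congr 1
  rw [div_mul_eq_mul_div, ← mul_pow]
  simp

theorem seriesStar_smul_left (x : ℂ) (η : ℕ → A) (τ : ℕ → B) :
    seriesStar Θ c lA lB w (x • η) τ = x • seriesStar Θ c lA lB w η τ := by
  funext n
  simp [seriesStar, smul_sum]

theorem seriesStar_smul_right (x : ℂ) (η : ℕ → A) (τ : ℕ → B) :
    seriesStar Θ c lA lB w η (x • τ) = x • seriesStar Θ c lA lB w η τ := by
  funext n
  simp [seriesStar, smul_sum]

/-- The twisted product of formal power series as a bilinear map. -/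
def seriesStarₗ (Θ : ι → ι → ℝ) (c : ℂ) (lA : ι → A →ₗ[ℂ] A) (lB : ι → B →ₗ[ℂ] B)
    (w : A →ₗ[ℂ] B →ₗ[ℂ] C) : (ℕ → A) →ₗ[ℂ] (ℕ → B) →ₗ[ℂ] (ℕ → C) :=
  LinearMap.mk₂ ℂ (seriesStar Θ c lA lB w) seriesStar_add_left seriesStar_smul_left
    seriesStar_add_right seriesStar_smul_right

end SeriesConjugation

/-! ### Matrices with entries in a module, and their products -/

section MatrixPairing

open Finset

variable {l m n o : Type*} [Fintype m] [Fintype n]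
  {A B C : Type*} [AddCommMonoid A] [Module ℂ A] [AddCommMonoid B] [Module ℂ B]
  [AddCommMonoid C] [Module ℂ C]

/-- The matrix product with respect to a pairing of the entries. -/
def matPairing (w : A →ₗ[ℂ] B →ₗ[ℂ] C) (X : Matrix l m A) (Y : Matrix m n B) : Matrix l n C :=
  Matrix.of fun i j => ∑ k, w (X i k) (Y k j)

/-- Left multiplication by a matrix of scalars. -/
def leftMul (g : Matrix l m ℂ) (X : Matrix m n A) : Matrix l n A :=
  Matrix.of fun i j => ∑ k, g i k • X k j

/-- Right multiplication by a matrix of scalars. -/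
def rightMul (X : Matrix l m A) (g : Matrix m n ℂ) : Matrix l n A :=
  Matrix.of fun i j => ∑ k, g k j • X i k

theorem matPairing_rightMul_left [Fintype o] (w : A →ₗ[ℂ] B →ₗ[ℂ] C) (X : Matrix l m A)
    (g : Matrix m n ℂ) (Y : Matrix n o B) :
    matPairing w (rightMul X g) Y = matPairing w X (leftMul g Y) := by
  ext i j
  simp only [matPairing, rightMul, leftMul, Matrix.of_apply, map_sum, LinearMap.sum_apply, map_smul,
    LinearMap.smul_apply]
  exact sum_comm

theorem rightMul_matPairing [Fintype o] (w : A →ₗ[ℂ] B →ₗ[ℂ] C) (X : Matrix l m A)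
    (Y : Matrix m n B) (g : Matrix n o ℂ) :
    rightMul (matPairing w X Y) g = matPairing w X (rightMul Y g) := by
  ext i j
  simp only [matPairing, rightMul, Matrix.of_apply, map_sum, map_smul, smul_sum]
  exact sum_comm

omit [Fintype n] in
theorem leftMul_matPairing [Fintype l] (w : A →ₗ[ℂ] B →ₗ[ℂ] C) (g : Matrix o l ℂ)
    (X : Matrix l m A) (Y : Matrix m n B) :
    leftMul g (matPairing w X Y) = matPairing w (leftMul g X) Y := by
  ext i j
  simp only [matPairing, leftMul, Matrix.of_apply, map_sum, map_smul, smul_sum,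
    LinearMap.sum_apply, LinearMap.smul_apply]
  exact sum_comm

theorem leftMul_leftMul [Fintype o] (g : Matrix l m ℂ) (g' : Matrix m n ℂ) (X : Matrix n o A) :
    leftMul g (leftMul g' X) = leftMul (g * g') X := by
  ext i j
  simp only [leftMul, Matrix.of_apply, Matrix.mul_apply, smul_sum, sum_smul, smul_smul]
  exact sum_comm

theorem rightMul_rightMul [Fintype o] (X : Matrix l m A) (g : Matrix m n ℂ) (g' : Matrix n o ℂ) :
    rightMul (rightMul X g) g' = rightMul X (g * g') := by
  ext i j
  simp only [rightMul, Matrix.of_apply, Matrix.mul_apply, smul_sum, sum_smul, smul_smul]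
  rw [sum_comm]
  simp only [mul_comm]

theorem leftMul_rightMul [Fintype o] (g : Matrix l m ℂ) (X : Matrix m n A) (g' : Matrix n o ℂ) :
    leftMul g (rightMul X g') = rightMul (leftMul g X) g' := by
  ext i j
  simp only [leftMul, rightMul, Matrix.of_apply, smul_sum, smul_smul]
  rw [sum_comm]
  simp only [mul_comm]

omit [Fintype n] in
theorem leftMul_one [DecidableEq m] (X : Matrix m n A) : leftMul 1 X = X := by
  ext i j
  simp [leftMul, Matrix.one_apply]

theorem rightMul_one [DecidableEq m] (X : Matrix l m A) : rightMul X 1 = X := by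
  ext i j
  simp [rightMul, Matrix.one_apply]

theorem sum_leftMul_diag (f : A →ₗ[ℂ] ℂ) (g : Matrix m n ℂ) (X : Matrix n m A) :
    ∑ i, f (leftMul g X i i) = ∑ i, f (rightMul X g i i) := by
  simp only [leftMul, rightMul, Matrix.of_apply, map_sum]
  exact sum_comm

theorem sum_rightMul_neg_diag (f : A →ₗ[ℂ] ℂ) (X : Matrix n m A) (g : Matrix m n ℂ) :
    ∑ i, f (rightMul X (-g) i i) = -∑ i, f (rightMul X g i i) := by
  simp [rightMul, map_sum]

end MatrixPairing

/-- The relabelling of summation indices needed when the trace of a product is transposed. -/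
theorem sum_reverse {m : Type*} [Fintype m] (f : m → m → m → m → m → ℂ) :
    ∑ a, ∑ b, ∑ c, ∑ d, ∑ e, f a b c d e = ∑ e, ∑ d, ∑ c, ∑ b, ∑ a, f a b c d e := by
  have h3 : ∀ f : m → m → m → ℂ, ∑ a, ∑ b, ∑ c, f a b c = ∑ c, ∑ b, ∑ a, f a b c := by
    intro f
    refine (Finset.sum_congr rfl fun a _ => Finset.sum_comm).trans ?_
    rw [Finset.sum_comm]
    exact Finset.sum_congr rfl fun c _ => Finset.sum_comm
  have h4 : ∀ f : m → m → m → m → ℂ,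
      ∑ a, ∑ b, ∑ c, ∑ d, f a b c d = ∑ d, ∑ c, ∑ b, ∑ a, f a b c d := by
    intro f
    refine (Finset.sum_congr rfl fun a _ => h3 _).trans ?_
    rw [Finset.sum_comm]
    refine Finset.sum_congr rfl fun d _ => ?_
    rw [Finset.sum_comm]
    exact Finset.sum_congr rfl fun c _ => Finset.sum_comm
  refine (Finset.sum_congr rfl fun a _ => h4 _).trans ?_
  rw [Finset.sum_comm]
  refine Finset.sum_congr rfl fun e _ => ?_
  rw [Finset.sum_comm]
  refine Finset.sum_congr rfl fun d _ => ?_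
  rw [Finset.sum_comm]
  exact Finset.sum_congr rfl fun c _ => Finset.sum_comm

/-- The formula of `wedgeAlt_four_apply` with the degrees written as numerals in place of the
definitionally equal `0 + 1`, `0 + 1 + 1`, and so on. -/
theorem wedgeAlt_four_apply_three {E : Type*} [AddCommGroup E] [Module ℝ E] [TopologicalSpace E] (h : E [⋀^Fin 0]→L[ℝ] ℂ) (b : Fin 4 → E [⋀^Fin 1]→L[ℝ] ℂ)
    (v : Fin 4 → E) :
    wedgeAlt (p := 3) (q := 1) (wedgeAlt (p := 2) (q := 1) (wedgeAlt (p := 1) (q := 1)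
      (wedgeAlt (p := 0) (q := 1) h (b 0)) (b 1)) (b 2)) (b 3) v =
      h ![] * (Matrix.of fun i j : Fin 4 => b i (fun _ => v j)).det := by
  have h₁ := wedgeAlt_four_apply h b v
  with_reducible exact h₁

/-- Reversing four covectors is the permutation `(0 3)(1 2)`, which is even. This is the order-zero
case of the reversal of the star product. -/
theorem wedgeAlt_four_reverse {E : Type*} [AddCommGroup E] [Module ℝ E] [TopologicalSpace E]
    (h : E [⋀^Fin 0]→L[ℝ] ℂ) (v₁ v₂ v₃ v₄ : E [⋀^Fin 1]→L[ℝ] ℂ) :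
    wedgeAlt (p := 3) (q := 1) (wedgeAlt (p := 2) (q := 1) (wedgeAlt (p := 1) (q := 1)
      (wedgeAlt (p := 0) (q := 1) h v₁) v₂) v₃) v₄ =
      wedgeAlt (p := 3) (q := 1) (wedgeAlt (p := 2) (q := 1) (wedgeAlt (p := 1) (q := 1)
      (wedgeAlt (p := 0) (q := 1) h v₄) v₃) v₂) v₁ := by
  refine ContinuousAlternatingMap.ext fun v => ?_
  have h₁ := wedgeAlt_four_apply_three h ![v₁, v₂, v₃, v₄] v
  have h₂ := wedgeAlt_four_apply_three h ![v₄, v₃, v₂, v₁] v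
  have e : (Matrix.of fun i j : Fin 4 => ![v₄, v₃, v₂, v₁] i (fun _ => v j)) =
      (Matrix.of fun i j : Fin 4 => ![v₁, v₂, v₃, v₄] i (fun _ => v j)).submatrix
        (Equiv.swap (0 : Fin 4) 3 * Equiv.swap (1 : Fin 4) 2 : Equiv.Perm (Fin 4)) id := by
    ext i j
    fin_cases i <;> rfl
  have hs : Equiv.Perm.sign (Equiv.swap (0 : Fin 4) 3 * Equiv.swap (1 : Fin 4) 2) = 1 := by decide
  rw [e, Matrix.det_permute, hs, Units.val_one, Int.cast_one, one_mul] at h₂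
  generalize h ![] * (Matrix.of fun i j : Fin 4 => ![v₁, v₂, v₃, v₄] i (fun _ => v j)).det = z
    at h₁ h₂
  simp only [Matrix.cons_val] at h₁ h₂
  exact h₁.trans h₂.symm

/-! ### The integral of a function times four one-forms under conjugation -/

section FourfoldIntegral

open Finset

variable {M : Type*} [TopologicalSpace M] [ChartedSpace E4 M] [IsManifold (𝓡 4) ∞ M]
  {ι : Type*} [Fintype ι] (T : Twist M ι)

omit [IsManifold (𝓡 4) ∞ M] in
theorem wedge_four_reverse (h : DForm M 0) (v₁ v₂ v₃ v₄ : DForm M 1) :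
    DForm.wedge (p := 3) (q := 1) (DForm.wedge (p := 2) (q := 1) (DForm.wedge (p := 1) (q := 1)
      (DForm.wedge (p := 0) (q := 1) h v₁) v₂) v₃) v₄ =
    DForm.wedge (p := 3) (q := 1) (DForm.wedge (p := 2) (q := 1) (DForm.wedge (p := 1) (q := 1)
      (DForm.wedge (p := 0) (q := 1) h v₄) v₃) v₂) v₁ :=
  funext fun x => wedgeAlt_four_reverse (h x) (v₁ x) (v₂ x) (v₃ x) (v₄ x)

theorem coe_wedgeC {p q : ℕ} (η : CForm M p) (τ : SForm M q) :
    (wedgeC M p q η τ : DForm M (p + q)) = DForm.wedge η.1 τ.1 := rfl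

section

variable [T2Space M] [SigmaCompactSpace M]

theorem integralC_apply (η : CForm M 4) : integralC M η = DForm.integral η.1 := rfl

theorem integralC_wedge_four_reverse (h : CForm M 0) (v₁ v₂ v₃ v₄ : SForm M 1) :
    integralC M (wedgeC M 3 1 (wedgeC M 2 1 (wedgeC M 1 1 (wedgeC M 0 1 h v₁) v₂) v₃) v₄) = 
    integralC M (wedgeC M 3 1 (wedgeC M 2 1 (wedgeC M 1 1 (wedgeC M 0 1 h v₄) v₃) v₂) v₁) := 
 by
  have h₁ := wedge_four_reverse h.1 v₁.1 v₂.1 v₃.1 v₄.1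
  have h₂ := congrArg DForm.integral h₁
  simp only [integralC_apply, coe_wedgeC]
  with_reducible exact h₂

end

namespace Twist

/-- The star product of a compactly supported series and a smooth series. -/
abbrev starC [T2Space M] (p q : ℕ) :
    (ℕ → CForm M p) →ₗ[ℂ] (ℕ → SForm M q) →ₗ[ℂ] (ℕ → CForm M (p + q)) :=
  seriesStarₗ T.Θ (Complex.I / 2) (T.lieC p) (T.lieS q) (wedgeC M p q)

/-- The star product of smooth series. -/
abbrev starS (p q : ℕ) :
    (ℕ → SForm M p) →ₗ[ℂ] (ℕ → SForm M q) →ₗ[ℂ] (ℕ → SForm M (p + q)) :=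
  seriesStarₗ T.Θ (Complex.I / 2) (T.lieS p) (T.lieS q) (wedgeS M p q)

omit [Fintype ι] in
theorem conjC_lieC [T2Space M] {p : ℕ} (α : ι) (η : CForm M p) :
    conjC M p (T.lieC p α η) = T.lieC p α (conjC M p η) :=
  Subtype.ext (lieDeriv_conj (T.smooth α) η.2.1).symm

omit [Fintype ι] in
theorem conjS_lieS {p : ℕ} (α : ι) (η : SForm M p) :
    conjS M p (T.lieS p α η) = T.lieS p α (conjS M p η) :=
  Subtype.ext (lieDeriv_conj (T.smooth α) η.2).symm

theorem conjC_wedgeC {p q : ℕ} (η : CForm M p) (τ : SForm M q) :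
    conjC M (p + q) (wedgeC M p q η τ) = wedgeC M p q (conjC M p η) (conjS M q τ) :=
  Subtype.ext (funext fun _ => conj_wedgeAlt _ _)

theorem conjS_wedgeS {p q : ℕ} (η : SForm M p) (τ : SForm M q) :
    conjS M (p + q) (wedgeS M p q η τ) = wedgeS M p q (conjS M p η) (conjS M q τ) :=
  Subtype.ext (funext fun _ => conj_wedgeAlt _ _)

theorem conj_I_div_two : (starRingEnd ℂ) (Complex.I / 2) = -(Complex.I / 2) := by
  rw [map_div₀, Complex.conj_I, map_ofNat, neg_div]

theorem wedgeS_zero_comm (f g : SForm M 0) : wedgeS M 0 0 f g = wedgeS M 0 0 g f :=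
  Subtype.ext (funext fun _ => ContinuousAlternatingMap.ext fun _ => by
    refine (wedgeAlt_zero_form_apply _ _ _).trans (Eq.trans (mul_comm _ _)
      (wedgeAlt_zero_form_apply _ _ _).symm))

/-- Complex conjugation is an antiautomorphism of the star product of functions. -/
theorem conj_starS_zero (f g : ℕ → SForm M 0) (n : ℕ) :
    conjS M 0 (T.starS 0 0 f g n) =
      T.starS 0 0 (fun i => conjS M 0 (g i)) (fun i => conjS M 0 (f i)) n := by
  refine (map_seriesStar T.conjS_lieS T.conjS_lieS conjS_wedgeS f g n).trans ?_
  rw [conj_I_div_two]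
  exact seriesStar_swap T.antisymm wedgeS_zero_comm _ _ n

variable [T2Space M] [SigmaCompactSpace M]

/-- The star product with four one-forms. -/
def four (h : ℕ → CForm M 0) (v₁ v₂ v₃ v₄ : ℕ → SForm M 1) : ℕ → CForm M 4 :=
  T.starC 3 1 (T.starC 2 1 (T.starC 1 1 (T.starC 0 1 h v₁) v₂) v₃) v₄

omit [SigmaCompactSpace M] in
theorem four_eq_fourStar (h : ℕ → CForm M 0) (v₁ v₂ v₃ v₄ : ℕ → SForm M 1) :
    T.four h v₁ v₂ v₃ v₄ = fourStar T.Θ (Complex.I / 2) (T.lieC 0) (T.lieC 1) (T.lieC 2)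
      (T.lieC 3) (T.lieS 1) (wedgeC M 0 1) (wedgeC M 1 1) (wedgeC M 2 1) (wedgeC M 3 1)
      h v₁ v₂ v₃ v₄ := rfl

theorem integralC_conjC (η : CForm M 4) :
    integralC M (conjC M 4 η) = (starRingEnd ℂ) (integralC M η) := DForm.integral_conj η.1

/-- The integral of the star product of a compactly supported function and four one-forms is
conjugated by reversing the order of the one-forms. -/
theorem conj_integral_four (hM : OrientedAtlas M) (h : ℕ → CForm M 0)
    (v₁ v₂ v₃ v₄ : ℕ → SForm M 1) (n : ℕ) :
    (starRingEnd ℂ) (integralC M (T.four h v₁ v₂ v₃ v₄ n)) =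
      integralC M (T.four (fun i => conjC M 0 (h i)) (fun i => conjS M 1 (v₄ i))
        (fun i => conjS M 1 (v₃ i)) (fun i => conjS M 1 (v₂ i)) (fun i => conjS M 1 (v₁ i)) n) := by
  have key := fourStar_reverse (c := Complex.I / 2) (l₀ := T.lieC 0) (l₁ := T.lieC 1)
    (l₂ := T.lieC 2) (l₃ := T.lieC 3)
    (l₄ := T.lieC 4) (lV := T.lieS 1) (w₁ := wedgeC M 0 1) (w₂ := wedgeC M 1 1)
    (w₃ := wedgeC M 2 1) (w₄ := wedgeC M 3 1) T.antisymm T.lieC_comm T.lieC_comm T.lieC_comm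
    T.lieC_comm T.lieS_comm T.lieC_wedge T.lieC_wedge T.lieC_wedge T.lieC_wedge (integralC M)
    (fun γ a => integral_lieDeriv_eq_zero hM (T.smooth γ) a.2.1 a.2.2)
    integralC_wedge_four_reverse
  rw [← integralC_conjC, four_eq_fourStar T (fun i => conjC M 0 (h i)), ← key]
  refine congrArg (integralC M) ?_
  -- Conjugation changes the parameter of every star product from `i/2` to `-i/2` and keeps the
  -- order of the factors. The reversal of order has already been supplied by `key`.
  have step : ∀ (p : ℕ) (η : ℕ → CForm M p) (v : ℕ → SForm M 1) (n : ℕ),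
      conjC M (p + 1) (T.starC p 1 η v n) =
        seriesStar T.Θ (-(Complex.I / 2)) (T.lieC p) (T.lieS 1) (wedgeC M p 1)
          (fun i => conjC M p (η i)) (fun i => conjS M 1 (v i)) n := fun p η v n => by
    rw [← conj_I_div_two]
    exact map_seriesStar T.conjC_lieC T.conjS_lieS conjC_wedgeC η v n
  have s₁ := funext fun i => step 0 h v₁ i
  have s₂ := funext fun i => step 1 (T.starC 0 1 h v₁) v₂ i
  have s₃ := funext fun i => step 2 (T.starC 1 1 (T.starC 0 1 h v₁) v₂) v₃ i
  refine (step 3 _ v₄ n).trans ?_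
  rw [fourStar]
  refine congrArg (fun f => seriesStar T.Θ (-(Complex.I / 2)) (T.lieC 3) (T.lieS 1)
    (wedgeC M 3 1) f (fun i => conjS M 1 (v₄ i)) n) (s₃.trans ?_)
  refine congrArg (fun f => seriesStar T.Θ (-(Complex.I / 2)) (T.lieC 2) (T.lieS 1)
    (wedgeC M 2 1) f (fun i => conjS M 1 (v₃ i))) (s₂.trans ?_)
  exact congrArg (fun f => seriesStar T.Θ (-(Complex.I / 2)) (T.lieC 1) (T.lieS 1)
    (wedgeC M 1 1) f (fun i => conjS M 1 (v₂ i))) s₁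

end Twist

end FourfoldIntegral

/-- The trace computation for the conjugate of a fourfold matrix product. -/
theorem sum_matPairing_sandwich {A₀ A₁ A₂ A₃ A₄ B m : Type*} [Fintype m] [DecidableEq m]
    [AddCommMonoid A₀] [Module ℂ A₀] [AddCommMonoid A₁] [Module ℂ A₁] [AddCommMonoid A₂]
    [Module ℂ A₂] [AddCommMonoid A₃] [Module ℂ A₃] [AddCommMonoid A₄] [Module ℂ A₄]
    [AddCommMonoid B] [Module ℂ B] (w₁ : A₀ →ₗ[ℂ] B →ₗ[ℂ] A₁) (w₂ : A₁ →ₗ[ℂ] B →ₗ[ℂ] A₂)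
    (w₃ : A₂ →ₗ[ℂ] B →ₗ[ℂ] A₃) (w₄ : A₃ →ₗ[ℂ] B →ₗ[ℂ] A₄) (f : A₄ →ₗ[ℂ] ℂ)
    {g g₅ : Matrix m m ℂ} (hg : g * g = 1) (hg₅ : g₅ * g = g * -g₅) (N : Matrix m m A₀)
    {V : Matrix m m B} (hl : leftMul g₅ V = rightMul V (-g₅))
    (hl' : leftMul (-g₅) V = rightMul V g₅) :
    ∑ i, f (matPairing w₄ (matPairing w₃ (matPairing w₂ (matPairing w₁ (leftMul g N)
      (leftMul g₅ (rightMul (leftMul g V) g))) (rightMul (leftMul g V) g))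
      (rightMul (leftMul g V) g)) (rightMul (leftMul g V) g) i i) =
    -∑ i, f (matPairing w₄ (matPairing w₃ (matPairing w₂ (matPairing w₁ (rightMul N g) V) V) V)
      (rightMul V g₅) i i) := by
  -- In the product of the factors `g V g` the neighbouring `g`'s cancel. One `g` remains at each
  -- end, and `g₅ * g` stands before the first `V`.
  have e : matPairing w₄ (matPairing w₃ (matPairing w₂ (matPairing w₁ (leftMul g N)
      (leftMul g₅ (rightMul (leftMul g V) g))) (rightMul (leftMul g V) g))
      (rightMul (leftMul g V) g)) (rightMul (leftMul g V) g) = leftMul g (rightMul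
        (matPairing w₄ (matPairing w₃ (matPairing w₂ (matPairing w₁ N
          (leftMul (g₅ * g) V)) V) V) V) g) := by
    simp only [leftMul_matPairing, leftMul_rightMul, leftMul_leftMul]
    simp only [← rightMul_matPairing, matPairing_rightMul_left, leftMul_leftMul, hg, leftMul_one]
  -- Moving `g₅` to the right end passes `g` once and `V` four times. The five signs turn it into
  -- `-g₅`, while `g` stays attached to `N`.
  have e' : matPairing w₄ (matPairing w₃ (matPairing w₂ (matPairing w₁ N
      (leftMul (g₅ * g) V)) V) V) V = rightMul (matPairing w₄ (matPairing w₃ (matPairing w₂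
        (matPairing w₁ (rightMul N g) V) V) V) V) (-g₅) := by
    rw [hg₅, ← leftMul_leftMul, hl', ← matPairing_rightMul_left w₁, ← rightMul_matPairing w₁,
      matPairing_rightMul_left w₂, hl, ← rightMul_matPairing w₂, matPairing_rightMul_left w₃, hl',
      ← rightMul_matPairing w₃, matPairing_rightMul_left w₄, hl, ← rightMul_matPairing w₄]
  -- Cyclicity of the trace for scalar matrices brings the outer `g`'s together, where they cancel.
  rw [e, sum_leftMul_diag, rightMul_rightMul, hg, rightMul_one, e', sum_rightMul_neg_diag,
    rightMul_matPairing]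

/-! ### Clifford algebra identities -/

namespace GammaMatrices

variable (G : GammaMatrices)

theorem mul_swap {a b : Fin 4} (h : a ≠ b) : G.γ b * G.γ a = -(G.γ a * G.γ b) := by
  have := G.clifford a b
  rw [if_neg h, zero_smul] at this
  exact eq_neg_of_add_eq_zero_right this

theorem zero_mul_zero : G.γ 0 * G.γ 0 = 1 := by
  have := G.clifford 0 0
  rw [if_pos rfl, if_pos rfl, ← two_smul ℂ (G.γ 0 * G.γ 0)] at this
  exact smul_right_injective _ (two_ne_zero (α := ℂ)) this

theorem mul_self_of_ne_zero {a : Fin 4} (h : a ≠ 0) : G.γ a * G.γ a = -1 := by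
  have := G.clifford a a
  rw [if_pos rfl, if_neg h, ← two_smul ℂ (G.γ a * G.γ a), neg_smul, ← smul_neg] at this
  exact smul_right_injective _ (two_ne_zero (α := ℂ)) this

theorem mul_swap_mul {a b : Fin 4} (h : a ≠ b) (X : Matrix (Fin 4) (Fin 4) ℂ) :
    G.γ b * (G.γ a * X) = -(G.γ a * (G.γ b * X)) := by
  rw [← mul_assoc, G.mul_swap h, neg_mul, mul_assoc]

theorem zero_mul_zero_mul (X : Matrix (Fin 4) (Fin 4) ℂ) : G.γ 0 * (G.γ 0 * X) = X := by
  rw [← mul_assoc, G.zero_mul_zero, one_mul]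

theorem mul_self_mul_of_ne_zero {a : Fin 4} (h : a ≠ 0) (X : Matrix (Fin 4) (Fin 4) ℂ) :
    G.γ a * (G.γ a * X) = -X := by
  rw [← mul_assoc, G.mul_self_of_ne_zero h, neg_mul, one_mul]

theorem conjTranspose_zero : (G.γ 0).conjTranspose = G.γ 0 := by
  rw [G.hermitian, G.zero_mul_zero, one_mul]

/-- Each `γ_a` anticommutes with three of the four factors of `γ₅`. The anticommutation relations
serve as rewrite rules that sort indices into increasing order. -/
theorem mul_γ₅ (a : Fin 4) : G.γ a * G.γ₅ = -(G.γ₅ * G.γ a) := by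
  have h1 := G.mul_swap_mul (a := 0) (b := 1) (by decide)
  have h2 := G.mul_swap_mul (a := 0) (b := 2) (by decide)
  have h3 := G.mul_swap_mul (a := 0) (b := 3) (by decide)
  have h4 := G.mul_swap_mul (a := 1) (b := 2) (by decide)
  have h5 := G.mul_swap_mul (a := 1) (b := 3) (by decide)
  have h6 := G.mul_swap_mul (a := 2) (b := 3) (by decide)
  have g3 := G.mul_swap (a := 0) (b := 3) (by decide)
  have g5 := G.mul_swap (a := 1) (b := 3) (by decide)
  have g6 := G.mul_swap (a := 2) (b := 3) (by decide)
  rw [γ₅, mul_smul_comm, smul_mul_assoc, ← smul_neg]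
  congr 1
  fin_cases a <;>
    simp only [Fin.mk_zero, Fin.mk_one, Fin.reduceFinMk, mul_assoc, h1, h2, h3, h4, h5, h6, g3,
      g5, g6, neg_neg, mul_neg]

theorem γ₅_mul_γ₅ : G.γ₅ * G.γ₅ = 1 := by
  have h1 := G.mul_swap_mul (a := 0) (b := 1) (by decide)
  have h2 := G.mul_swap_mul (a := 0) (b := 2) (by decide)
  have h3 := G.mul_swap_mul (a := 0) (b := 3) (by decide)
  have h4 := G.mul_swap_mul (a := 1) (b := 2) (by decide)
  have h5 := G.mul_swap_mul (a := 1) (b := 3) (by decide)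
  have h6 := G.mul_swap_mul (a := 2) (b := 3) (by decide)
  rw [γ₅, smul_mul_smul_comm, Complex.I_mul_I]
  simp only [mul_assoc, h1, h2, h3, h4, h5, h6, mul_neg, G.zero_mul_zero_mul,
    G.mul_self_mul_of_ne_zero (a := 1) (by decide), G.mul_self_mul_of_ne_zero (a := 2) (by decide),
    G.mul_self_of_ne_zero (a := 3) (by decide), neg_neg, neg_smul, one_smul]

/-- The inner `γ₀` cancel in `(γ₀γ₃γ₀)(γ₀γ₂γ₀)(γ₀γ₁γ₀)γ₀ = γ₀γ₃γ₂γ₁`. Reversing the last three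
factors gives a sign, which compensates the conjugation of `i`. -/
theorem conjTranspose_γ₅ : G.γ₅.conjTranspose = G.γ₅ := by
  have h2 := G.mul_swap_mul (a := 0) (b := 2) (by decide)
  have h3 := G.mul_swap_mul (a := 0) (b := 3) (by decide)
  have h5 := G.mul_swap_mul (a := 1) (b := 3) (by decide)
  have g1 := G.mul_swap (a := 0) (b := 1) (by decide)
  have g2 := G.mul_swap (a := 0) (b := 2) (by decide)
  have g3 := G.mul_swap (a := 0) (b := 3) (by decide)
  have g4 := G.mul_swap (a := 1) (b := 2) (by decide)
  have g6 := G.mul_swap (a := 2) (b := 3) (by decide)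
  rw [γ₅, Matrix.conjTranspose_smul, Matrix.conjTranspose_mul, Matrix.conjTranspose_mul,
    Matrix.conjTranspose_mul, G.hermitian 3, G.hermitian 2, G.hermitian 1, G.conjTranspose_zero,
    Complex.star_def, Complex.conj_I, neg_smul, ← smul_neg]
  congr 1
  simp only [mul_assoc, h2, h3, h5, g1, g2, g3, g4, g6, mul_neg, neg_mul,
    G.zero_mul_zero_mul, neg_neg]

theorem γ₅_mul_zero : G.γ₅ * G.γ 0 = G.γ 0 * -G.γ₅ := by
  rw [mul_neg, G.mul_γ₅, neg_neg]

/-- The Clifford algebra valued element `v^a γ_a + ṽ^a γ_a γ₅`. -/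
def vierbein {N : Type*} [AddCommMonoid N] [Module ℂ N] (v vt : Fin 4 → N) :
    Matrix (Fin 4) (Fin 4) N :=
  Matrix.of fun i j => ∑ a, (G.γ a i j • v a + (G.γ a * G.γ₅) i j • vt a)

variable {N : Type*} [AddCommMonoid N] [Module ℂ N] (v vt : Fin 4 → N)

theorem leftMul_vierbein (g : Matrix (Fin 4) (Fin 4) ℂ) :
    leftMul g (G.vierbein v vt) =
      Matrix.of fun i j => ∑ a, ((g * G.γ a) i j • v a + (g * (G.γ a * G.γ₅)) i j • vt a) := by
  ext i j
  simp only [leftMul, vierbein, Matrix.of_apply, Finset.smul_sum]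
  rw [Finset.sum_comm]
  refine Finset.sum_congr rfl fun a _ => ?_
  rw [Matrix.mul_apply, Matrix.mul_apply, Finset.sum_smul, Finset.sum_smul,
    ← Finset.sum_add_distrib]
  simp only [smul_add, smul_smul]

theorem rightMul_vierbein (g : Matrix (Fin 4) (Fin 4) ℂ) :
    rightMul (G.vierbein v vt) g =
      Matrix.of fun i j => ∑ a, ((G.γ a * g) i j • v a + (G.γ a * G.γ₅ * g) i j • vt a) := by
  ext i j
  simp only [rightMul, vierbein, Matrix.of_apply, Finset.smul_sum]
  rw [Finset.sum_comm]
  refine Finset.sum_congr rfl fun a _ => ?_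
  rw [Matrix.mul_apply, Matrix.mul_apply, Finset.sum_smul, Finset.sum_smul,
    ← Finset.sum_add_distrib]
  simp only [smul_add, smul_smul, mul_comm]

/-- As `γ₅` anticommutes with `γ_a`, it also anticommutes with `γ_a γ₅`; the components `ṽ^a`
therefore behave like `v^a`. -/
theorem leftMul_γ₅_vierbein :
    leftMul G.γ₅ (G.vierbein v vt) = rightMul (G.vierbein v vt) (-G.γ₅) := by
  rw [leftMul_vierbein, rightMul_vierbein]
  have h : ∀ a, G.γ₅ * G.γ a = G.γ a * -G.γ₅ := fun a => by rw [mul_neg, G.mul_γ₅, neg_neg]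
  have h' : ∀ a, G.γ₅ * (G.γ a * G.γ₅) = G.γ a * G.γ₅ * -G.γ₅ := fun a => by
    rw [← mul_assoc, h, mul_assoc, mul_assoc, neg_mul, mul_neg, mul_neg, mul_neg]
  simp only [h, h']

theorem leftMul_neg_γ₅_vierbein :
    leftMul (-G.γ₅) (G.vierbein v vt) = rightMul (G.vierbein v vt) G.γ₅ := by
  rw [leftMul_vierbein, rightMul_vierbein]
  have h : ∀ a, -G.γ₅ * G.γ a = G.γ a * G.γ₅ := fun a => by rw [neg_mul, G.mul_γ₅]
  have h' : ∀ a, -G.γ₅ * (G.γ a * G.γ₅) = G.γ a * G.γ₅ * G.γ₅ := fun a => by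
    rw [← mul_assoc, h]
  simp only [h, h']

end GammaMatrices

/-! ### Hermiticity of the trace functional -/

section TraceForm

variable {M : Type*} [TopologicalSpace M] [ChartedSpace E4 M] [IsManifold (𝓡 4) ∞ M]
  [T2Space M] {ι : Type*} [Fintype ι] (T : Twist M ι)

/-- Hermitian conjugation of matrices of series of compactly supported forms. -/
def daggerC {p : ℕ} {l m : Type*} (X : Matrix l m (ℕ → CForm M p)) : Matrix m l (ℕ → CForm M p) :=
  Matrix.of fun i j n => conjC M p (X j i n)

/-- Hermitian conjugation of matrices of series of smooth forms. -/
def daggerS {p : ℕ} {l m : Type*} (X : Matrix l m (ℕ → SForm M p)) : Matrix m l (ℕ → SForm M p) :=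
  Matrix.of fun i j n => conjS M p (X j i n)

omit [IsManifold (𝓡 4) ∞ M] [T2Space M] in
theorem daggerC_rightMul {p : ℕ} {l m n : Type*} [Fintype m] [Fintype n]
    (X : Matrix l m (ℕ → CForm M p)) (g : Matrix m n ℂ) :
    daggerC (rightMul X g) = leftMul g.conjTranspose (daggerC X) := by
  ext i j k : 3
  simp only [daggerC, rightMul, leftMul, Matrix.of_apply, Finset.sum_apply, Pi.smul_apply, map_sum,
    LinearMap.map_smulₛₗ]
  rfl

omit [IsManifold (𝓡 4) ∞ M] [T2Space M] in
theorem daggerS_rightMul {p : ℕ} {l m n : Type*} [Fintype m] [Fintype n]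
    (X : Matrix l m (ℕ → SForm M p)) (g : Matrix m n ℂ) :
    daggerS (rightMul X g) = leftMul g.conjTranspose (daggerS X) := by
  ext i j k : 3
  simp only [daggerS, rightMul, leftMul, Matrix.of_apply, Finset.sum_apply, Pi.smul_apply, map_sum,
    LinearMap.map_smulₛₗ]
  rfl

namespace Twist

/-- The matrix product `K ⋆ U₁ ∧⋆ U₂ ∧⋆ U₃ ∧⋆ U₄`. -/
def fourMat (K : Matrix (Fin 4) (Fin 4) (ℕ → CForm M 0))
    (U₁ U₂ U₃ U₄ : Matrix (Fin 4) (Fin 4) (ℕ → SForm M 1)) :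
    Matrix (Fin 4) (Fin 4) (ℕ → CForm M 4) :=
  matPairing (T.starC 3 1) (matPairing (T.starC 2 1) (matPairing (T.starC 1 1)
    (matPairing (T.starC 0 1) K U₁) U₂) U₃) U₄

variable [SigmaCompactSpace M]

/-- The integral of the coefficient of `λ^n`. -/
def integralCoeff (M : Type*) [TopologicalSpace M] [ChartedSpace E4 M] [IsManifold (𝓡 4) ∞ M]
    [T2Space M] [SigmaCompactSpace M] (n : ℕ) : (ℕ → CForm M 4) →ₗ[ℂ] ℂ :=
  (integralC M).comp (LinearMap.proj n)

theorem sum_integral_fourMat (n : ℕ) (K : Matrix (Fin 4) (Fin 4) (ℕ → CForm M 0))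
    (U₁ U₂ U₃ U₄ : Matrix (Fin 4) (Fin 4) (ℕ → SForm M 1)) :
    ∑ i, integralCoeff M n (T.fourMat K U₁ U₂ U₃ U₄ i i) =
      ∑ i, ∑ a, ∑ b, ∑ c, ∑ j, integralC M
        (T.four (K i j) (U₁ j c) (U₂ c b) (U₃ b a) (U₄ a i) n) := by
  simp only [fourMat, matPairing, Matrix.of_apply, map_sum, LinearMap.sum_apply]
  rfl

/-- Entrywise, `conj_integral_four` reverses the four one-forms and leaves the function in front.
Reversing the order of the matrix indices as well produces the product of Hermitian conjugates, with
`K` still first. -/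
theorem conj_sum_integral_fourMat (hM : OrientedAtlas M) (n : ℕ)
    (K : Matrix (Fin 4) (Fin 4) (ℕ → CForm M 0))
    (U₁ U₂ U₃ U₄ : Matrix (Fin 4) (Fin 4) (ℕ → SForm M 1)) :
    (starRingEnd ℂ) (∑ i, integralCoeff M n (T.fourMat K U₁ U₂ U₃ U₄ i i)) =
      ∑ i, integralCoeff M n (T.fourMat (daggerC K) (daggerS U₄) (daggerS U₃) (daggerS U₂)
        (daggerS U₁) i i) := by
  rw [sum_integral_fourMat, sum_integral_fourMat]
  simp only [map_sum, T.conj_integral_four hM]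
  exact sum_reverse _

/-- Hermiticity of `i ∫ Tr(N γ₀ ⋆ V ∧⋆ V ∧⋆ V ∧⋆ V γ₅)` for a vierbein `V` with `V† = γ₀ V γ₀`. -/
theorem conj_sum_integral_vierbein (hM : OrientedAtlas M) (G : GammaMatrices) (n : ℕ)
    {N N' : Matrix (Fin 4) (Fin 4) (ℕ → CForm M 0)} (hN : daggerC N = N')
    (v vt : Fin 4 → ℕ → SForm M 1)
    (hV : daggerS (G.vierbein v vt) = rightMul (leftMul (G.γ 0) (G.vierbein v vt)) (G.γ 0)) :
    (starRingEnd ℂ) (∑ i, integralCoeff M n (T.fourMat (rightMul N (G.γ 0)) (G.vierbein v vt)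
      (G.vierbein v vt) (G.vierbein v vt) (rightMul (G.vierbein v vt) G.γ₅) i i)) =
    -∑ i, integralCoeff M n (T.fourMat (rightMul N' (G.γ 0)) (G.vierbein v vt)
      (G.vierbein v vt) (G.vierbein v vt) (rightMul (G.vierbein v vt) G.γ₅) i i) := by
  rw [conj_sum_integral_fourMat T hM, daggerC_rightMul, daggerS_rightMul, hN, hV,
    G.conjTranspose_zero, G.conjTranspose_γ₅]
  exact sum_matPairing_sandwich (T.starC 0 1) (T.starC 1 1) (T.starC 2 1) (T.starC 3 1)
    (integralCoeff M n) G.zero_mul_zero G.γ₅_mul_zero N' (G.leftMul_γ₅_vierbein v vt)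
    (G.leftMul_neg_γ₅_vierbein v vt)

end Twist

end TraceForm

/-! ### The Dirac inner product and its Hermiticity -/

section InnerForm

open Finset

variable {M : Type*} [TopologicalSpace M] [ChartedSpace E4 M] {ι : Type*} [Fintype ι]

theorem bidiff_eq_zero_left [IsManifold (𝓡 4) ∞ M] (T : Twist M ι) {p q : ℕ} {K : Set M}
    (hK : IsClosed K) (r : ℕ) {η : DForm M p} (h : ∀ x ∉ K, η x = 0) (τ : DForm M q) :
    ∀ x ∉ K, bidiff T r η τ x = 0 := by
  induction r generalizing η τ with
  | zero =>
    intro x hx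
    rw [bidiff, DForm.wedge, h x hx]
    exact wedgeAlt_zero_left _
  | succ r ih =>
    intro x hx
    rw [bidiff, Finset.sum_apply]
    refine sum_eq_zero fun α _ => ?_
    rw [Finset.sum_apply]
    refine sum_eq_zero fun β _ => ContinuousAlternatingMap.ext fun v => ?_
    change ((T.Θ α β : ℝ) : ℂ) * bidiff T r (lieDeriv (T.X α) η) (lieDeriv (T.X β) τ) x v = 0
    rw [ih (lieDeriv_eq_zero_of_notMem hK h _) _ x hx]
    exact mul_zero _

theorem bidiff_eq_zero_right [IsManifold (𝓡 4) ∞ M] (T : Twist M ι) {p q : ℕ} {K : Set M}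
    (hK : IsClosed K) (r : ℕ) (η : DForm M p) {τ : DForm M q} (h : ∀ x ∉ K, τ x = 0) :
    ∀ x ∉ K, bidiff T r η τ x = 0 := by
  induction r generalizing η τ with
  | zero =>
    intro x hx
    rw [bidiff, DForm.wedge, h x hx]
    exact wedgeAlt_zero_right _
  | succ r ih =>
    intro x hx
    rw [bidiff, Finset.sum_apply]
    refine sum_eq_zero fun α _ => ?_
    rw [Finset.sum_apply]
    refine sum_eq_zero fun β _ => ContinuousAlternatingMap.ext fun v => ?_
    change ((T.Θ α β : ℝ) : ℂ) * bidiff T r (lieDeriv (T.X α) η) (lieDeriv (T.X β) τ) x v = 0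
    rw [ih _ (lieDeriv_eq_zero_of_notMem hK h _) x hx]
    exact mul_zero _

/-- Each coefficient is a finite sum of bidifferential operators, and these are local: a term is
supported where the supports of its two arguments meet. -/
theorem starProd_isCompactlySupported [IsManifold (𝓡 4) ∞ M] (T : Twist M ι) {p q : ℕ}
    {η : FormSeries M p} {τ : FormSeries M q} {K L : ℕ → Set M} (hK : ∀ i, IsClosed (K i))
    (hL : ∀ i, IsClosed (L i)) (hη : ∀ i, ∀ x ∉ K i, η i x = 0) (hτ : ∀ i, ∀ x ∉ L i, τ i x = 0)
    (hc : ∀ i j, IsCompact (K i ∩ L j)) (n : ℕ) : (starProd T η τ n).IsCompactlySupported := by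
  have hs : ∀ (s : Finset (ℕ × ℕ)) (f : ℕ × ℕ → DForm M (p + q)),
      (∀ a, (f a).IsCompactlySupported) → (∑ a ∈ s, f a).IsCompactlySupported := by
    intro s f hf
    exact Finset.sum_induction f DForm.IsCompactlySupported (fun _ _ => DForm.IsCompactlySupported.add)
      DForm.isCompactlySupported_zero fun a _ => hf a
  refine hs _ _ fun a => hs _ _ fun b => DForm.IsCompactlySupported.smul ?_ _
  refine ⟨K b.1 ∩ L b.2, hc _ _, fun x hx => ?_⟩
  by_cases h : x ∈ K b.1
  · exact bidiff_eq_zero_right T (hL _) _ _ (hτ _) x fun h' => hx ⟨h, h'⟩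
  · exact bidiff_eq_zero_left T (hK _) _ (hη _) _ x h

/-- The series of differential forms underlying a matrix of series of smooth forms. -/
def coeS {p : ℕ} {l m : Type*} (X : Matrix l m (ℕ → SForm M p)) : Matrix l m (FormSeries M p) :=
  Matrix.of fun i j n => (X i j n).1

/-- The series of differential forms underlying a matrix of series of smooth compactly supported
forms. -/
def coeC {p : ℕ} {l m : Type*} (X : Matrix l m (ℕ → CForm M p)) : Matrix l m (FormSeries M p) :=
  Matrix.of fun i j n => (X i j n).1

theorem mulConst_coeC {p : ℕ} {l m n : Type*} [Fintype m] (X : Matrix l m (ℕ → CForm M p))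
    (g : Matrix m n ℂ) : mulConst (coeC X) g = coeC (rightMul X g) := by
  ext i j k : 2
  simp only [mulConst, coeC, rightMul, Matrix.of_apply, Finset.sum_apply, Submodule.coe_sum]
  rfl

theorem mulConst_coeS {p : ℕ} {l m n : Type*} [Fintype m] (X : Matrix l m (ℕ → SForm M p))
    (g : Matrix m n ℂ) : mulConst (coeS X) g = coeS (rightMul X g) := by
  ext i j k : 2
  simp only [mulConst, coeS, rightMul, Matrix.of_apply, Finset.sum_apply, Submodule.coe_sum]
  rfl

theorem constMul_coeS {p : ℕ} {l m n : Type*} [Fintype m] (g : Matrix l m ℂ)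
    (X : Matrix m n (ℕ → SForm M p)) : constMul g (coeS X) = coeS (leftMul g X) := by
  ext i j k : 2
  simp only [constMul, coeS, leftMul, Matrix.of_apply, Finset.sum_apply, Submodule.coe_sum]
  rfl

theorem dagger_coeS {p : ℕ} {l m : Type*} (X : Matrix l m (ℕ → SForm M p)) :
    dagger (coeS X) = coeS (daggerS X) := rfl

theorem coeS_injective {p : ℕ} {l m : Type*} :
    Function.Injective (coeS : Matrix l m (ℕ → SForm M p) → Matrix l m (FormSeries M p)) := by
  intro X Y h
  ext i j k : 2
  exact Subtype.ext (congrFun (congrFun (congrFun h i) j) k)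

variable [IsManifold (𝓡 4) ∞ M] (T : Twist M ι)

theorem matStar_coeC [T2Space M] {p q : ℕ} {l m n : Type*} [Fintype m]
    (X : Matrix l m (ℕ → CForm M p)) (Y : Matrix m n (ℕ → SForm M q)) :
    matStar T (coeC X) (coeS Y) = coeC (matPairing (T.starC p q) X Y) := by
  ext i j k : 2
  simp only [matStar, coeC, coeS, matPairing, Matrix.of_apply, Finset.sum_apply, Submodule.coe_sum]
  exact sum_congr rfl fun a _ => (T.coe_seriesStar_C _ _ _).symm

theorem matStar_coeS {p q : ℕ} {l m n : Type*} [Fintype m]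
    (X : Matrix l m (ℕ → SForm M p)) (Y : Matrix m n (ℕ → SForm M q)) :
    matStar T (coeS X) (coeS Y) = coeS (matPairing (T.starS p q) X Y) := by
  ext i j k : 2
  simp only [matStar, coeS, matPairing, Matrix.of_apply, Finset.sum_apply, Submodule.coe_sum]
  exact sum_congr rfl fun a _ => (T.coe_seriesStar_S _ _ _).symm

/-- The vierbein of a Cartan geometry as a matrix of series of smooth forms. -/
def IsCartanGeometry.vierbein {G : GammaMatrices} {C : CartanComponents M}
    (hC : IsCartanGeometry G C) : Matrix (Fin 4) (Fin 4) (ℕ → SForm M 1) :=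
  G.vierbein (fun a n => (⟨C.Va a n, hC.smooth_Va a n⟩ : SForm M 1))
    fun a n => (⟨C.Vt a n, hC.smooth_Vt a n⟩ : SForm M 1)

omit [IsManifold (𝓡 4) ∞ M] in
theorem IsCartanGeometry.coeS_vierbein {G : GammaMatrices} {C : CartanComponents M}
    (hC : IsCartanGeometry G C) : coeS hC.vierbein = C.V G := by
  ext i j k : 2
  simp only [coeS, vierbein, GammaMatrices.vierbein, CartanComponents.V, Matrix.of_apply,
    Finset.sum_apply, Submodule.coe_sum]
  rfl

omit [IsManifold (𝓡 4) ∞ M] in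
theorem IsCartanGeometry.daggerS_vierbein {G : GammaMatrices} {C : CartanComponents M}
    (hC : IsCartanGeometry G C) :
    daggerS hC.vierbein = rightMul (leftMul (G.γ 0) hC.vierbein) (G.γ 0) := by
  apply coeS_injective
  rw [← dagger_coeS, ← mulConst_coeS, ← constMul_coeS, hC.coeS_vierbein, hC.real_V]

/-- The components of a Dirac field as series of smooth 0-forms. -/
def componentS (ψ : DiracField M) (i : Fin 4) (n : ℕ) : SForm M 0 :=
  ⟨DForm.ofFun fun x => ψ n x i, DForm.isSmooth_ofFun (by
    have h := (ψ n).contMDiff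
    rw [contMDiff_pi_space] at h
    exact h i)⟩

theorem componentS_eq_zero (ψ : DiracField M) (i : Fin 4) (n : ℕ) :
    ∀ x ∉ tsupport (ψ n), (componentS ψ i n).1 x = 0 := by
  intro x hx
  refine ContinuousAlternatingMap.ext fun v => ?_
  change ψ n x i = 0
  rw [image_eq_zero_of_notMem_tsupport hx]
  rfl

variable [T2Space M]

/-- The series `ψ₂ ⋆ ψ₁†`, with compactly supported coefficients. -/
def outer {ψ₁ ψ₂ : DiracField M} (h : CompactOverlap ψ₁ ψ₂) :
    Matrix (Fin 4) (Fin 4) (ℕ → CForm M 0) :=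
  Matrix.of fun i j n => ⟨(T.starS 0 0 (componentS ψ₂ i)
    (fun k => conjS M 0 (componentS ψ₁ j k)) n : SForm M 0).1, (T.starS 0 0 (componentS ψ₂ i)
    (fun k => conjS M 0 (componentS ψ₁ j k)) n).2, by
      have e := T.coe_seriesStar_S (componentS ψ₂ i) (fun k => conjS M 0 (componentS ψ₁ j k)) n
      refine e ▸ starProd_isCompactlySupported T (K := fun k => tsupport (ψ₂ k))
        (L := fun k => tsupport (ψ₁ k)) (fun _ => isClosed_tsupport _)
        (fun _ => isClosed_tsupport _) (fun k => componentS_eq_zero ψ₂ i k) (fun k x hx => ?_)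
        (fun a b => by rw [Set.inter_comm]; exact h b a) n
      refine ContinuousAlternatingMap.ext fun v => ?_
      change (starRingEnd ℂ) ((componentS ψ₁ j k).1 x v) = 0
      rw [componentS_eq_zero ψ₁ j k x hx]
      exact map_zero _⟩

omit [IsManifold (𝓡 4) ∞ M] [T2Space M] in
theorem CompactOverlap.symm {ψ₁ ψ₂ : DiracField M} (h : CompactOverlap ψ₁ ψ₂) :
    CompactOverlap ψ₂ ψ₁ := fun m n => by
  rw [Set.inter_comm]
  exact h n m

omit [IsManifold (𝓡 4) ∞ M] [T2Space M] in
theorem conjS_conjS {p : ℕ} (η : SForm M p) : conjS M p (conjS M p η) = η :=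
  Subtype.ext (funext fun _ => ContinuousAlternatingMap.ext fun _ => Complex.conj_conj _)

omit [T2Space M] in
-- Conjugation is an antiautomorphism of the star product of functions, so `(ψ₂ ⋆ ψ₁†)†` is `ψ₁ ⋆
-- ψ₂†`.
theorem daggerC_outer {ψ₁ ψ₂ : DiracField M} (h : CompactOverlap ψ₁ ψ₂) :
    daggerC (outer T h) = outer T h.symm := by
  ext i j n : 2
  have e := T.conj_starS_zero (componentS ψ₂ j) (fun k => conjS M 0 (componentS ψ₁ i k)) n
  simp only [conjS_conjS] at e
  have e' := congrArg (fun z : SForm M 0 => (z : DForm M 0)) e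
  exact Subtype.ext e'

omit [T2Space M] in
theorem matStar_column_diracAdjoint (G : GammaMatrices) {ψ₁ ψ₂ : DiracField M}
    (h : CompactOverlap ψ₁ ψ₂) : matStar T (column ψ₂) (diracAdjoint G ψ₁) =
      (coeC (rightMul (outer T h) (G.γ 0)) : Matrix (Fin 4) (Fin 4) (FormSeries M 0)) := by
  have e₂ : column ψ₂ = coeS (Matrix.of fun i (_ : Fin 1) => componentS ψ₂ i) := rfl
  have e₁ : diracAdjoint G ψ₁ = coeS (rightMul (Matrix.of fun (_ : Fin 1) j n =>
      conjS M 0 (componentS ψ₁ j n)) (G.γ 0)) := by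
    rw [← mulConst_coeS]
    rfl
  rw [e₁, e₂, matStar_coeS, ← rightMul_matPairing, ← mulConst_coeC, ← mulConst_coeS]
  refine congrArg (fun X : Matrix (Fin 4) (Fin 4) (FormSeries M 0) => mulConst X (G.γ 0)) ?_
  ext i j n : 2
  simp only [coeS, coeC, matPairing, outer, Matrix.of_apply, Finset.univ_unique, Finset.sum_singleton]

variable [SigmaCompactSpace M]

omit [SigmaCompactSpace M] in
-- The constant `γ₅` is absorbed into the last vierbein and the expression is placed in `CForm M 4`,
-- where integration is a linear functional.
theorem innerForm_eq (G : GammaMatrices) {C : CartanComponents M} (hC : IsCartanGeometry G C)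
    {ψ₁ ψ₂ : DiracField M} (h : CompactOverlap ψ₁ ψ₂) (n : ℕ) :
    innerForm G T C ψ₁ ψ₂ n = (∑ i, T.fourMat (rightMul (outer T h) (G.γ 0)) hC.vierbein
      hC.vierbein hC.vierbein (rightMul hC.vierbein G.γ₅) i i n : CForm M 4) := by
  rw [innerForm, ← hC.coeS_vierbein, matStar_column_diracAdjoint T G h]
  have e : ∀ (X : Matrix (Fin 4) (Fin 4) (ℕ → CForm M 0))
      (V : Matrix (Fin 4) (Fin 4) (ℕ → SForm M 1)),
      mulConst (matStar T (matStar T (matStar T (matStar T (coeC X) (coeS V)) (coeS V)) (coeS V))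
        (coeS V)) G.γ₅ = coeC (T.fourMat X V V V (rightMul V G.γ₅)) := fun X V => by
    rw [matStar_coeC, matStar_coeC, matStar_coeC, matStar_coeC, mulConst_coeC, rightMul_matPairing]
    rfl
  have e' := congrArg (fun Y : Matrix (Fin 4) (Fin 4) (FormSeries M 4) => (∑ i, Y i i) n)
    (e (rightMul (outer T h) (G.γ 0)) hC.vierbein)
  refine Eq.trans ?_ (e'.trans ?_)
  · rfl
  · simp only [Finset.sum_apply, Submodule.coe_sum, coeC, Matrix.of_apply]

/-- The sign from `conj_sum_integral_vierbein` cancels against the conjugate of the prefactor `i`.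
-/
theorem conj_diracInner (hM : OrientedAtlas M) (G : GammaMatrices) {C : CartanComponents M}
    (hC : IsCartanGeometry G C) {ψ₁ ψ₂ : DiracField M} (h : CompactOverlap ψ₁ ψ₂) :
    PowerSeries.map (starRingEnd ℂ) (diracInner G T C ψ₁ ψ₂) = diracInner G T C ψ₂ ψ₁ := by
  ext n
  have key := T.conj_sum_integral_vierbein hM G n (daggerC_outer T h) _ _ hC.daggerS_vierbein
  have e : ∀ {ψ₁ ψ₂ : DiracField M} (h : CompactOverlap ψ₁ ψ₂),
      DForm.integral (innerForm G T C ψ₁ ψ₂ n) = ∑ i, Twist.integralCoeff M n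
        (T.fourMat (rightMul (outer T h) (G.γ 0)) hC.vierbein
          hC.vierbein hC.vierbein (rightMul hC.vierbein G.γ₅) i i) := fun h => by
    rw [innerForm_eq T G hC h, ← integralC_apply, map_sum]
    rfl
  rw [PowerSeries.coeff_map, diracInner, diracInner, PowerSeries.coeff_mk, PowerSeries.coeff_mk,
    map_mul, Complex.conj_I, e h, e h.symm]
  refine (congrArg (-Complex.I * ·) key).trans ?_
  ring_nf
  rfl

end InnerForm

/-! ### Antisymmetrised products of gamma matrices -/

open Finset

namespace GammaMatrices

variable (G : GammaMatrices)

/-- Adjacent transpositions generate the symmetric group. Multiplying `σ` by one on the right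
exchanges two neighbouring gamma matrices with distinct indices, which anticommute. -/
theorem prod_perm (σ : Equiv.Perm (Fin 4)) :
    G.γ (σ 0) * G.γ (σ 1) * G.γ (σ 2) * G.γ (σ 3) =
      ((Equiv.Perm.sign σ : ℤ) : ℂ) • (G.γ 0 * G.γ 1 * G.γ 2 * G.γ 3) := by
  have hσ : σ ∈ Submonoid.closure
      (Set.range fun i : Fin 3 => Equiv.swap i.castSucc i.succ) := by
    rw [Equiv.Perm.mclosure_swap_castSucc_succ]
    trivial
  induction hσ using Submonoid.closure_induction_right with
  | one => simp
  | mul_right σ _ τ hτ ih =>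
    obtain ⟨i, rfl⟩ := hτ
    have hne : ∀ a b : Fin 4, a ≠ b → σ a ≠ σ b := fun a b h => σ.injective.ne h
    rw [Equiv.Perm.sign_mul, Equiv.Perm.sign_swap (by simp [Fin.ext_iff])]
    simp only [Equiv.Perm.coe_mul, Function.comp_apply, mul_neg, mul_one, Units.val_neg,
      Int.cast_neg, neg_smul, ← ih]
    fin_cases i
    · have e : ∀ j : Fin 4,
          Equiv.swap (Fin.castSucc (0 : Fin 3)) (Fin.succ 0) j = ![1, 0, 2, 3] j := by decide
      simp only [Fin.zero_eta, e, Matrix.cons_val]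
      rw [G.mul_swap (hne 0 1 (by decide)), neg_mul, neg_mul]
    · have e : ∀ j : Fin 4,
          Equiv.swap (Fin.castSucc (1 : Fin 3)) (Fin.succ 1) j = ![0, 2, 1, 3] j := by decide
      simp only [Fin.mk_one, e, Matrix.cons_val]
      rw [mul_assoc (G.γ (σ 0)), G.mul_swap (hne 1 2 (by decide)), mul_neg, neg_mul, ← mul_assoc]
    · have e : ∀ j : Fin 4,
          Equiv.swap (Fin.castSucc (2 : Fin 3)) (Fin.succ 2) j = ![0, 1, 3, 2] j := by decide
      simp only [Fin.reduceFinMk, e, Matrix.cons_val]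
      rw [mul_assoc _ (G.γ (σ 3)), G.mul_swap (hne 2 3 (by decide)), mul_neg, ← mul_assoc]

/-- The rows of the determinant are matrix entries along an index path from `j` to `k`. Its Leibniz
expansion, summed over paths, consists of signed products `γ_{σ0}γ_{σ1}γ_{σ2}γ_{σ3}`. By `prod_perm`
all `24` terms are equal. -/
theorem sum_det_path (j k : Fin 4) :
    ∑ c, ∑ b, ∑ a, (Matrix.of fun s e : Fin 4 =>
      ![G.γ e j a, G.γ e a b, G.γ e b c, G.γ e c k] s).det =
      24 * (G.γ 0 * G.γ 1 * G.γ 2 * G.γ 3) j k := by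
  have h : ∀ σ : Equiv.Perm (Fin 4), ∑ c, ∑ b, ∑ a, ((Equiv.Perm.sign σ : ℤ) : ℂ) *
      (G.γ (σ 0) j a * G.γ (σ 1) a b * G.γ (σ 2) b c * G.γ (σ 3) c k) =
      (G.γ 0 * G.γ 1 * G.γ 2 * G.γ 3) j k := fun σ => by
    have e := congrFun (congrFun (G.prod_perm σ) j) k
    simp only [Matrix.mul_apply, sum_mul] at e
    simp only [← mul_sum]
    rw [e, Matrix.smul_apply, smul_eq_mul, ← mul_assoc, ← Int.cast_mul]
    simp
  simp only [← Matrix.det_transpose (Matrix.of _), Matrix.det_apply', Fin.prod_univ_four,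
    Matrix.transpose_apply, Matrix.of_apply, Matrix.cons_val]
  simp only [sum_comm (t := (univ : Finset (Equiv.Perm (Fin 4))))]
  rw [sum_congr rfl fun σ _ => h σ]
  simp [Fintype.card_perm, Nat.factorial]

end GammaMatrices

/-- The symbol `levi` is itself a determinant, and its Leibniz expansion is a signed sum of delta
functions, each selecting the index tuple of one permutation. -/
theorem sum_levi_mul (X : Fin 4 → Fin 4 → Fin 4 → Fin 4 → ℂ) :
    ∑ a, ∑ b, ∑ c, ∑ d, levi a b c d * X a b c d =
      ∑ σ : Equiv.Perm (Fin 4), ((Equiv.Perm.sign σ : ℤ) : ℂ) * X (σ 0) (σ 1) (σ 2) (σ 3) := by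
  have h : ∀ a b c d, levi a b c d * X a b c d = ∑ σ : Equiv.Perm (Fin 4),
      if a = σ 0 then if b = σ 1 then if c = σ 2 then if d = σ 3 then
        ((Equiv.Perm.sign σ : ℤ) : ℂ) * X a b c d else 0 else 0 else 0 else 0 := fun a b c d => by
    rw [levi, ← Matrix.det_transpose, Matrix.det_apply', sum_mul]
    refine sum_congr rfl fun σ _ => ?_
    rw [Fin.prod_univ_four]
    change ((Equiv.Perm.sign σ : ℤ) : ℂ) * ((if a = σ 0 then 1 else 0) *
      (if b = σ 1 then 1 else 0) * (if c = σ 2 then 1 else 0) * (if d = σ 3 then 1 else 0)) *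
      X a b c d = _
    split_ifs <;> simp
  simp only [h]
  simp only [sum_comm (t := (univ : Finset (Equiv.Perm (Fin 4))))]
  refine sum_congr rfl fun σ _ => ?_
  simp

/-! ### Lowest-order coefficients of star products -/

section Leading

variable {M : Type*} [TopologicalSpace M] [ChartedSpace E4 M]

theorem DForm.sum_wedge {m : Type*} (s : Finset m) {p q : ℕ} (η : m → DForm M p) (τ : DForm M q) :
    DForm.wedge (∑ i ∈ s, η i) τ = ∑ i ∈ s, DForm.wedge (η i) τ := by
  classical
  induction s using Finset.induction_on with
  | empty => exact DForm.wedge_zero_left τ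
  | insert a s ha ih => rw [sum_insert ha, sum_insert ha, DForm.wedge_add_left, ih]

/-- Evaluation of forms on tangent vectors. -/
def DForm.evalₗ {k : ℕ} (x : M) (v : Fin k → TangentSpace (𝓡 4) x) : DForm M k →ₗ[ℂ] ℂ where
  toFun η := η x v
  map_add' _ _ := rfl
  map_smul' _ _ := rfl

theorem DForm.evalₗ_apply {k : ℕ} (x : M) (v : Fin k → TangentSpace (𝓡 4) x) (η : DForm M k) :
    DForm.evalₗ x v η = η x v := rfl

theorem wedge_four_apply (h : DForm M 0) (b : Fin 4 → DForm M 1) (x : M)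
    (v : Fin 4 → TangentSpace (𝓡 4) x) :
    (DForm.wedge (p := 3) (q := 1) (DForm.wedge (p := 2) (q := 1) (DForm.wedge (p := 1) (q := 1)
      (DForm.wedge (p := 0) (q := 1) h (b 0)) (b 1)) (b 2)) (b 3) : DForm M 4) x v =
      h x ![] * (Matrix.of fun i j : Fin 4 => b i x (fun _ => v j)).det :=
  wedgeAlt_four_apply_three (h x) (fun i => b i x) v

/-- The determinant whose vanishing expresses the degeneracy of the vierbein. -/
def CartanComponents.frameDet (C : CartanComponents M) (x : M)
    (v : Fin 4 → TangentSpace (𝓡 4) x) : ℂ :=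
  (Matrix.of fun a j : Fin 4 => C.Va a 0 x (fun _ => v j)).det

theorem det_frame (C : CartanComponents M) (x : M) (v : Fin 4 → TangentSpace (𝓡 4) x)
    (c : Fin 4 → Fin 4 → ℂ) : (Matrix.of fun i j : Fin 4 =>
      ∑ a, c i a * C.Va a 0 x (fun _ => v j)).det = (Matrix.of c).det * C.frameDet x v := by
  rw [CartanComponents.frameDet, ← Matrix.det_mul]
  rfl

/-- Each of the `24` permutations contributes its sign times the determinant with permuted rows,
that is, the same `frameDet`. -/
theorem vol₀_apply (C : CartanComponents M) (x : M) (v : Fin 4 → TangentSpace (𝓡 4) x) :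
    C.vol₀ x v = 24 * C.frameDet x v := by
  -- Inserting the constant 0-form `1` as first factor makes `wedge_four_apply` available for a
  -- product of one-forms only.
  have h1 : ∀ η : DForm M 1, DForm.wedge (p := 0) (q := 1) (DForm.ofFun fun _ => 1) η = η := by
    intro η
    refine funext fun x => ContinuousAlternatingMap.ext fun v => ?_
    refine (wedgeAlt_zero_form_left _ _ v).trans ?_
    exact one_mul _
  have h2 : ∀ f : Fin 4 → Fin 4,
      (DForm.wedge (DForm.wedge (DForm.wedge (C.Va (f 0) 0) (C.Va (f 1) 0))
        (C.Va (f 2) 0)) (C.Va (f 3) 0) : DForm M 4) x v =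
      (Matrix.of fun i j : Fin 4 => C.Va (f i) 0 x (fun _ => v j)).det := by
    intro f
    have h3 := wedge_four_apply (DForm.ofFun fun _ => 1) (fun i => C.Va (f i) 0) x v
    rw [h1] at h3
    have h4 : (DForm.ofFun (M := M) fun _ => 1) x ![] = 1 := rfl
    rw [h4, one_mul] at h3
    with_reducible exact h3
  have h4 : C.vol₀ x v = ∑ a, ∑ b, ∑ c, ∑ d, levi a b c d *
      (Matrix.of fun i j : Fin 4 => C.Va (![a, b, c, d] i) 0 x (fun _ => v j)).det := by
    have h5 := fun a b c d => h2 ![a, b, c, d]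
    simp only [Matrix.cons_val] at h5
    simp only [← h5]
    change DForm.evalₗ x v C.vol₀ = _
    simp only [CartanComponents.vol₀, map_sum, map_smul, smul_eq_mul]
    rfl
  rw [h4, sum_levi_mul]
  have h6 : ∀ σ : Equiv.Perm (Fin 4), ((Equiv.Perm.sign σ : ℤ) : ℂ) * (Matrix.of fun i j : Fin 4 =>
      C.Va (![σ 0, σ 1, σ 2, σ 3] i) 0 x (fun _ => v j)).det = C.frameDet x v := by
    intro σ
    have e : (Matrix.of fun i j : Fin 4 => C.Va (![σ 0, σ 1, σ 2, σ 3] i) 0 x (fun _ => v j)) =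
        (Matrix.of fun a j : Fin 4 => C.Va a 0 x (fun _ => v j)).submatrix σ id := by
      ext i j
      fin_cases i <;> rfl
    rw [e, Matrix.det_permute, ← mul_assoc, ← Int.cast_mul, CartanComponents.frameDet]
    simp
  rw [sum_congr rfl fun σ _ => h6 σ]
  simp [Fintype.card_perm, Nat.factorial]

variable [IsManifold (𝓡 4) ∞ M] {ι : Type*} [Fintype ι] (T : Twist M ι) {p q : ℕ}

theorem bidiff_zero_left (r : ℕ) (τ : DForm M q) : bidiff T r (0 : DForm M p) τ = 0 :=
  funext fun x => bidiff_eq_zero_left T isClosed_empty r (fun _ _ => rfl) τ x (Set.notMem_empty x)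

theorem bidiff_zero_right (r : ℕ) (η : DForm M p) : bidiff T r η (0 : DForm M q) = 0 :=
  funext fun x => bidiff_eq_zero_right T isClosed_empty r η (fun _ _ => rfl) x (Set.notMem_empty x)

/-- A term with `r ≥ 1` contractions involves only pairs of total order `n - r < n`, where one
coefficient vanishes. Thus only the undeformed product of the distinguished pair survives. -/
theorem starProd_eq_single {η : FormSeries M p} {τ : FormSeries M q} {n i j : ℕ} (hij : i + j = n)
    (h : ∀ a b, a + b ≤ n → (a, b) ≠ (i, j) → η a = 0 ∨ τ b = 0) :
    starProd T η τ n = DForm.wedge (η i) (τ j) := by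
  have key : ∀ r a b, a + b ≤ n → (a, b) ≠ (i, j) →
      ((Complex.I / 2) ^ r / (r ! : ℂ)) • bidiff T r (η a) (τ b) = 0 := by
    intro r a b hab hne
    have : bidiff T r (η a) (τ b) = 0 := by
      rcases h a b hab hne with h | h
      · rw [h, bidiff_zero_left]
      · rw [h, bidiff_zero_right]
    rw [this]
    exact funext fun x => ContinuousAlternatingMap.ext fun v => mul_zero _
  rw [starProd, sum_eq_single (0, n), sum_eq_single (i, j)]
  · refine funext fun x => ContinuousAlternatingMap.ext fun v => ?_
    change ((Complex.I / 2) ^ 0 / (0 ! : ℂ)) * _ = _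
    simp only [pow_zero, Nat.factorial_zero, Nat.cast_one, div_one, one_mul]
    rfl
  · rintro ⟨a, b⟩ hab hne
    exact key 0 a b (HasAntidiagonal.mem_antidiagonal.1 hab).le hne
  · intro h
    exact absurd (HasAntidiagonal.mem_antidiagonal.2 hij) h
  · rintro ⟨r, m⟩ hrm hne
    refine sum_eq_zero ?_
    rintro ⟨a, b⟩ hab
    rw [HasAntidiagonal.mem_antidiagonal] at hrm hab
    refine key r a b (by simp only at hrm hab ⊢; omega) ?_
    rintro ⟨⟩
    simp only at hrm hab
    refine hne (Prod.ext ?_ ?_) <;> simp only <;> omega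
  · intro h
    exact absurd (HasAntidiagonal.mem_antidiagonal.2 (zero_add n)) h

/-- The vanishing below order `n` is part of the conclusion so that the lemma can be iterated along
a chain of products. -/
theorem matStar_leading_left {l m o : Type*} [Fintype m] {X : Matrix l m (FormSeries M p)}
    (Y : Matrix m o (FormSeries M q)) {n : ℕ} (hX : ∀ i j, ∀ k < n, X i j k = 0) (i : l) (j : o) :
    (∀ k < n, matStar T X Y i j k = 0) ∧
      matStar T X Y i j n = ∑ a, DForm.wedge (X i a n) (Y a j 0) := by
  refine ⟨fun k hk => ?_, ?_⟩
  · rw [matStar, Matrix.of_apply, Finset.sum_apply]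
    refine sum_eq_zero fun a _ => ?_
    rw [starProd_eq_single T (add_zero k) fun b c hbc _ => Or.inl (hX i a b (by omega)),
      hX i a k hk]
    exact DForm.wedge_zero_left _
  · rw [matStar, Matrix.of_apply, Finset.sum_apply]
    refine sum_congr rfl fun a _ => starProd_eq_single T (add_zero n) fun b c hbc hne =>
      Or.inl (hX i a b (lt_of_le_of_ne (by omega) ?_))
    rintro rfl
    exact hne (Prod.ext rfl (by simp only; omega))

theorem matStar_leading_right {l m o : Type*} [Fintype m] (X : Matrix l m (FormSeries M p))
    {Y : Matrix m o (FormSeries M q)} {n : ℕ} (hY : ∀ i j, ∀ k < n, Y i j k = 0) (i : l) (j : o) :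
    (∀ k < n, matStar T X Y i j k = 0) ∧
      matStar T X Y i j n = ∑ a, DForm.wedge (X i a 0) (Y a j n) := by
  refine ⟨fun k hk => ?_, ?_⟩
  · rw [matStar, Matrix.of_apply, Finset.sum_apply]
    refine sum_eq_zero fun a _ => ?_
    rw [starProd_eq_single T (zero_add k) fun b c hbc _ => Or.inr (hY a j c (by omega)),
      hY a j k hk]
    exact DForm.wedge_zero_right _
  · rw [matStar, Matrix.of_apply, Finset.sum_apply]
    refine sum_congr rfl fun a _ => starProd_eq_single T (zero_add n) fun b c hbc hne =>
      Or.inr (hY a j c (lt_of_le_of_ne (by omega) ?_))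
    rintro rfl
    exact hne (Prod.ext (by simp only; omega) rfl)

omit [IsManifold (𝓡 4) ∞ M] in
theorem V_zero_apply {G : GammaMatrices} {C : CartanComponents M} (hC : IsCartanGeometry G C)
    (i j : Fin 4) (x : M) (v : Fin 1 → TangentSpace (𝓡 4) x) :
    C.V G i j 0 x v = ∑ a, G.γ a i j * C.Va a 0 x v := by
  have e : C.V G i j 0 = ∑ a, (G.γ a i j • C.Va a 0 + (G.γ a * G.γ₅) i j • C.Vt a 0) :=
    by rw [CartanComponents.V, Matrix.of_apply, Finset.sum_apply]; rfl
  rw [e]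
  simp only [hC.limit_Vt]
  rw [← DForm.evalₗ_apply]
  simp only [map_sum, map_add, map_smul, map_zero, mul_zero, add_zero, smul_eq_mul]
  rfl

end Leading

/-! ### The lowest-order coefficient of the Lagrangian four-form -/

section LeadingCoefficient

open Finset

variable {M : Type*} [TopologicalSpace M] [ChartedSpace E4 M]

theorem wedge_four_V_apply {G : GammaMatrices} {C : CartanComponents M}
    (hC : IsCartanGeometry G C) (h : DForm M 0) (i a b c k : Fin 4) (x : M)
    (v : Fin 4 → TangentSpace (𝓡 4) x) :
    (DForm.wedge (p := 3) (q := 1) (DForm.wedge (p := 2) (q := 1) (DForm.wedge (p := 1) (q := 1)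
      (DForm.wedge (p := 0) (q := 1) h (C.V G i a 0)) (C.V G a b 0)) (C.V G b c 0))
      (C.V G c k 0) : DForm M 4) x v = h x ![] * ((Matrix.of fun s e : Fin 4 =>
        ![G.γ e i a, G.γ e a b, G.γ e b c, G.γ e c k] s).det * C.frameDet x v) := by
  have h₁ := wedge_four_apply h ![C.V G i a 0, C.V G a b 0, C.V G b c 0, C.V G c k 0] x v
  have h₂ : (Matrix.of fun s j : Fin 4 =>
      ![C.V G i a 0, C.V G a b 0, C.V G b c 0, C.V G c k 0] s x (fun _ => v j)) =
      Matrix.of fun s j : Fin 4 => ∑ e, ![G.γ e i a, G.γ e a b, G.γ e b c, G.γ e c k] s *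
        C.Va e 0 x (fun _ => v j) := by
    ext s j
    fin_cases s <;> exact V_zero_apply hC _ _ x _
  rw [h₂, det_frame C x v fun s e => ![G.γ e i a, G.γ e a b, G.γ e b c, G.γ e c k] s] at h₁
  simp only [Matrix.cons_val] at h₁
  exact h₁

variable [IsManifold (𝓡 4) ∞ M] {ι : Type*} [Fintype ι] (T : Twist M ι)

/-- Four uses of `matStar_leading_left` leave undeformed products with `V` at order zero, where only
the `V^a γ_a` part is present. Expanding in the classical coframe separates `frameDet` from
determinants of gamma entries, and these are summed by `sum_det_path`. -/
theorem matStar_four_leading {G : GammaMatrices} {C : CartanComponents M}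
    (hC : IsCartanGeometry G C) {K : Matrix (Fin 4) (Fin 4) (FormSeries M 0)} {n : ℕ}
    (hK : ∀ i j, ∀ k < n, K i j k = 0) (i k : Fin 4) (x : M)
    (v : Fin 4 → TangentSpace (𝓡 4) x) :
    (matStar T (matStar T (matStar T (matStar T K (C.V G)) (C.V G)) (C.V G)) (C.V G)
      i k n : DForm M 4) x v = ∑ j, K i j n x ![] *
        (24 * (G.γ 0 * G.γ 1 * G.γ 2 * G.γ 3) j k * C.frameDet x v) := by
  have h1 := fun i j => matStar_leading_left T (C.V G) hK i j
  have h2 := fun i j => matStar_leading_left T (C.V G) (fun i j => (h1 i j).1) i j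
  have h3 := fun i j => matStar_leading_left T (C.V G) (fun i j => (h2 i j).1) i j
  have h4 := fun i j => matStar_leading_left T (C.V G) (fun i j => (h3 i j).1) i j
  have e : (matStar T (matStar T (matStar T (matStar T K (C.V G)) (C.V G)) (C.V G)) (C.V G)
      i k n : DForm M 4) = ∑ c, ∑ b, ∑ a, ∑ j, DForm.wedge (DForm.wedge (DForm.wedge
        (DForm.wedge (K i j n) (C.V G j a 0)) (C.V G a b 0)) (C.V G b c 0)) (C.V G c k 0) := by
    simp only [(h4 _ _).2, (h3 _ _).2, (h2 _ _).2, (h1 _ _).2, DForm.sum_wedge]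
  rw [e, ← DForm.evalₗ_apply]
  simp only [map_sum]
  have e' : ∀ c b a j, DForm.evalₗ x v (DForm.wedge (DForm.wedge (DForm.wedge
      (DForm.wedge (K i j n) (C.V G j a 0)) (C.V G a b 0)) (C.V G b c 0)) (C.V G c k 0)) =
      K i j n x ![] * ((Matrix.of fun s e : Fin 4 =>
        ![G.γ e j a, G.γ e a b, G.γ e b c, G.γ e c k] s).det * C.frameDet x v) :=
    fun c b a j => by
      have := wedge_four_V_apply hC (K i j n) j a b c k x v
      rw [DForm.evalₗ_apply]
      refine Eq.trans ?_ this
      with_reducible rfl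
  simp only [e']
  have h5 : ∀ j, ∑ c, ∑ b, ∑ a, K i j n x ![] * ((Matrix.of fun s e : Fin 4 =>
      ![G.γ e j a, G.γ e a b, G.γ e b c, G.γ e c k] s).det * C.frameDet x v) =
      K i j n x ![] * (24 * (G.γ 0 * G.γ 1 * G.γ 2 * G.γ 3) j k * C.frameDet x v) := fun j => by
    rw [← G.sum_det_path j k]
    simp only [mul_sum, sum_mul]
  simp only [← h5]
  exact (sum_congr rfl fun c _ => (sum_congr rfl fun b _ => sum_comm).trans sum_comm).trans sum_comm

/-- The coefficient of lowest order of the Lagrangian four-form. -/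
theorem innerForm_leading [T2Space M] [SigmaCompactSpace M] {G : GammaMatrices}
    {C : CartanComponents M} (hC : IsCartanGeometry G C) {ψ₁ ψ₂ : DiracField M} {n : ℕ}
    (hψ : ∀ k < n, ψ₁ k = 0) : Complex.I • innerForm G T C ψ₁ ψ₂ n = fun x =>
      (Matrix.vecMul (fun i => (starRingEnd ℂ) (ψ₁ n x i)) (G.γ 0) ⬝ᵥ ψ₂ 0 x) • C.vol₀ x := by
  have hadj : ∀ (i : Fin 1) j, ∀ k < n, diracAdjoint G ψ₁ i j k = 0 := by
    intro i j k hk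
    refine funext fun x => ContinuousAlternatingMap.ext fun v => ?_
    rw [diracAdjoint, mulConst, Matrix.of_apply, Finset.sum_apply]
    rw [← DForm.evalₗ_apply, map_sum]
    refine sum_eq_zero fun a _ => ?_
    change G.γ 0 a j * (starRingEnd ℂ) (ψ₁ k x a) = 0
    rw [hψ k hk]
    simp
  set K := matStar T (column ψ₂) (diracAdjoint G ψ₁) with hK
  have hK0 := fun i j => matStar_leading_right T (column ψ₂) hadj i j
  have hKx : ∀ i j x, K i j n x ![] =
      ψ₂ 0 x i * ∑ m, G.γ 0 m j * (starRingEnd ℂ) (ψ₁ n x m) := by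
    intro i j x
    rw [hK, (hK0 i j).2, Finset.univ_unique, Finset.sum_singleton]
    refine (wedgeAlt_zero_form_apply _ _ _).trans ?_
    refine congrArg (ψ₂ 0 x i * ·) ?_
    rw [diracAdjoint, mulConst, Matrix.of_apply, Finset.sum_apply]
    rw [← DForm.evalₗ_apply, map_sum]
    rfl
  refine funext fun x => ContinuousAlternatingMap.ext fun v => ?_
  have hM := fun i k => matStar_four_leading T hC (fun i j => (hK0 i j).1) i k x v
  have e : (innerForm G T C ψ₁ ψ₂ n : DForm M 4) = ∑ i, ∑ k, G.γ₅ k i •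
      (matStar T (matStar T (matStar T (matStar T K (C.V G)) (C.V G)) (C.V G)) (C.V G)
        i k n : DForm M 4) := by
    rw [innerForm, Finset.sum_apply]
    refine sum_congr rfl fun i _ => ?_
    rw [mulConst, Matrix.of_apply, Finset.sum_apply]
    rfl
  have e' : innerForm G T C ψ₁ ψ₂ n x v = ∑ i, ∑ k, G.γ₅ k i * ∑ j, K i j n x ![] *
      (24 * (G.γ 0 * G.γ 1 * G.γ 2 * G.γ 3) j k * C.frameDet x v) := by
    rw [e, ← DForm.evalₗ_apply]
    simp only [map_sum, map_smul, smul_eq_mul]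
    exact sum_congr rfl fun i _ => sum_congr rfl fun k _ => congrArg (_ * ·) (hM i k)
  -- Here `γ₀γ₁γ₂γ₃ = -iγ₅` and `γ₅² = 1`, so the matrix factor is scalar and the trace reduces to
  -- that of `K`. The value `-i` is cancelled by the prefactor `i`.
  have hP : ∀ i j, ∑ k, (G.γ 0 * G.γ 1 * G.γ 2 * G.γ 3) j k * G.γ₅ k i =
      if j = i then -Complex.I else 0 := fun i j => by
    have h : (G.γ 0 * G.γ 1 * G.γ 2 * G.γ 3) * G.γ₅ =
        (-Complex.I) • (1 : Matrix (Fin 4) (Fin 4) ℂ) := by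
      rw [← G.γ₅_mul_γ₅, ← smul_mul_assoc]
      refine congrArg (· * G.γ₅) ?_
      rw [GammaMatrices.γ₅, smul_smul, neg_mul, Complex.I_mul_I, neg_neg, one_smul]
    have h' := congrFun (congrFun h j) i
    rw [Matrix.mul_apply, Matrix.smul_apply, Matrix.one_apply] at h'
    refine h'.trans ?_
    split_ifs <;> simp
  change Complex.I * innerForm G T C ψ₁ ψ₂ n x v = (Matrix.vecMul _ _ ⬝ᵥ ψ₂ 0 x) * C.vol₀ x v
  have e'' : ∀ i, ∑ k, G.γ₅ k i * ∑ j, K i j n x ![] *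
      (24 * (G.γ 0 * G.γ 1 * G.γ 2 * G.γ 3) j k * C.frameDet x v) =
      K i i n x ![] * 24 * C.frameDet x v * -Complex.I := fun i => by
    have e₁ : ∀ j, K i j n x ![] * 24 * C.frameDet x v * ∑ k,
        (G.γ 0 * G.γ 1 * G.γ 2 * G.γ 3) j k * G.γ₅ k i = ∑ k, G.γ₅ k i * (K i j n x ![] *
          (24 * (G.γ 0 * G.γ 1 * G.γ 2 * G.γ 3) j k * C.frameDet x v)) := fun j => by
      rw [mul_sum]
      exact sum_congr rfl fun k _ => by ring
    refine (sum_congr rfl fun k _ => mul_sum _ _ _).trans (sum_comm.trans ?_)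
    refine (sum_congr rfl fun j _ => (e₁ j).symm.trans (congrArg (_ * ·) (hP i j))).trans ?_
    simp
  rw [e', vol₀_apply, sum_congr rfl fun i _ => e'' i, ← sum_mul, ← sum_mul, ← sum_mul,
    sum_congr rfl fun i _ => hKx i i x]
  simp only [dotProduct, Matrix.vecMul]
  have e₃ : ∀ i, ψ₂ 0 x i * ∑ m, G.γ 0 m i * (starRingEnd ℂ) (ψ₁ n x m) =
      (∑ m, (starRingEnd ℂ) (ψ₁ n x m) * G.γ 0 m i) * ψ₂ 0 x i := fun i => by
    rw [mul_comm]
    simp only [mul_comm (G.γ 0 _ _)]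
  simp only [e₃]
  linear_combination (-24 * C.frameDet x v * ∑ i, (∑ m, (starRingEnd ℂ) (ψ₁ n x m) * G.γ 0 m i) *
    ψ₂ 0 x i) * Complex.I_mul_I

end LeadingCoefficient

/-! ### Reality of the classical vierbein and nonvanishing of its volume form -/

section Nondegeneracy

open Set

namespace GammaMatrices

variable (G : GammaMatrices)

/-- The anticommutator with `γ_b` isolates the coefficient `d b` up to the factor `±2`. -/
theorem eq_zero_of_sum_smul_eq_zero {d : Fin 4 → ℂ} (h : ∑ a, d a • G.γ a = 0) (b : Fin 4) :
    d b = 0 := by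
  have h1 : (∑ a, d a • G.γ a) * G.γ b + G.γ b * ∑ a, d a • G.γ a = 0 := by
    rw [h, zero_mul, mul_zero, add_zero]
  rw [Finset.sum_mul, Finset.mul_sum, ← Finset.sum_add_distrib] at h1
  simp only [smul_mul_assoc, mul_smul_comm, ← smul_add, G.clifford] at h1
  rw [Finset.sum_eq_single b (fun a _ hab => by rw [if_neg hab, zero_smul, smul_zero])
    (fun hb => (hb (Finset.mem_univ b)).elim), if_pos rfl] at h1
  have h2 := congrFun (congrFun h1 0) 0
  rw [Matrix.smul_apply, Matrix.smul_apply, Matrix.one_apply_eq, Matrix.zero_apply] at h2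
  split_ifs at h2 <;> simpa using h2

/-- Conjugation by `γ₀` turns the condition into a linear relation among the gamma matrices with
coefficients `conj (z a) - z a`. -/
theorem conj_eq_of_conjTranspose_eq {z : Fin 4 → ℂ}
    (h : (∑ a, z a • G.γ a).conjTranspose = G.γ 0 * (∑ a, z a • G.γ a) * G.γ 0) (a : Fin 4) :
    (starRingEnd ℂ) (z a) = z a := by
  have h1 : G.γ 0 * (∑ a, ((starRingEnd ℂ) (z a) - z a) • G.γ a) * G.γ 0 = 0 := by
    have e : ∑ a, ((starRingEnd ℂ) (z a) - z a) • G.γ a =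
        (∑ a, (starRingEnd ℂ) (z a) • G.γ a) - ∑ a, z a • G.γ a := by
      simp only [sub_smul, Finset.sum_sub_distrib]
    rw [e, mul_sub, sub_mul, ← h, Matrix.conjTranspose_sum, sub_eq_zero]
    simp only [Finset.mul_sum, Finset.sum_mul, Matrix.conjTranspose_smul, G.hermitian,
      mul_smul_comm, smul_mul_assoc]
    rfl
  have h2 : ∑ a, ((starRingEnd ℂ) (z a) - z a) • G.γ a = 0 := by
    have h3 := congrArg (fun X => G.γ 0 * X * G.γ 0) h1
    simp only [mul_assoc, G.zero_mul_zero, mul_zero, zero_mul, mul_one, G.zero_mul_zero_mul] at h3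
    exact h3
  exact sub_eq_zero.1 (G.eq_zero_of_sum_smul_eq_zero h2 a)

end GammaMatrices

variable {M : Type*} [TopologicalSpace M] [ChartedSpace E4 M]

/-- The classical vierbein is real. -/
theorem IsCartanGeometry.conj_Va_zero {G : GammaMatrices} {C : CartanComponents M}
    (hC : IsCartanGeometry G C) (a : Fin 4) (x : M) (v : Fin 1 → TangentSpace (𝓡 4) x) :
    (starRingEnd ℂ) (C.Va a 0 x v) = C.Va a 0 x v := by
  refine G.conj_eq_of_conjTranspose_eq (z := fun a => C.Va a 0 x v) ?_ a
  ext i j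
  have h1 : (starRingEnd ℂ) (C.V G j i 0 x v) =
      (mulConst (constMul (G.γ 0) (C.V G)) (G.γ 0) i j 0) x v :=
    congrArg (fun A : Matrix (Fin 4) (Fin 4) (FormSeries M 1) => A i j 0 x v) hC.real_V
  have e : ∀ i j, (∑ a, C.Va a 0 x v • G.γ a) i j = C.V G i j 0 x v := fun i j => by
    rw [V_zero_apply hC, Matrix.sum_apply]
    exact Finset.sum_congr rfl fun a _ => mul_comm _ _
  rw [Matrix.conjTranspose_apply, e]
  refine h1.trans ?_
  rw [mulConst, Matrix.of_apply, Finset.sum_apply, ← DForm.evalₗ_apply, map_sum, Matrix.mul_apply]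
  refine Finset.sum_congr rfl fun k _ => ?_
  change G.γ 0 k j * (constMul (G.γ 0) (C.V G) i k 0) x v = _
  rw [constMul, Matrix.of_apply, Finset.sum_apply, ← DForm.evalₗ_apply, map_sum, Matrix.mul_apply,
    mul_comm]
  simp only [e]
  rfl

/-- Real linear independence of complex-valued covectors would not suffice by itself. Reality makes
the matrix real, so that a vanishing determinant yields a relation with real coefficients. -/
theorem det_ne_zero_of_real {b : Fin 4 → E4 [⋀^Fin 1]→L[ℝ] ℂ} (hb : LinearIndependent ℝ b)
    (hr : ∀ a v, (starRingEnd ℂ) (b a v) = b a v) :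
    (Matrix.of fun a j : Fin 4 => b a (fun _ => EuclideanSpace.single j (1 : ℝ))).det ≠ 0 := by
  intro h0
  have h1 : ∀ a v, ((b a v).re : ℂ) = b a v := fun a v => Complex.conj_eq_iff_re.1 (hr a v)
  have h2 : (Matrix.of fun a j : Fin 4 => b a (fun _ => EuclideanSpace.single j (1 : ℝ))) =
      (Matrix.of fun a j : Fin 4 => (b a (fun _ => EuclideanSpace.single j (1 : ℝ))).re).map
        Complex.ofRealHom := by
    ext a j
    exact (h1 a _).symm
  rw [h2, ← RingHom.mapMatrix_apply, ← RingHom.map_det, Complex.ofRealHom_eq_coe,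
    Complex.ofReal_eq_zero] at h0
  obtain ⟨c, hc, hc0⟩ := Matrix.exists_vecMul_eq_zero_iff.2 h0
  refine hc (funext fun a => Fintype.linearIndependent_iff.1 hb c ?_ a)
  refine ContinuousAlternatingMap.toAlternatingMap_injective
    ((EuclideanSpace.basisFun (Fin 4) ℝ).toBasis.ext_alternating fun w _ => ?_)
  have h6 : (fun i => (EuclideanSpace.basisFun (Fin 4) ℝ).toBasis (w i)) =
      fun _ => EuclideanSpace.single (w 0) (1 : ℝ) := funext fun i => by
    rw [Subsingleton.elim i 0]
    simp
  rw [h6]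
  change (∑ a, c a • b a) (fun _ => EuclideanSpace.single (w 0) (1 : ℝ)) = 0
  rw [ContinuousAlternatingMap.sum_apply]
  have h4 := congrArg Complex.ofReal (congrFun hc0 (w 0))
  refine Eq.trans ?_ h4
  simp [Matrix.vecMul, dotProduct, h1]

variable [IsManifold (𝓡 4) ∞ M]

theorem CartanComponents.Nondegenerate.inChart {C : CartanComponents M} (hN : C.Nondegenerate)
    {x₀ : M} {y : E4} (hy : y ∈ (extChartAt (𝓡 4) x₀).target) :
    LinearIndependent ℝ fun a => DForm.inChart (C.Va a 0) x₀ y := by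
  refine Fintype.linearIndependent_iff.2 fun c hc => ?_
  refine Fintype.linearIndependent_iff.1 (hN ((extChartAt (𝓡 4) x₀).symm y)) c ?_
  have h0 : ∀ (z : M) (w : Fin 1 → TangentSpace (𝓡 4) z),
      (∑ a, c a • C.Va a 0 z) w = ∑ a, c a • C.Va a 0 z w := fun z w => by
    rw [ContinuousAlternatingMap.sum_apply]
    rfl
  have h1 : DForm.inChart (fun z => ∑ a, c a • C.Va a 0 z) x₀ y =
      DForm.inChart (0 : DForm M 1) x₀ y := by
    refine Eq.trans ?_ (hc.trans (DForm.inChart_zero x₀ y).symm)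
    refine ContinuousAlternatingMap.ext fun v => ?_
    rw [ContinuousAlternatingMap.sum_apply]
    exact h0 _ fun i => symmDeriv x₀ y (v i)
  exact DForm.eq_of_inChart_eq hy h1

omit [IsManifold (𝓡 4) ∞ M] in
theorem volCoeff_inChart (η : DForm M 4) (x₀ : M) (y : E4) : volCoeff (DForm.inChart η x₀ y) =
    η ((extChartAt (𝓡 4) x₀).symm y)
      (fun j => symmDeriv x₀ y (EuclideanSpace.single j (1 : ℝ))) := rfl

/-- The classical volume form of a nondegenerate vierbein vanishes nowhere. -/
theorem volCoeff_vol₀_ne_zero {G : GammaMatrices} {C : CartanComponents M}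
    (hC : IsCartanGeometry G C) (hN : C.Nondegenerate) {x₀ : M} {y : E4}
    (hy : y ∈ (extChartAt (𝓡 4) x₀).target) : volCoeff (DForm.inChart C.vol₀ x₀ y) ≠ 0 := by
  have h := vol₀_apply C ((extChartAt (𝓡 4) x₀).symm y)
    fun j => symmDeriv x₀ y (EuclideanSpace.single j (1 : ℝ))
  have h0 : C.frameDet ((extChartAt (𝓡 4) x₀).symm y)
      (fun j => symmDeriv x₀ y (EuclideanSpace.single j (1 : ℝ))) = (Matrix.of fun a j : Fin 4 =>
        DForm.inChart (C.Va a 0) x₀ y (fun _ => EuclideanSpace.single j (1 : ℝ))).det := by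
    refine congrArg Matrix.det ?_
    ext a j
    rfl
  have h1 : volCoeff (DForm.inChart C.vol₀ x₀ y) = 24 * (Matrix.of fun a j : Fin 4 =>
      DForm.inChart (C.Va a 0) x₀ y (fun _ => EuclideanSpace.single j (1 : ℝ))).det := by
    rw [← h0]
    exact (volCoeff_inChart C.vol₀ x₀ y).trans h
  rw [h1]
  exact mul_ne_zero (by norm_num) (det_ne_zero_of_real (hN.inChart hy)
    fun a v => hC.conj_Va_zero a _ fun i => symmDeriv x₀ y (v i))

omit [IsManifold (𝓡 4) ∞ M] in
theorem isSmooth_vol₀ {G : GammaMatrices} {C : CartanComponents M} (hC : IsCartanGeometry G C) :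
    DForm.IsSmooth C.vol₀ := by
  have hs : ∀ f : Fin 4 → DForm M 4, (∀ a, DForm.IsSmooth (f a)) → DForm.IsSmooth (∑ a, f a) :=
    fun f hf => Finset.sum_induction f DForm.IsSmooth (fun _ _ => DForm.IsSmooth.add)
      DForm.isSmooth_zero fun a _ => hf a
  have h := fun a => hC.smooth_Va a 0
  exact hs _ fun a => hs _ fun b => hs _ fun c => hs _ fun d =>
    ((((h a).wedge (h b)).wedge (h c)).wedge (h d)).smul _

end Nondegeneracy

/-! ### Nondegeneracy of the classical and of the deformed inner product -/

section Definiteness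

open Set MeasureTheory

variable {M : Type*} [TopologicalSpace M] [ChartedSpace E4 M]

/-- The extension by zero of a function on the preferred chart at `x₀`. -/
def extendByZero (x₀ : M) (g : E4 → ℝ) : M → ℝ :=
  (extChartAt (𝓡 4) x₀).source.indicator (g ∘ extChartAt (𝓡 4) x₀)

theorem extendByZero_symm {x₀ : M} (g : E4 → ℝ) {y : E4}
    (hy : y ∈ (extChartAt (𝓡 4) x₀).target) :
    extendByZero x₀ g ((extChartAt (𝓡 4) x₀).symm y) = g y := by
  rw [extendByZero, indicator_of_mem ((extChartAt (𝓡 4) x₀).map_target hy), Function.comp_apply,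
    (extChartAt (𝓡 4) x₀).right_inv hy]

/-- The compact subset of `M` outside of which `extendByZero x₀ g` vanishes. -/
theorem isCompact_symm_image {x₀ : M} {g : E4 → ℝ} (hg : HasCompactSupport g)
    (hgU : tsupport g ⊆ (extChartAt (𝓡 4) x₀).target) :
    IsCompact ((extChartAt (𝓡 4) x₀).symm '' tsupport g) :=
  hg.isCompact.image_of_continuousOn ((continuousOn_extChartAt_symm x₀).mono hgU)

theorem extendByZero_eq_zero {x₀ : M} {g : E4 → ℝ} {x : M}
    (hx : x ∉ (extChartAt (𝓡 4) x₀).symm '' tsupport g) : extendByZero x₀ g x = 0 := by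
  by_cases h : x ∈ (extChartAt (𝓡 4) x₀).source
  · rw [extendByZero, indicator_of_mem h, Function.comp_apply]
    by_contra h0
    exact hx ⟨_, subset_tsupport _ h0, (extChartAt (𝓡 4) x₀).left_inv h⟩
  · exact indicator_of_notMem h _

theorem tsupport_extendByZero_subset [T2Space M] {x₀ : M} {g : E4 → ℝ} (hg : HasCompactSupport g)
    (hgU : tsupport g ⊆ (extChartAt (𝓡 4) x₀).target) :
    tsupport (extendByZero x₀ g) ⊆ (extChartAt (𝓡 4) x₀).symm '' tsupport g :=
  closure_minimal (fun _ hx => by_contra fun h => hx (extendByZero_eq_zero h))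
    (isCompact_symm_image hg hgU).isClosed

variable [IsManifold (𝓡 4) ∞ M] [T2Space M]

theorem contMDiff_extendByZero {x₀ : M} {g : E4 → ℝ} (hs : ContDiff ℝ ∞ g)
    (hg : HasCompactSupport g) (hgU : tsupport g ⊆ (extChartAt (𝓡 4) x₀).target) :
    ContMDiff (𝓡 4) 𝓘(ℝ, ℝ) ∞ (extendByZero x₀ g) := by
  refine contMDiff_of_tsupport fun x hx => ?_
  have hx' : x ∈ (extChartAt (𝓡 4) x₀).source := by
    obtain ⟨y, hy, rfl⟩ := tsupport_extendByZero_subset hg hgU hx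
    exact (extChartAt (𝓡 4) x₀).map_target (hgU hy)
  have h1 : ContMDiffAt (𝓡 4) 𝓘(ℝ, ℝ) ∞ (g ∘ extChartAt (𝓡 4) x₀) x :=
    hs.contMDiff.contMDiffAt.comp x (contMDiffAt_extChartAt' (by rwa [← extChartAt_source (𝓡 4)]))
  refine h1.congr_of_eventuallyEq ?_
  filter_upwards [(isOpen_extChartAt_source x₀).mem_nhds hx'] with z hz
  exact indicator_of_mem hz _

/-- A spinor field with one component, supported in a chart. -/
def chartSpinor {x₀ : M} {g : E4 → ℝ} (hs : ContDiff ℝ ∞ g) (hg : HasCompactSupport g)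
    (hgU : tsupport g ⊆ (extChartAt (𝓡 4) x₀).target) (j : Fin 4) :
    C^∞⟮𝓡 4, M; 𝓘(ℝ, Fin 4 → ℂ), Fin 4 → ℂ⟯ :=
  ⟨fun x => extendByZero x₀ g x • Pi.single j (1 : ℂ),
    (contMDiff_extendByZero hs hg hgU).smul contMDiff_const⟩

theorem hasCompactSupport_chartSpinor {x₀ : M} {g : E4 → ℝ} (hs : ContDiff ℝ ∞ g)
    (hg : HasCompactSupport g) (hgU : tsupport g ⊆ (extChartAt (𝓡 4) x₀).target) (j : Fin 4) :
    HasCompactSupport (chartSpinor hs hg hgU j) :=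
  HasCompactSupport.intro (isCompact_symm_image hg hgU) fun x hx => by
    change extendByZero x₀ g x • Pi.single j (1 : ℂ) = (0 : Fin 4 → ℂ)
    rw [extendByZero_eq_zero hx, zero_smul]

variable [SigmaCompactSpace M]

/-- The fundamental lemma of the calculus of variations, in a chart: testing with bump functions
times basis spinors shows that each component of the Dirac adjoint times the volume density vanishes
almost everywhere, hence everywhere by continuity. The density has no zeros. -/
theorem eq_zero_of_classicalInner_eq_zero (hM : OrientedAtlas M) {G : GammaMatrices}
    {C : CartanComponents M} (hC : IsCartanGeometry G C) (hN : C.Nondegenerate)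
    {φ₁ : C^∞⟮𝓡 4, M; 𝓘(ℝ, Fin 4 → ℂ), Fin 4 → ℂ⟯}
    (h : ∀ φ₂ : C^∞⟮𝓡 4, M; 𝓘(ℝ, Fin 4 → ℂ), Fin 4 → ℂ⟯, HasCompactSupport φ₂ →
      classicalInner G C φ₁ φ₂ = 0) : φ₁ = 0 := by
  set w : M → Fin 4 → ℂ := fun x => Matrix.vecMul (fun i => (starRingEnd ℂ) (φ₁ x i)) (G.γ 0)
    with hw
  have hwc : Continuous w := by
    refine Continuous.matrix_vecMul ?_ continuous_const
    exact continuous_pi fun i =>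
      Complex.continuous_conj.comp ((continuous_apply i).comp φ₁.contMDiff.continuous)
  have key : ∀ x j, w x j = 0 := by
    intro x₀ j
    set U := (extChartAt (𝓡 4) x₀).target
    set F : E4 → ℂ := fun y => w ((extChartAt (𝓡 4) x₀).symm y) j *
      volCoeff (DForm.inChart C.vol₀ x₀ y) with hF
    have hU : IsOpen U := isOpen_extChartAt_target x₀
    have hFc : ContinuousOn F U := by
      refine ContinuousOn.mul ?_
        (volCoeff.continuous.comp_continuousOn (isSmooth_vol₀ hC x₀).continuousOn)
      exact ((continuous_apply j).comp hwc).comp_continuousOn (continuousOn_extChartAt_symm x₀)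
    have h1 : ∀ᵐ y, y ∈ U → F y = 0 := by
      refine hU.ae_eq_zero_of_integral_contDiff_smul_eq_zero
        (hFc.locallyIntegrableOn hU.measurableSet) fun g hs hg hgU => ?_
      have h2 := h _ (hasCompactSupport_chartSpinor hs hg hgU j)
      have h3 : ∀ x, Matrix.vecMul (fun i => (starRingEnd ℂ) (φ₁ x i)) (G.γ 0) ⬝ᵥ
          chartSpinor hs hg hgU j x = (extendByZero x₀ g x : ℂ) * w x j := fun x => by
        change w x ⬝ᵥ (extendByZero x₀ g x • Pi.single j (1 : ℂ)) = _
        rw [dotProduct_smul, dotProduct_single_one, Complex.real_smul]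
      have h4 : ∀ y ∈ U, volCoeff (DForm.inChart (fun x =>
          (Matrix.vecMul (fun i => (starRingEnd ℂ) (φ₁ x i)) (G.γ 0) ⬝ᵥ
            chartSpinor hs hg hgU j x) • C.vol₀ x) x₀ y) = g y • F y := fun y hy => by
        change (_ : ℂ) * volCoeff (DForm.inChart C.vol₀ x₀ y) = _
        rw [h3, extendByZero_symm g hy, mul_assoc, ← Complex.real_smul]
      rw [classicalInner, DForm.integral_eq_chartIntegral hM (isCompact_symm_image hg hgU)
        (x₀ := x₀)] at h2
      · rw [chartIntegral, setIntegral_congr_fun hU.measurableSet h4] at h2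
        rw [← h2, setIntegral_eq_integral_of_forall_compl_eq_zero]
        intro y hy
        rw [image_eq_zero_of_notMem_tsupport fun hy' => hy (hgU hy'), zero_smul]
      · rintro _ ⟨y, hy, rfl⟩
        exact (extChartAt (𝓡 4) x₀).map_target (hgU hy)
      · intro x hx
        refine ContinuousAlternatingMap.ext fun v => ?_
        change (_ : ℂ) * C.vol₀ x v = 0
        rw [h3, extendByZero_eq_zero hx, Complex.ofReal_zero, zero_mul, zero_mul]
      · exact (hs.continuous.continuousOn.smul hFc).congr h4
    have h5 : EqOn F 0 U := Measure.eqOn_open_of_ae_eq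
      ((ae_restrict_iff' hU.measurableSet).2 h1) hU hFc continuousOn_const
    have h6 := h5 (mem_extChartAt_target (I := 𝓡 4) x₀)
    have h7 := (mul_eq_zero.1 h6).resolve_right
      (volCoeff_vol₀_ne_zero hC hN (mem_extChartAt_target x₀))
    rwa [extChartAt_to_inv] at h7
  ext x i
  -- Since `γ₀² = 1`, the spinor is recovered from its Dirac adjoint.
  have h8 : Matrix.vecMul (w x) (G.γ 0) = 0 := by
    rw [show w x = 0 from funext (key x), Matrix.zero_vecMul]
  rw [hw, Matrix.vecMul_vecMul, G.zero_mul_zero, Matrix.vecMul_one] at h8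
  exact (map_eq_zero _).1 (congrFun h8 i)

variable {ι : Type*} [Fintype ι] (T : Twist M ι)

/-- The coefficient of lowest order of the inner product. -/
theorem coeff_diracInner {G : GammaMatrices} {C : CartanComponents M} (hC : IsCartanGeometry G C)
    {ψ₁ ψ₂ : DiracField M} {n : ℕ} (hψ : ∀ k < n, ψ₁ k = 0) :
    PowerSeries.coeff n (diracInner G T C ψ₁ ψ₂) = classicalInner G C (ψ₁ n) (ψ₂ 0) := by
  rw [diracInner, PowerSeries.coeff_mk, ← DForm.integral_smul, innerForm_leading T hC hψ,
    classicalInner]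

/-- Once `ψ₁` vanishes below order `n`, pairing with a `λ`-independent test field gives at order `n`
the classical pairing with its `n`-th coefficient. -/
theorem eq_zero_of_diracInner_eq_zero (hM : OrientedAtlas M) {G : GammaMatrices}
    {C : CartanComponents M} (hC : IsCartanGeometry G C) (hN : C.Nondegenerate)
    {ψ₁ : DiracField M} (h : ∀ ψ₂ : DiracField M, (∀ n, HasCompactSupport (ψ₂ n)) →
      diracInner G T C ψ₁ ψ₂ = 0) : ψ₁ = 0 := by
  funext n
  induction n using Nat.strong_induction_on with
  | _ n ih =>
    refine eq_zero_of_classicalInner_eq_zero hM hC hN fun φ₂ hφ₂ => ?_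
    -- The test series equals `φ₂` at order `λ⁰` and zero at all other orders.
    have h1 := h (Function.update 0 0 φ₂) fun m => by
      rcases eq_or_ne m 0 with rfl | hm
      · rwa [Function.update_self]
      · rw [Function.update_of_ne hm]
        exact HasCompactSupport.zero
    have h2 := coeff_diracInner T hC (ψ₂ := Function.update 0 0 φ₂) ih
    rw [h1, map_zero, Function.update_self] at h2
    exact h2.symm

end Definiteness

end NCDirac

end

theorem mainTheorem7 {M : Type*} [TopologicalSpace M] [ChartedSpace NCDirac.E4 M]
    [IsManifold (𝓡 4) ∞ M] [T2Space M] [SigmaCompactSpace M]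
    (hM : NCDirac.OrientedAtlas M)
    {ι : Type*} [Fintype ι] (T : NCDirac.Twist M ι) (G : NCDirac.GammaMatrices)
    (C : NCDirac.CartanComponents M) (hC : NCDirac.IsCartanGeometry G C) :
    (∀ ψ₁ ψ₂ : NCDirac.DiracField M, NCDirac.CompactOverlap ψ₁ ψ₂ →
      PowerSeries.map (starRingEnd ℂ) (NCDirac.diracInner G T C ψ₁ ψ₂) =
        NCDirac.diracInner G T C ψ₂ ψ₁) ∧
    (∀ ψ₁ ψ₂ : NCDirac.DiracField M, NCDirac.CompactOverlap ψ₁ ψ₂ →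
      PowerSeries.constantCoeff (NCDirac.diracInner G T C ψ₁ ψ₂) =
        NCDirac.classicalInner G C (ψ₁ 0) (ψ₂ 0)) ∧
    (C.Nondegenerate → ∀ ψ₁ : NCDirac.DiracField M,
      (∀ ψ₂ : NCDirac.DiracField M, (∀ n, HasCompactSupport (ψ₂ n)) →
        NCDirac.diracInner G T C ψ₁ ψ₂ = 0) → ψ₁ = 0) := by
  refine ⟨fun ψ₁ ψ₂ h => NCDirac.conj_diracInner T hM G hC h, fun ψ₁ ψ₂ _ => ?_,
    fun hN ψ₁ h => NCDirac.eq_zero_of_diracInner_eq_zero T hM hC hN h⟩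
  rw [← PowerSeries.coeff_zero_eq_constantCoeff_apply]
  -- Part (b) is the case `n = 0` of the lowest-order formula, where no lower coefficients exist.
  exact NCDirac.coeff_diracInner T hC fun k hk => (Nat.not_lt_zero k hk).elim
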